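/- Let $A$ be a simple infinite-dimensional (not necessarily unital) C*-algebra, let $G$ be a finite group, and let $\alpha\colon G\to\operatorname{Aut}(A)$ be an action with the weak tracial Rokhlin property: for every $\varepsilon>0$, every finite set $F\subseteq A$ and all positive $x,y\in A$ with $\|x\|=1$ there are pairwise orthogonal positive contractions $f_g\in A$, $g\in G$, such that, with $f=\sum_{g} f_g$, one has (i) $\|zf_g-f_gz\|<\varepsilon$ for all $g\in G$ and $z\in F$; (ii) $\|\alpha_g(f_h)-f_{gh}\|<\varepsilon$ for all $g,h\in G$; (iii) $(y^2-yfy-\varepsilon)_+\precsim_A x$, where $s\precsim_A t$ means that there are $w_n\in A\otimes\mathcal K$ with $w_ntw_n^*\to s$ (and $A$ is identified with a corner $A\otimes e_{11}$ of $A\otimes\mathcal K$, $\mathcal K$ being the compact operators on $\ell^2(\mathbb N)$); (iv) $\|fxf\|>1-\varepsilon$. Let $\iota\colon A^\alpha\to A$ and $\kappa\colon A\to A\rtimes_\alpha G$ be the inclusions of the fixed point algebra and of $A$, and use the same symbols for the induced maps $A^\alpha\otimes\mathcal K\to A\otimes\mathcal K\to(A\rtimes_\alpha G)\otimes\mathcal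 K$. Let $u_g$, $g\in G$, be the canonical unitaries in the multiplier algebra of $(A\otimes\mathcal K)\rtimes_{\alpha\otimes\mathrm{id}}G\cong(A\rtimes_\alpha G)\otimes\mathcal K$ and put $p=\frac1{\operatorname{card}(G)}\sum_{g\in G}u_g$. Let $\operatorname{Ped}(B)$ denote the Pedersen ideal, i.e. the smallest dense two-sided ideal, of a C*-algebra $B$. Let $a\in\operatorname{Ped}(A^\alpha\otimes\mathcal K)$ be positive and nonzero, and let $\tau\colon((A\rtimes_\alpha G)\otimes\mathcal K)_+\to[0,\infty]$ be a lower semicontinuous extended trace, i.e. a lower semicontinuous map with $\tau(0)=0$, $\tau(b+c)=\tau(b)+\tau(c)$ and $\tau(tb)=t\,\tau(b)$ for positive $b,c$ and $t>0$, and $\tau(xx^*)=\tau(x^*x)$ for all $x$. Then $(\kappa\circ\iota)(a)$ and $(\kappa\circ\iota)(a)\,p$ are positive elements of $(A\rtimes_\alpha G)\otimes\mathcal K$, and: 1. $\tau\big((\kappa\circ\iota)(a)\,p\big)=\frac1{\operatorname{card}(G)}\,\tau\big((\kappa\circ\iota)(a)\big)$; 2. $d_\tau\big((\kappa\circ\iota)(a)\,p\big)=\frac1{\operatorname{card}(G)}\,d_\tau\big((\kappa\circ\iota)(a)\big)$,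 where $d_\tau(b)=\lim_{n\to\infty}\tau(b^{1/n})$ and the limits exist in $[0,\infty]$ for both elements. -/

import Mathlib

open scoped ENNReal NNReal MultiplierAlgebra
open Filter Topology

noncomputable section

/-! ### Completion of a normed *-algebra satisfying the C*-identity -/

/-- The completion of a complex normed `*`-algebra whose norm satisfies the C*-identity. -/
def CStarCompletion (M : Type*) [NonUnitalNormedRing M] : Type _ := UniformSpace.Completion M

namespace CStarCompletion

open UniformSpace UniformSpace.Completion

section Ring

variable {M : Type*} [NonUnitalNormedRing M]

instance : NormedAddCommGroup (CStarCompletion M) :=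
  inferInstanceAs (NormedAddCommGroup (Completion M))

instance : CompleteSpace (CStarCompletion M) :=
  inferInstanceAs (CompleteSpace (Completion M))

/-- The canonical dense inclusion. -/
def of (x : M) : CStarCompletion M := (x : Completion M)

theorem of_zero : of (0 : M) = 0 := rfl

theorem of_add (x y : M) : of (x + y) = of x + of y := Completion.coe_add x y

theorem norm_of (x : M) : ‖of x‖ = ‖x‖ := Completion.norm_coe x

theorem isDenseInducing_of : IsDenseInducing (of : M → CStarCompletion M) :=
  isDenseInducing_coe

theorem continuous_of : Continuous (of : M → CStarCompletion M) := continuous_coe M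

@[elab_as_elim] theorem dense_ind {p : CStarCompletion M → Prop} (x : CStarCompletion M)
    (hp : IsClosed {x | p x}) (ih : ∀ m, p (of m)) : p x :=
  Completion.induction_on x hp ih

@[elab_as_elim] theorem dense_ind₂ {p : CStarCompletion M → CStarCompletion M → Prop}
    (x y : CStarCompletion M)
    (hp : IsClosed {z : CStarCompletion M × CStarCompletion M | p z.1 z.2})
    (ih : ∀ m n, p (of m) (of n)) : p x y :=
  Completion.induction_on₂ x y hp ih

@[elab_as_elim] theorem dense_ind₃ {p : CStarCompletion M → CStarCompletion M → CStarCompletion M → Prop}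
    (x y z : CStarCompletion M)
    (hp : IsClosed {w : CStarCompletion M × CStarCompletion M × CStarCompletion M |
      p w.1 w.2.1 w.2.2})
    (ih : ∀ m n k, p (of m) (of n) (of k)) : p x y z :=
  Completion.induction_on₃ x y z hp ih

/-- The product is the continuous extension of the product of `M`. -/
instance : Mul (CStarCompletion M) :=
  ⟨Function.curry <| (isDenseInducing_of.prodMap isDenseInducing_of).extend
    (of ∘ Function.uncurry (· * ·))⟩

theorem of_mul (x y : M) : of (x * y) = of x * of y :=
  ((isDenseInducing_of.prodMap isDenseInducing_of).extend_eq
      (continuous_of.comp (continuous_mul (M := M))) (x, y)).symm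

instance : ContinuousMul (CStarCompletion M) where
  continuous_mul := by
    let m := (AddMonoidHom.mul : M →+ M →+ M).compr₂ (toCompl (α := M))
    have : Continuous fun p : M × M => m p.1 p.2 := (continuous_coe M).comp continuous_mul
    have di : IsDenseInducing (toCompl : M → Completion M) := isDenseInducing_coe
    exact (di.extend_Z_bilin di this :)

instance : NonUnitalNormedRing (CStarCompletion M) where
  __ : NormedAddCommGroup (CStarCompletion M) := inferInstance
  __ : Mul (CStarCompletion M) := inferInstance
  zero_mul a := dense_ind a (isClosed_eq (by fun_prop) continuous_const)
    fun a => by rw [← of_zero, ← of_mul, zero_mul]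
  mul_zero a := dense_ind a (isClosed_eq (by fun_prop) continuous_const)
    fun a => by rw [← of_zero, ← of_mul, mul_zero]
  mul_assoc a b c := dense_ind₃ a b c (isClosed_eq (by fun_prop) (by fun_prop))
    fun a b c => by rw [← of_mul, ← of_mul, ← of_mul, ← of_mul, mul_assoc]
  left_distrib a b c := dense_ind₃ a b c (isClosed_eq (by fun_prop) (by fun_prop))
    fun a b c => by rw [← of_add, ← of_mul, ← of_mul, ← of_mul, ← of_add, mul_add]
  right_distrib a b c := dense_ind₃ a b c (isClosed_eq (by fun_prop) (by fun_prop))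
    fun a b c => by rw [← of_add, ← of_mul, ← of_mul, ← of_mul, ← of_add, add_mul]
  norm_mul_le a b := dense_ind₂ a b (isClosed_le (by fun_prop) (by fun_prop))
    fun a b => by rw [← of_mul, norm_of, norm_of, norm_of]; exact norm_mul_le a b

end Ring

section Star

variable {M : Type*} [NonUnitalNormedRing M]

section Module

variable [NormedSpace ℂ M]

instance : NormedSpace ℂ (CStarCompletion M) :=
  inferInstanceAs (NormedSpace ℂ (Completion M))

theorem of_smul (c : ℂ) (x : M) : of (c • x) = c • of x := Completion.coe_smul c x

theorem continuous_const_smul_aux (c : ℂ) :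
    Continuous (fun x : CStarCompletion M => c • x) := continuous_const_smul c

theorem smul_mul_aux [IsScalarTower ℂ M M] (c : ℂ) (x y : CStarCompletion M) :
    (c • x) * y = c • (x * y) := by
  refine dense_ind₂ (p := fun x y => (c • x) * y = c • (x * y)) x y (isClosed_eq ?_ ?_) ?_
  · exact ((continuous_const_smul_aux c).comp continuous_fst).mul continuous_snd
  · exact (continuous_const_smul_aux c).comp (continuous_fst.mul continuous_snd)
  · intro x y
    rw [← of_smul, ← of_mul, ← of_mul, ← of_smul, smul_mul_assoc]

theorem mul_smul_aux [SMulCommClass ℂ M M] (c : ℂ) (x y : CStarCompletion M) :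
    x * (c • y) = c • (x * y) := by
  refine dense_ind₂ (p := fun x y => x * (c • y) = c • (x * y)) x y (isClosed_eq ?_ ?_) ?_
  · exact continuous_fst.mul ((continuous_const_smul_aux c).comp continuous_snd)
  · exact (continuous_const_smul_aux c).comp (continuous_fst.mul continuous_snd)
  · intro x y
    rw [← of_smul, ← of_mul, ← of_mul, ← of_smul, mul_smul_comm]

instance [IsScalarTower ℂ M M] : IsScalarTower ℂ (CStarCompletion M) (CStarCompletion M) where
  smul_assoc c x y := smul_mul_aux c x y

instance [SMulCommClass ℂ M M] : SMulCommClass ℂ (CStarCompletion M) (CStarCompletion M) where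
  smul_comm c x y := (mul_smul_aux c x y).symm

end Module

variable [StarRing M] [CStarRing M]

/-- The involution is the continuous extension of the involution of `M`. -/
instance : Star (CStarCompletion M) := ⟨Completion.map (star : M → M)⟩

theorem of_star (x : M) : of (star x) = star (of x) :=
  (Completion.map_coe (star_isometry (E := M)).uniformContinuous x).symm

instance : ContinuousStar (CStarCompletion M) := ⟨Completion.continuous_map⟩

instance : StarRing (CStarCompletion M) where
  star_involutive x := dense_ind x (isClosed_eq (by fun_prop) (by fun_prop))
    fun x => by rw [← of_star, ← of_star, star_star]
  star_mul x y := dense_ind₂ x y (isClosed_eq (by fun_prop) (by fun_prop))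
    fun x y => by rw [← of_mul, ← of_star, ← of_star, ← of_star, ← of_mul, star_mul]
  star_add x y := dense_ind₂ x y (isClosed_eq (by fun_prop) (by fun_prop))
    fun x y => by rw [← of_add, ← of_star, ← of_star, ← of_star, ← of_add, star_add]

instance : CStarRing (CStarCompletion M) where
  norm_mul_self_le x := dense_ind x (isClosed_le (by fun_prop) (by fun_prop))
    fun x => by
      rw [← of_star, ← of_mul, norm_of, norm_of]
      exact CStarRing.norm_star_mul_self.ge

theorem star_smul_aux [NormedSpace ℂ M] [StarModule ℂ M] (c : ℂ) (x : CStarCompletion M) :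
    star (c • x) = star c • star x := by
  refine dense_ind (p := fun x => star (c • x) = star c • star x) x (isClosed_eq ?_ ?_) ?_
  · exact (continuous_const_smul_aux c).star
  · exact (continuous_const_smul_aux (star c)).comp continuous_star
  · intro x
    rw [← of_smul, ← of_star, ← of_star, ← of_smul, star_smul]

instance [NormedSpace ℂ M] [StarModule ℂ M] : StarModule ℂ (CStarCompletion M) where
  star_smul c x := star_smul_aux c x

instance [NormedSpace ℂ M] [IsScalarTower ℂ M M] [SMulCommClass ℂ M M] [StarModule ℂ M] :
    NonUnitalCStarAlgebra (CStarCompletion M) where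

end Star

end CStarCompletion

/-! ### Matrix amplifications and the stabilization `A ⊗ K` -/

namespace Stabilization



variable {A : Type*} [NonUnitalCStarAlgebra A] [PartialOrder A] [StarOrderedRing A]
variable {B : Type*} [NonUnitalCStarAlgebra B] [PartialOrder B] [StarOrderedRing B]

/-- Extend an `m × m` matrix by zeros, or truncate it, to an `n × n` matrix. -/
def padFun (m n : ℕ) (x : CStarMatrix (Fin m) (Fin m) A) : CStarMatrix (Fin n) (Fin n) A :=
  CStarMatrix.ofMatrix fun i j =>
    if hij : (i : ℕ) < m ∧ (j : ℕ) < m then x ⟨i, hij.1⟩ ⟨j, hij.2⟩ else 0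

set_option linter.unusedSectionVars false in
theorem padFun_apply (m n : ℕ) (x : CStarMatrix (Fin m) (Fin m) A) (i j : Fin n) :
    padFun m n x i j =
      if hij : (i : ℕ) < m ∧ (j : ℕ) < m then x ⟨i, hij.1⟩ ⟨j, hij.2⟩ else 0 := rfl

/-- The upper left corner inclusion `M_m(A) → M_n(A)`, `m ≤ n`, given by padding with zeros. -/
def pad (A : Type*) [NonUnitalCStarAlgebra A] [PartialOrder A] [StarOrderedRing A]
    (m n : ℕ) (h : m ≤ n) :
    CStarMatrix (Fin m) (Fin m) A →⋆ₙₐ[ℂ] CStarMatrix (Fin n) (Fin n) A where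
  toFun x := padFun m n x
  map_smul' c x := by
    ext i j
    simp only [padFun_apply, CStarMatrix.smul_apply]
    split_ifs <;> simp
  map_zero' := by
    ext i j
    simp only [padFun_apply, CStarMatrix.zero_apply]
    split_ifs <;> simp
  map_add' x y := by
    ext i j
    simp only [padFun_apply, CStarMatrix.add_apply]
    split_ifs <;> simp
  map_mul' x y := by
    ext i j
    obtain ⟨d, rfl⟩ := Nat.exists_eq_add_of_le h
    rw [CStarMatrix.mul_apply, Fin.sum_univ_add]
    simp only [padFun_apply]
    by_cases hi : (i : ℕ) < m <;> by_cases hj : (j : ℕ) < m <;>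
      simp [hi, hj, CStarMatrix.mul_apply]
  map_star' x := by
    ext i j
    rw [CStarMatrix.star_apply, padFun_apply, padFun_apply]
    by_cases hi : (i : ℕ) < m <;> by_cases hj : (j : ℕ) < m <;>
      simp [hi, hj, CStarMatrix.star_apply]

theorem pad_apply (m n : ℕ) (h : m ≤ n) (x : CStarMatrix (Fin m) (Fin m) A) (i j : Fin n) :
    pad A m n h x i j =
      if hij : (i : ℕ) < m ∧ (j : ℕ) < m then x ⟨i, hij.1⟩ ⟨j, hij.2⟩ else 0 := rfl

theorem pad_injective (m n : ℕ) (h : m ≤ n) : Function.Injective (pad A m n h) := by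
  intro x y hxy
  ext i j
  have := congrFun (congrFun hxy (Fin.castLE h i)) (Fin.castLE h j)
  simpa [pad_apply] using this

theorem norm_pad (m n : ℕ) (h : m ≤ n) (x : CStarMatrix (Fin m) (Fin m) A) :
    ‖pad A m n h x‖ = ‖x‖ :=
  NonUnitalStarAlgHom.norm_map _ (pad_injective m n h) x

instance : DirectedSystem (fun n : ℕ => CStarMatrix (Fin n) (Fin n) A)
    (fun m n h => pad A m n h) where
  map_self n x := by
    ext i j
    simp [pad_apply]
  map_map k j i hij hjk x := by
    ext r s
    simp only [pad_apply]
    split_ifs <;> first | rfl | omega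

/-- The union `⋃ₙ Mₙ(A)` of matrix algebras along the corner inclusions. -/
abbrev FinMat (A : Type*) [NonUnitalCStarAlgebra A] [PartialOrder A] [StarOrderedRing A] : Type _ :=
  DirectLimit (fun n : ℕ => CStarMatrix (Fin n) (Fin n) A) (pad A)

namespace FinMat

/-- The class in `⋃ₙ Mₙ(A)` of an `n × n` matrix. -/
def mk (n : ℕ) (x : CStarMatrix (Fin n) (Fin n) A) : FinMat A :=
  (⟦⟨n, x⟩⟧ : DirectLimit _ (pad A))

theorem mk_add (n : ℕ) (x y : CStarMatrix (Fin n) (Fin n) A) :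
    mk n (x + y) = mk n x + mk n y := (DirectLimit.add_def (G := fun n : ℕ => CStarMatrix (Fin n) (Fin n) A) (f := pad A) n x y).symm

theorem mk_mul (n : ℕ) (x y : CStarMatrix (Fin n) (Fin n) A) :
    mk n (x * y) = mk n x * mk n y := (DirectLimit.mul_def (G := fun n : ℕ => CStarMatrix (Fin n) (Fin n) A) (f := pad A) n x y).symm

theorem mk_zero (n : ℕ) : mk n (0 : CStarMatrix (Fin n) (Fin n) A) = 0 :=
  (DirectLimit.zero_def (f := pad A) n).symm

theorem mk_smul (n : ℕ) (c : ℂ) (x : CStarMatrix (Fin n) (Fin n) A) :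
    mk n (c • x) = c • mk n x := (DirectLimit.smul_def (G := fun n : ℕ => CStarMatrix (Fin n) (Fin n) A) (f := pad A) n x c).symm

theorem mk_star (n : ℕ) (x : CStarMatrix (Fin n) (Fin n) A) :
    mk n (star x) = star (mk n x) := (DirectLimit.star_def (G := fun n : ℕ => CStarMatrix (Fin n) (Fin n) A) (f := pad A) n x).symm

theorem mk_pad (m n : ℕ) (h : m ≤ n) (x : CStarMatrix (Fin m) (Fin m) A) :
    mk n (pad A m n h x) = mk m x := DirectLimit.mk_apply (F := fun n : ℕ => CStarMatrix (Fin n) (Fin n) A) (f := pad A) m n x h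

@[elab_as_elim] theorem ind {p : FinMat A → Prop} (x : FinMat A) (ih : ∀ n x, p (mk n x)) : p x :=
  DirectLimit.induction (pad A) (C := p) ih x

@[elab_as_elim] theorem ind₂ {p : FinMat A → FinMat A → Prop} (x y : FinMat A)
    (ih : ∀ n x y, p (mk n x) (mk n y)) : p x y :=
  DirectLimit.induction₂ (pad A) (C := p) ih x y

/-- The norm on `⋃ₙ Mₙ(A)` that restricts to the C*-norm on each `Mₙ(A)`. -/
instance : Norm (FinMat A) where
  norm := DirectLimit.lift (pad A) (fun _ x => ‖x‖) fun m n h x => (norm_pad m n h x).symm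

theorem norm_mk (n : ℕ) (x : CStarMatrix (Fin n) (Fin n) A) : ‖mk n x‖ = ‖x‖ := rfl

theorem core : NormedSpace.Core ℂ (FinMat A) where
  norm_nonneg x := ind x fun n x => by rw [norm_mk]; exact norm_nonneg x
  norm_smul c x := ind x fun n x => by rw [← mk_smul, norm_mk, norm_mk, norm_smul]
  norm_triangle x y := ind₂ x y fun n x y => by
    rw [← mk_add, norm_mk, norm_mk, norm_mk]; exact norm_add_le x y
  norm_eq_zero_iff x := ind x fun n x => by
    rw [norm_mk, norm_eq_zero]
    constructor
    · rintro rfl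
      exact mk_zero n
    · intro h
      have h1 : ‖mk n x‖ = ‖mk n (0 : CStarMatrix (Fin n) (Fin n) A)‖ := by rw [h, mk_zero]
      rwa [norm_mk, norm_mk, norm_zero, norm_eq_zero] at h1

instance : NormedAddCommGroup (FinMat A) := NormedAddCommGroup.ofCore core

instance : NonUnitalNormedRing (FinMat A) where
  __ : NonUnitalRing (FinMat A) := inferInstance
  __ : NormedAddCommGroup (FinMat A) := inferInstance
  norm_mul_le x y := ind₂ x y fun n x y => by
    rw [← mk_mul, norm_mk, norm_mk, norm_mk]; exact norm_mul_le x y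

instance : NormedSpace ℂ (FinMat A) := NormedSpace.ofCore core

instance : CStarRing (FinMat A) where
  norm_mul_self_le x := ind x fun n x => by
    rw [← mk_star, ← mk_mul, norm_mk, norm_mk]
    exact CStarRing.norm_star_mul_self.ge

end FinMat

/-- The stabilization `A ⊗ K`, `K` the compact operators on `ℓ²(ℕ)`, as the C*-algebraic
inductive limit of the matrix algebras `Mₙ(A)` along the corner inclusions. -/
def _root_.Stab (A : Type*) [NonUnitalCStarAlgebra A] [PartialOrder A] [StarOrderedRing A] :
    Type _ := CStarCompletion (FinMat A)

instance : NonUnitalCStarAlgebra (Stab A) :=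
  inferInstanceAs (NonUnitalCStarAlgebra (CStarCompletion (FinMat A)))

instance : PartialOrder (Stab A) := CStarAlgebra.spectralOrder _

instance : StarOrderedRing (Stab A) := CStarAlgebra.spectralOrderedRing _

/-- The canonical inclusion `Mₙ(A) → A ⊗ K`. -/
def ofMat (n : ℕ) : CStarMatrix (Fin n) (Fin n) A →⋆ₙₐ[ℂ] Stab A where
  toFun x := CStarCompletion.of (FinMat.mk n x)
  map_smul' c x := by rw [FinMat.mk_smul]; exact CStarCompletion.of_smul c _
  map_zero' := by rw [FinMat.mk_zero]; exact CStarCompletion.of_zero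
  map_add' x y := by rw [FinMat.mk_add]; exact CStarCompletion.of_add _ _
  map_mul' x y := by rw [FinMat.mk_mul]; exact CStarCompletion.of_mul _ _
  map_star' x := by rw [FinMat.mk_star]; exact CStarCompletion.of_star _

theorem ofMat_pad (m n : ℕ) (h : m ≤ n) (x : CStarMatrix (Fin m) (Fin m) A) :
    ofMat n (pad A m n h x) = ofMat m x := by
  change CStarCompletion.of _ = CStarCompletion.of _
  rw [FinMat.mk_pad]

theorem norm_ofMat (n : ℕ) (x : CStarMatrix (Fin n) (Fin n) A) : ‖ofMat n x‖ = ‖x‖ :=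
  (CStarCompletion.norm_of _).trans (FinMat.norm_mk n x)

@[elab_as_elim] theorem ind {p : Stab A → Prop} (x : Stab A) (hp : IsClosed {x | p x})
    (ih : ∀ n x, p (ofMat n x)) : p x :=
  CStarCompletion.dense_ind (p := p) x hp fun m => FinMat.ind m ih

@[elab_as_elim] theorem ind₂ {p : Stab A → Stab A → Prop} (x y : Stab A)
    (hp : IsClosed {z : Stab A × Stab A | p z.1 z.2})
    (ih : ∀ n x y, p (ofMat n x) (ofMat n y)) : p x y :=
  CStarCompletion.dense_ind₂ (p := p) x y hp fun m k => FinMat.ind₂ m k ih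

/-- The corner embedding `A → A ⊗ K`, `a ↦ a ⊗ e₀₀`. -/
def corner (a : A) : Stab A := ofMat 1 (CStarMatrix.ofMatrix fun _ _ => a)

/-- Applying a linear map entrywise to a square matrix. -/
def entrywise (φ : A →ₗ[ℂ] B) (n : ℕ) :
    CStarMatrix (Fin n) (Fin n) A →ₗ[ℂ] CStarMatrix (Fin n) (Fin n) B :=
  CStarMatrix.mapₗ φ

set_option linter.unusedSectionVars false in
theorem entrywise_apply (φ : A →ₗ[ℂ] B) (n : ℕ) (x : CStarMatrix (Fin n) (Fin n) A)
    (i j : Fin n) : entrywise φ n x i j = φ (x i j) := rfl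

/-- The entrywise application of `φ` to the matrices in `⋃ₙ Mₙ(A)`. -/
def FinMat.map (φ : A →ₗ[ℂ] B) : FinMat A →ₗ[ℂ] FinMat B where
  toFun := DirectLimit.map (pad A) (pad B) (fun n x => entrywise φ n x) fun m n h x => by
    ext i j
    simp only [pad_apply, entrywise_apply]
    split_ifs <;> simp
  map_add' x y := FinMat.ind₂ x y fun n x y => by
    rw [← mk_add]
    exact (congrArg (mk n) (map_add (entrywise φ n) x y)).trans (mk_add _ _ _)
  map_smul' c x := FinMat.ind x fun n x => by
    rw [← mk_smul]
    exact (congrArg (mk n) (map_smul (entrywise φ n) c x)).trans (mk_smul _ _ _)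

theorem FinMat.map_mk (φ : A →ₗ[ℂ] B) (n : ℕ) (x : CStarMatrix (Fin n) (Fin n) A) :
    FinMat.map φ (FinMat.mk n x) = FinMat.mk n (entrywise φ n x) := rfl

/-- For a completely contractive linear map `φ : A → B`, the map `φ ⊗ id : A ⊗ K → B ⊗ K`. -/
def amplify (φ : A →ₗ[ℂ] B) (hφ : ∀ n x, ‖entrywise φ n x‖ ≤ ‖x‖) : Stab A →L[ℂ] Stab B :=
  (LinearMap.mkContinuous (FinMat.map φ) 1 fun x => FinMat.ind x fun n x => by
    rw [FinMat.map_mk, FinMat.norm_mk, FinMat.norm_mk, one_mul]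
    exact hφ n x).completion

theorem amplify_ofMat (φ : A →ₗ[ℂ] B) (hφ : ∀ n x, ‖entrywise φ n x‖ ≤ ‖x‖) (n : ℕ)
    (x : CStarMatrix (Fin n) (Fin n) A) :
    amplify φ hφ (ofMat n x) = ofMat n (entrywise φ n x) :=
  ContinuousLinearMap.completion_apply_coe _ _

theorem entrywise_eq (φ : A →⋆ₙₐ[ℂ] B) (n : ℕ) (x : CStarMatrix (Fin n) (Fin n) A) :
    entrywise (φ : A →ₗ[ℂ] B) n x = CStarMatrix.mapₙₐ (n := Fin n) φ x := rfl

theorem norm_entrywise_le (φ : A →⋆ₙₐ[ℂ] B) (n : ℕ) (x : CStarMatrix (Fin n) (Fin n) A) :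
    ‖entrywise (φ : A →ₗ[ℂ] B) n x‖ ≤ ‖x‖ := by
  rw [entrywise_eq]
  exact NonUnitalStarAlgHom.norm_apply_le (CStarMatrix.mapₙₐ (n := Fin n) φ) x

/-- For a `*`-homomorphism `φ : A → B`, the `*`-homomorphism `φ ⊗ id : A ⊗ K → B ⊗ K`. -/
def map (φ : A →⋆ₙₐ[ℂ] B) : Stab A →⋆ₙₐ[ℂ] Stab B where
  toFun := amplify (φ : A →ₗ[ℂ] B) (norm_entrywise_le φ)
  map_smul' c x := by simp
  map_zero' := map_zero _
  map_add' := map_add _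
  map_mul' x y := by
    refine ind₂ (p := fun x y => amplify (φ : A →ₗ[ℂ] B) (norm_entrywise_le φ) (x * y) =
      amplify (φ : A →ₗ[ℂ] B) (norm_entrywise_le φ) x *
        amplify (φ : A →ₗ[ℂ] B) (norm_entrywise_le φ) y) x y
      (isClosed_eq (by fun_prop) (by fun_prop)) fun n x y => ?_
    rw [← map_mul, amplify_ofMat, amplify_ofMat, amplify_ofMat, ← map_mul,
      entrywise_eq, entrywise_eq, entrywise_eq, map_mul]
  map_star' x := by
    refine ind (p := fun x => amplify (φ : A →ₗ[ℂ] B) (norm_entrywise_le φ) (star x) =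
      star (amplify (φ : A →ₗ[ℂ] B) (norm_entrywise_le φ) x)) x
      (isClosed_eq (by fun_prop) (by fun_prop)) fun n x => ?_
    rw [← map_star, amplify_ofMat, amplify_ofMat, ← map_star, entrywise_eq, entrywise_eq,
      map_star]

theorem map_ofMat (φ : A →⋆ₙₐ[ℂ] B) (n : ℕ) (x : CStarMatrix (Fin n) (Fin n) A) :
    map φ (ofMat n x) = ofMat n (CStarMatrix.mapₙₐ (n := Fin n) φ x) :=
  amplify_ofMat (φ : A →ₗ[ℂ] B) (norm_entrywise_le φ) n x

/-! ### Multipliers of `A ⊗ K` of the form `u ⊗ 1` with `u` a unitary multiplier of `A` -/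

theorem norm_entrywise_left (L : A →ₗ[ℂ] A) (hL : ∀ a b, star (L a) * L b = star a * b)
    (n : ℕ) (x : CStarMatrix (Fin n) (Fin n) A) : ‖entrywise L n x‖ ≤ ‖x‖ := by
  have h : star (entrywise L n x) * entrywise L n x = star x * x := by
    ext i j
    simp only [CStarMatrix.mul_apply, CStarMatrix.star_apply, entrywise_apply, hL]
  rw [← sq_le_sq₀ (norm_nonneg _) (norm_nonneg _), sq, sq, ← CStarRing.norm_star_mul_self,
    ← CStarRing.norm_star_mul_self, h]

theorem norm_entrywise_right (R : A →ₗ[ℂ] A) (hR : ∀ a b, R a * star (R b) = a * star b)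
    (n : ℕ) (x : CStarMatrix (Fin n) (Fin n) A) : ‖entrywise R n x‖ ≤ ‖x‖ := by
  have h : entrywise R n x * star (entrywise R n x) = x * star x := by
    ext i j
    simp only [CStarMatrix.mul_apply, CStarMatrix.star_apply, entrywise_apply, hR]
  rw [← sq_le_sq₀ (norm_nonneg _) (norm_nonneg _), sq, sq, ← CStarRing.norm_self_mul_star,
    ← CStarRing.norm_self_mul_star, h]

/-- The multiplier `u ⊗ 1` of `A ⊗ K`, where `u` is the unitary multiplier of `A` with
`u a = L a` and `a u = R a`: it acts on matrices by applying `L` and `R` to each entry. -/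
def unitaryMultiplier (L R : A →ₗ[ℂ] A) (hLR : ∀ a b, R a * b = a * L b)
    (hL : ∀ a b, star (L a) * L b = star a * b) (hR : ∀ a b, R a * star (R b) = a * star b) :
    𝓜(ℂ, Stab A) where
  toProd := (amplify L (norm_entrywise_left L hL), amplify R (norm_entrywise_right R hR))
  central x y := by
    refine ind₂ (p := fun x y => amplify R (norm_entrywise_right R hR) x * y =
      x * amplify L (norm_entrywise_left L hL) y) x y
      (isClosed_eq (by fun_prop) (by fun_prop)) fun n x y => ?_
    rw [amplify_ofMat, amplify_ofMat, ← map_mul, ← map_mul]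
    congr 1
    ext i j
    simp only [CStarMatrix.mul_apply, entrywise_apply, hLR]

end Stabilization

/-- The product `x m ∈ B` of `x ∈ B` and a multiplier `m` of `B`. -/
def mulMultiplier {B : Type*} [NonUnitalCStarAlgebra B] (x : B) (m : 𝓜(ℂ, B)) : B := m.snd x

/-- `mulMultiplier x m` is the product of `x` and `m` in the multiplier algebra. -/
theorem coe_mulMultiplier {B : Type*} [NonUnitalCStarAlgebra B] (x : B) (m : 𝓜(ℂ, B)) :
    ((mulMultiplier x m : B) : 𝓜(ℂ, B)) = (x : 𝓜(ℂ, B)) * m := by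
  ext y
  · simp [mulMultiplier, m.central]
  · have h : ∀ y : B, m.snd (y * x) = y * m.snd x := by
      intro y
      have h1 : ∀ z, (m.snd (y * x) - y * m.snd x) * z = 0 := by
        intro z
        rw [sub_mul, m.central, mul_assoc, mul_assoc, m.central, sub_self]
      have h2 := h1 (star (m.snd (y * x) - y * m.snd x))
      rwa [CStarRing.mul_star_self_eq_zero_iff, sub_eq_zero] at h2
    simp [mulMultiplier, h]

/-! ### Crossed products by finite groups -/

section Action

variable {A : Type*} [NonUnitalCStarAlgebra A]
variable {G : Type*} [Group G]

/-- The fixed point algebra as a `*`-subalgebra of `A`. -/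
def fixedSubalgebra (α : G →* (A ≃⋆ₐ[ℂ] A)) : NonUnitalStarSubalgebra ℂ A where
  carrier := {a | ∀ g, α g a = a}
  add_mem' ha hb g := by rw [map_add, ha g, hb g]
  zero_mem' g := map_zero _
  mul_mem' ha hb g := by rw [map_mul, ha g, hb g]
  smul_mem' c a ha g := by rw [map_smul, ha g]
  star_mem' ha g := by rw [map_star, ha g]

theorem isClosed_fixedSubalgebra (α : G →* (A ≃⋆ₐ[ℂ] A)) :
    IsClosed (fixedSubalgebra α : Set A) := by
  have h : (fixedSubalgebra α : Set A) = ⋂ g, {a | α g a = a} := by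
    ext a
    rw [Set.mem_iInter]
    rfl
  rw [h]
  exact isClosed_iInter fun g =>
    isClosed_eq (StarAlgEquiv.isometry (α g)).continuous continuous_id

/-- The fixed point algebra `A^α`. -/
def FixedPointAlgebra (α : G →* (A ≃⋆ₐ[ℂ] A)) : Type _ := fixedSubalgebra α

namespace FixedPointAlgebra

variable (α : G →* (A ≃⋆ₐ[ℂ] A))

instance : NonUnitalCStarAlgebra (FixedPointAlgebra α) :=
  NonUnitalStarSubalgebra.nonUnitalCStarAlgebra (fixedSubalgebra α)
    (h_closed := isClosed_fixedSubalgebra α)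

instance : PartialOrder (FixedPointAlgebra α) := CStarAlgebra.spectralOrder _

instance : StarOrderedRing (FixedPointAlgebra α) := CStarAlgebra.spectralOrderedRing _

/-- The inclusion `ι : A^α → A`. -/
def incl : FixedPointAlgebra α →⋆ₙₐ[ℂ] A :=
  NonUnitalStarSubalgebraClass.subtype (fixedSubalgebra α)

end FixedPointAlgebra

section CrossedProduct

variable (α : G →* (A ≃⋆ₐ[ℂ] A))

/-- The operator `∑ g, a_g u_g` on `ℓ²(G, A)` in the regular representation of `(A, G, α)`, where
`(a ξ)(s) = α_{s⁻¹}(a) ξ(s)` and `(u_g ξ)(s) = ξ(g⁻¹ s)`, as a `G × G` matrix over `A`. -/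
def regularRep (a : G → A) : CStarMatrix G G A :=
  CStarMatrix.ofMatrix fun s t => α s⁻¹ (a (s * t⁻¹))

theorem regularRep_apply (a : G → A) (s t : G) :
    regularRep α a s t = α s⁻¹ (a (s * t⁻¹)) := rfl

theorem action_action (g h : G) (a : A) : α g (α h a) = α (g * h) a := by
  rw [map_mul]
  rfl

theorem regularRep_mul [Fintype G] (a b : G → A) :
    regularRep α a * regularRep α b =
      regularRep α fun g => ∑ h, a h * α h (b (h⁻¹ * g)) := by
  ext s t
  rw [CStarMatrix.mul_apply, regularRep_apply, map_sum]
  refine Fintype.sum_equiv ((Equiv.inv G).trans (Equiv.mulLeft s)) _ _ fun r => ?_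
  simp only [Equiv.trans_apply, Equiv.inv_apply, Equiv.coe_mulLeft]
  have h1 : s⁻¹ * (s * r⁻¹) = r⁻¹ := by group
  have h2 : (s * r⁻¹)⁻¹ * (s * t⁻¹) = r * t⁻¹ := by group
  rw [regularRep_apply, regularRep_apply, map_mul (α s⁻¹), action_action, h1, h2]

theorem regularRep_star (a : G → A) :
    star (regularRep α a) = regularRep α fun g => α g (star (a g⁻¹)) := by
  ext s t
  simp only [CStarMatrix.star_apply, regularRep_apply, action_action, ← map_star]
  congr 3 <;> group

theorem mem_range_regularRep (x : CStarMatrix G G A) :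
    x ∈ Set.range (regularRep α) ↔ ∀ r s t, x (s * r) (t * r) = α r⁻¹ (x s t) := by
  constructor
  · rintro ⟨a, rfl⟩ r s t
    have h1 : s * r * (t * r)⁻¹ = s * t⁻¹ := by group
    rw [regularRep_apply, regularRep_apply, action_action, h1, mul_inv_rev]
  · intro h
    refine ⟨fun g => α g (x g 1), ?_⟩
    ext s t
    have := h t (s * t⁻¹) 1
    rw [inv_mul_cancel_right, one_mul] at this
    rw [this, regularRep_apply, action_action]
    congr 2
    group

variable [Fintype G] [PartialOrder A] [StarOrderedRing A]

/-- The crossed product of `A` by the finite group `G` as the `*`-algebra of all operators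
`∑ g, a_g u_g` in the regular representation. -/
def crossedSubalgebra : NonUnitalStarSubalgebra ℂ (CStarMatrix G G A) where
  carrier := Set.range (regularRep α)
  add_mem' := by
    rintro _ _ ⟨a, rfl⟩ ⟨b, rfl⟩
    refine ⟨a + b, ?_⟩
    ext s t
    simp [regularRep_apply]
  zero_mem' := by
    refine ⟨0, ?_⟩
    ext s t
    simp [regularRep_apply]
  mul_mem' := by
    rintro _ _ ⟨a, rfl⟩ ⟨b, rfl⟩
    exact ⟨_, (regularRep_mul α a b).symm⟩
  smul_mem' := by
    rintro c _ ⟨a, rfl⟩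
    refine ⟨c • a, ?_⟩
    ext s t
    simp [regularRep_apply]
  star_mem' := by
    rintro _ ⟨a, rfl⟩
    exact ⟨_, (regularRep_star α a).symm⟩

theorem isClosed_crossedSubalgebra : IsClosed (crossedSubalgebra α : Set (CStarMatrix G G A)) := by
  have h : (crossedSubalgebra α : Set (CStarMatrix G G A)) =
      ⋂ r, ⋂ s, ⋂ t, {x | x (s * r) (t * r) = α r⁻¹ (x s t)} := by
    ext x
    simp only [Set.mem_iInter]
    exact mem_range_regularRep α x
  have hc : ∀ s t : G, Continuous fun x : CStarMatrix G G A => x s t := fun s t =>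
    continuous_apply_apply (ρ := fun _ _ => A) s t
  rw [h]
  exact isClosed_iInter fun r => isClosed_iInter fun s => isClosed_iInter fun t =>
    isClosed_eq (hc _ _) ((StarAlgEquiv.isometry (α r⁻¹)).continuous.comp (hc _ _))

/-- The crossed product `A ⋊_α G` of a C*-algebra by an action of a finite group. -/
def CrossedProduct : Type _ := crossedSubalgebra α

namespace CrossedProduct

instance : NonUnitalCStarAlgebra (CrossedProduct α) :=
  NonUnitalStarSubalgebra.nonUnitalCStarAlgebra (crossedSubalgebra α)
    (h_closed := isClosed_crossedSubalgebra α)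

instance : PartialOrder (CrossedProduct α) := CStarAlgebra.spectralOrder _

instance : StarOrderedRing (CrossedProduct α) := CStarAlgebra.spectralOrderedRing _

/-- The regular representation of `A ⋊_α G`. -/
def toMatrix : CrossedProduct α →⋆ₙₐ[ℂ] CStarMatrix G G A :=
  NonUnitalStarSubalgebraClass.subtype (crossedSubalgebra α)

theorem toMatrix_injective : Function.Injective (toMatrix α) := Subtype.val_injective

/-- The element `∑ g, a_g u_g` of `A ⋊_α G`. -/
def mk (a : G → A) : CrossedProduct α := ⟨regularRep α a, a, rfl⟩

theorem toMatrix_mk (a : G → A) : toMatrix α (mk α a) = regularRep α a := rfl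

theorem exists_mk (x : CrossedProduct α) : ∃ a, x = mk α a := by
  obtain ⟨_, a, rfl⟩ := x
  exact ⟨a, rfl⟩

open Classical in
/-- The inclusion `κ : A → A ⋊_α G`, `a ↦ a u_1`. -/
def incl : A →⋆ₙₐ[ℂ] CrossedProduct α where
  toFun a := mk α (Pi.single 1 a)
  map_smul' c a := by
    apply toMatrix_injective
    ext s t
    simp only [map_smul, CStarMatrix.smul_apply, toMatrix_mk, regularRep_apply, Pi.single_smul,
      Pi.smul_apply, MonoidHom.id_apply]
  map_zero' := by
    apply toMatrix_injective
    ext s t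
    simp only [toMatrix_mk, regularRep_apply, Pi.single_zero, Pi.zero_apply, map_zero,
      CStarMatrix.zero_apply]
  map_add' a b := by
    apply toMatrix_injective
    ext s t
    simp only [map_add, CStarMatrix.add_apply, toMatrix_mk, regularRep_apply, Pi.single_add,
      Pi.add_apply]
  map_mul' a b := by
    apply toMatrix_injective
    rw [map_mul, toMatrix_mk, toMatrix_mk, toMatrix_mk, regularRep_mul]
    congr 1
    ext g
    rw [Finset.sum_eq_single 1]
    · by_cases hg : g = 1
      · subst hg
        simp
      · simp [hg]
    · intro h _ hh
      simp [hh]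
    · simp
  map_star' a := by
    apply toMatrix_injective
    rw [map_star, toMatrix_mk, toMatrix_mk, regularRep_star]
    congr 1
    ext g
    by_cases hg : g = 1
    · subst hg
      simp
    · simp [hg]

/-- Left multiplication by the canonical unitary: `∑ h, a_h u_h ↦ u_g (∑ h, a_h u_h)`. -/
def leftMul (g : G) : CrossedProduct α →ₗ[ℂ] CrossedProduct α where
  toFun x := ⟨CStarMatrix.ofMatrix fun s t => toMatrix α x (g⁻¹ * s) t,
    (mem_range_regularRep α _).2 fun r s t => by
      have h := (mem_range_regularRep α _).1 x.2 r (g⁻¹ * s) t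
      rw [mul_assoc] at h
      exact h⟩
  map_add' x y := rfl
  map_smul' c x := rfl

/-- Right multiplication by the canonical unitary: `∑ h, a_h u_h ↦ (∑ h, a_h u_h) u_g`. -/
def rightMul (g : G) : CrossedProduct α →ₗ[ℂ] CrossedProduct α where
  toFun x := ⟨CStarMatrix.ofMatrix fun s t => toMatrix α x s (g * t),
    (mem_range_regularRep α _).2 fun r s t => by
      have h := (mem_range_regularRep α _).1 x.2 r s (g * t)
      rw [mul_assoc] at h
      exact h⟩
  map_add' x y := rfl
  map_smul' c x := rfl

theorem toMatrix_leftMul (g : G) (x : CrossedProduct α) (s t : G) :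
    toMatrix α (leftMul α g x) s t = toMatrix α x (g⁻¹ * s) t := rfl

theorem toMatrix_rightMul (g : G) (x : CrossedProduct α) (s t : G) :
    toMatrix α (rightMul α g x) s t = toMatrix α x s (g * t) := rfl

theorem leftMul_mk (g : G) (a : G → A) :
    leftMul α g (mk α a) = mk α fun h => α g (a (g⁻¹ * h)) := by
  apply toMatrix_injective
  ext s t
  simp only [toMatrix_leftMul, toMatrix_mk, regularRep_apply, action_action, mul_inv_rev, inv_inv,
    mul_assoc]

theorem rightMul_mk (g : G) (a : G → A) :
    rightMul α g (mk α a) = mk α fun h => a (h * g⁻¹) := by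
  apply toMatrix_injective
  ext s t
  simp only [toMatrix_rightMul, toMatrix_mk, regularRep_apply, mul_inv_rev, mul_assoc]

theorem rightMul_mul (g : G) (x y : CrossedProduct α) :
    rightMul α g x * y = x * leftMul α g y := by
  apply toMatrix_injective
  ext s t
  simp only [map_mul, CStarMatrix.mul_apply, toMatrix_leftMul, toMatrix_rightMul]
  exact Fintype.sum_equiv (Equiv.mulLeft g) _ _ fun r => by simp

theorem star_leftMul_mul (g : G) (x y : CrossedProduct α) :
    star (leftMul α g x) * leftMul α g y = star x * y := by
  apply toMatrix_injective
  ext s t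
  simp only [map_mul, map_star, CStarMatrix.mul_apply, CStarMatrix.star_apply, toMatrix_leftMul]
  exact Fintype.sum_equiv (Equiv.mulLeft g⁻¹) _ _ fun r => by simp

theorem rightMul_mul_star (g : G) (x y : CrossedProduct α) :
    rightMul α g x * star (rightMul α g y) = x * star y := by
  apply toMatrix_injective
  ext s t
  simp only [map_mul, map_star, CStarMatrix.mul_apply, CStarMatrix.star_apply, toMatrix_rightMul]
  exact Fintype.sum_equiv (Equiv.mulLeft g) _ _ fun r => by simp

/-- The canonical unitary `u_g`, as a multiplier of `(A ⋊_α G) ⊗ K ≅ (A ⊗ K) ⋊_{α ⊗ id} G`. -/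
def canonicalUnitary (g : G) : 𝓜(ℂ, Stab (CrossedProduct α)) :=
  Stabilization.unitaryMultiplier (leftMul α g) (rightMul α g) (rightMul_mul α g)
    (star_leftMul_mul α g) (rightMul_mul_star α g)

/-- The averaging projection `p = |G|⁻¹ ∑ g, u_g`. -/
def averagingProjection : 𝓜(ℂ, Stab (CrossedProduct α)) :=
  (Fintype.card G : ℂ)⁻¹ • ∑ g, canonicalUnitary α g

/-- The map `κ ∘ ι : A^α ⊗ K → (A ⋊_α G) ⊗ K` induced by the inclusions
`ι : A^α → A` and `κ : A → A ⋊_α G`. -/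
def stabIncl : Stab (FixedPointAlgebra α) →⋆ₙₐ[ℂ] Stab (CrossedProduct α) :=
  (Stabilization.map (incl α)).comp (Stabilization.map (FixedPointAlgebra.incl α))

end CrossedProduct

end CrossedProduct

end Action

/-! ### Simplicity, the Pedersen ideal, traces and Cuntz comparison -/

/-- A linear subspace of an algebra that is a two-sided ideal. -/
def IsTwoSided {B : Type*} [NonUnitalCStarAlgebra B] (I : Submodule ℂ B) : Prop :=
  ∀ x ∈ I, ∀ b : B, b * x ∈ I ∧ x * b ∈ I

/-- A C*-algebra is simple if it is nonzero and has no nontrivial closed two-sided ideals. -/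
def IsSimpleCStar (B : Type*) [NonUnitalCStarAlgebra B] : Prop :=
  Nontrivial B ∧ ∀ I : Submodule ℂ B, IsTwoSided I → IsClosed (I : Set B) → I = ⊥ ∨ I = ⊤

/-- The Pedersen ideal: the smallest dense two-sided ideal, that is, the intersection of all dense
two-sided ideals. -/
def pedersenIdeal (B : Type*) [NonUnitalCStarAlgebra B] : Submodule ℂ B :=
  sInf {I | IsTwoSided I ∧ Dense (I : Set B)}

/-- `τ` is a lower semicontinuous extended trace on the positive cone of `S`; only the values of
`τ` at positive elements matter. -/
structure IsLscExtendedTrace {S : Type*} [NonUnitalCStarAlgebra S] [PartialOrder S]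
    [StarOrderedRing S] (τ : S → ℝ≥0∞) : Prop where
  map_zero : τ 0 = 0
  map_add : ∀ a b : S, 0 ≤ a → 0 ≤ b → τ (a + b) = τ a + τ b
  map_smul : ∀ (t : ℝ) (a : S), 0 < t → 0 ≤ a → τ (t • a) = ENNReal.ofReal t * τ a
  tracial : ∀ x : S, τ (x * star x) = τ (star x * x)
  lsc : LowerSemicontinuousOn τ {a | 0 ≤ a}

/-- `d_τ(a) = lim_n τ(a^{1/n})`. -/
def dimensionFunction {S : Type*} [NonUnitalCStarAlgebra S] [PartialOrder S]
    [StarOrderedRing S] (τ : S → ℝ≥0∞) (a : S) : ℝ≥0∞ :=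
  limUnder atTop fun n : ℕ => τ (CFC.nnrpow a (n : ℝ≥0)⁻¹)

/-- Cuntz subequivalence `a ≾_A b` for positive `a, b ∈ A ⊗ K`. -/
def CuntzSub {A : Type*} [NonUnitalCStarAlgebra A] [PartialOrder A] [StarOrderedRing A]
    (a b : Stab A) : Prop :=
  ∃ w : ℕ → Stab A, Tendsto (fun n => w n * b * star (w n)) atTop (𝓝 a)

/-- The weak tracial Rokhlin property for an action of a finite group on a (simple) C*-algebra.
Elements of `A` are compared in the sense of Cuntz via `A ≅ A ⊗ e₀₀ ⊆ A ⊗ K`, and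
`(c - ε)₊` is `cfcₙ (fun t => max (t - ε) 0) c`. -/
def HasWeakTracialRokhlinProperty {A : Type*} [NonUnitalCStarAlgebra A] [PartialOrder A]
    [StarOrderedRing A] {G : Type*} [Group G] [Fintype G] (α : G →* (A ≃⋆ₐ[ℂ] A)) : Prop :=
  ∀ ε : ℝ, 0 < ε → ∀ (F : Finset A) (x y : A), 0 ≤ x → 0 ≤ y → ‖x‖ = 1 →
    ∃ f : G → A, (∀ g, 0 ≤ f g ∧ ‖f g‖ ≤ 1) ∧ (∀ g h, g ≠ h → f g * f h = 0) ∧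
      (∀ g, ∀ a ∈ F, ‖a * f g - f g * a‖ < ε) ∧
      (∀ g h, ‖α g (f h) - f (g * h)‖ < ε) ∧
      CuntzSub
        (Stabilization.corner (cfcₙ (fun t : ℝ => max (t - ε) 0) (y * y - y * (∑ g, f g) * y)))
        (Stabilization.corner x) ∧
      1 - ε < ‖(∑ g, f g) * x * (∑ g, f g)‖

end

/-! Write N for the order of G. On fixed elements z ↦ z p is a `*`-homomorphism, so a p is the image
of a under its amplification (`mulMultiplier_stabIncl`). This gives positivity and lets n-th roots
pass through, so statement 2 is statement 1 at a^{1/n} followed by a limit. A lower semicontinuous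
trace on a stabilization is the sum of its values on diagonal entries (`trace_eq_tsum_diagEntry`),
so statement 1 reduces to τ(b ∑ u_g) = τ(b) for positive fixed b in A (`trace_constMk`).

The reason for that equality: let f_g be Rokhlin elements and X = f_1 b^{1/2}. On one side N² p X*X
p = (∑ α_g(X*X)) N p, which is about b N p because ∑ α_g(f_1)² is about a unit on b. On the other
side N² X p X* = N ∑ X α_g(X*) u_g, which is about N X X*, since f_1 is nearly orthogonal to
α_g(f_1) for g ≠ 1. The trace property identifies the two left sides, and N τ(XX*) = τ(∑ α_g(X*X))
is about τ(b).

Traces are not norm continuous, so each approximation needs control. By simplicity, either the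
restriction T of τ to A is infinite on every nonzero positive element, or elements of finite trace
are dense (`infinite_or_dense`). In the first case it suffices to see that τ(b N p) is infinite,
which follows by cutting XX* spectrally (`trace_constMk_eq_top`). In the second case b is replaced
by (b - 2δ)₊, which has a local unit k of finite trace; norm errors are then compressed to multiples
of k² (`trace_constMk_mul_self`). The remainder in the Rokhlin property is Cuntz-below a chosen
element, and its trace is small if that element has a local unit of small trace. Such elements come
from repeated halving (`exists_small_localUnit`), which needs self-adjoint elements ztz of neither
sign; t = f_g - f_h works when g ≠ h (`exists_indefinite`). -/

set_option linter.unusedSectionVars false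

/-! ### Spectral cut-offs and order estimates without a unit -/

section SpectralCut

variable {S : Type*} [NonUnitalCStarAlgebra S] [PartialOrder S] [StarOrderedRing S]

/-- The piecewise linear function that is `0` on `(-∞, δ]` and `1` on `[2δ, ∞)`. -/
noncomputable def cutFun (δ t : ℝ) : ℝ := max 0 (min 1 ((t - δ) / δ))

/-- `spectralCut δ a` is a local unit for `(a - 2δ)₊`, supported where `a ≥ δ`. -/
noncomputable def spectralCut (δ : ℝ) (a : S) : S := cfcₙ (cutFun δ) a

theorem continuous_cutFun (δ : ℝ) : Continuous (cutFun δ) := by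
  unfold cutFun; fun_prop

theorem cutFun_nonneg (δ t : ℝ) : 0 ≤ cutFun δ t := le_max_left _ _

theorem cutFun_le_one (δ t : ℝ) : cutFun δ t ≤ 1 := max_le zero_le_one (min_le_left _ _)

theorem cutFun_eq_zero {δ t : ℝ} (hδ : 0 < δ) (ht : t ≤ δ) : cutFun δ t = 0 :=
  max_eq_left <| (min_le_right _ _).trans <| div_nonpos_of_nonpos_of_nonneg (by linarith) hδ.le

theorem cutFun_eq_one {δ t : ℝ} (hδ : 0 < δ) (ht : 2 * δ ≤ t) : cutFun δ t = 1 := by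
  have : 1 ≤ (t - δ) / δ := by rw [le_div_iff₀ hδ]; linarith
  rw [cutFun, min_eq_left this, max_eq_right zero_le_one]

theorem cutFun_zero {δ : ℝ} (hδ : 0 < δ) : cutFun δ 0 = 0 := cutFun_eq_zero hδ hδ.le

theorem spectralCut_nonneg (δ : ℝ) (a : S) : 0 ≤ spectralCut δ a :=
  cfcₙ_nonneg fun t _ => cutFun_nonneg δ t

theorem isSelfAdjoint_spectralCut (δ : ℝ) (a : S) : IsSelfAdjoint (spectralCut δ a) :=
  (spectralCut_nonneg δ a).isSelfAdjoint

theorem norm_spectralCut_le (δ : ℝ) (a : S) : ‖spectralCut δ a‖ ≤ 1 :=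
  norm_cfcₙ_le fun t _ => by
    rw [Real.norm_of_nonneg (cutFun_nonneg δ t)]
    exact cutFun_le_one δ t

/-- The cut function vanishes for t ≤ δ, negative t included, so the pointwise inequality holds on
the whole line and positivity of a is not needed. -/
theorem smul_spectralCut_mul_self_le {δ : ℝ} (hδ : 0 < δ) {a : S} (ha : IsSelfAdjoint a) :
    δ • (spectralCut δ a * spectralCut δ a) ≤ spectralCut δ a * a * spectralCut δ a := by
  have hc := (continuous_cutFun δ).continuousOn (s := quasispectrum ℝ a)
  have h0 := cutFun_zero hδ
  have e1 : spectralCut δ a * a = cfcₙ (fun t => cutFun δ t * t) a := by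
    conv_lhs => enter [2]; rw [← cfcₙ_id' ℝ a]
    rw [spectralCut, ← cfcₙ_mul ..]
  rw [e1, spectralCut, ← cfcₙ_mul .., ← cfcₙ_mul .., ← cfcₙ_smul ..]
  refine cfcₙ_mono fun t _ => ?_
  rcases le_total t δ with ht | ht
  · simp [cutFun_eq_zero hδ ht]
  · rw [smul_eq_mul]
    nlinarith [mul_nonneg (cutFun_nonneg δ t) (cutFun_nonneg δ t)]

/-- `(a - δ)₊`. -/
noncomputable def posCut (δ : ℝ) (a : S) : S := cfcₙ (fun t : ℝ => max (t - δ) 0) a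

/-- `(a - δ)₊ ^ (1/2)`. -/
noncomputable def sqrtPosCut (δ : ℝ) (a : S) : S := cfcₙ (fun t : ℝ => √(max (t - δ) 0)) a

theorem posCut_nonneg (δ : ℝ) (a : S) : 0 ≤ posCut δ a := cfcₙ_nonneg fun _ _ => le_max_right _ _

theorem sqrtPosCut_nonneg (δ : ℝ) (a : S) : 0 ≤ sqrtPosCut δ a :=
  cfcₙ_nonneg fun _ _ => Real.sqrt_nonneg _

theorem sqrtPosCut_mul_self {δ : ℝ} (hδ : 0 ≤ δ) (a : S) :
    sqrtPosCut δ a * sqrtPosCut δ a = posCut δ a := by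
  have h0 : (fun t : ℝ => √(max (t - δ) 0)) 0 = 0 := by simp [hδ]
  by_cases ha : IsSelfAdjoint a
  · rw [sqrtPosCut, posCut, ← cfcₙ_mul ..]
    exact cfcₙ_congr fun t _ => Real.mul_self_sqrt (le_max_right _ _)
  -- The functional calculus of an element that is not self-adjoint is 0 by default.
  · rw [sqrtPosCut, posCut, cfcₙ_apply_of_not_predicate a ha, cfcₙ_apply_of_not_predicate a ha,
      mul_zero]

theorem spectralCut_mul_sqrtPosCut {δ : ℝ} (hδ : 0 < δ) (a : S) :
    spectralCut δ a * sqrtPosCut (2 * δ) a = sqrtPosCut (2 * δ) a := by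
  have h0 : (fun t : ℝ => √(max (t - 2 * δ) 0)) 0 = 0 := by simp [hδ.le]
  have h1 := cutFun_zero hδ
  have hc := (continuous_cutFun δ).continuousOn (s := quasispectrum ℝ a)
  by_cases ha : IsSelfAdjoint a
  · rw [sqrtPosCut, spectralCut, ← cfcₙ_mul ..]
    refine cfcₙ_congr fun t _ => ?_
    rcases le_total t (2 * δ) with ht | ht
    · simp [max_eq_right (sub_nonpos.2 ht)]
    · simp [cutFun_eq_one hδ ht]
  · rw [sqrtPosCut, cfcₙ_apply_of_not_predicate a ha, mul_zero]

/-- The function min(t₊, δ) supplies u, which stands in for the scalar δ of the unitization. It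
dominates t - (t - δ)₊ = min(t, δ) also for negative t. -/
theorem sub_posCut_le {δ : ℝ} (hδ : 0 ≤ δ) {a : S} (ha : IsSelfAdjoint a) :
    ∃ u : S, IsSelfAdjoint u ∧ ‖u‖ ≤ δ ∧ a - posCut δ a ≤ u := by
  have h0 : (fun t : ℝ => max (t - δ) 0) 0 = 0 := by simp [hδ]
  have h1 : (fun t : ℝ => min (max t 0) δ) 0 = 0 := by simp [hδ]
  refine ⟨cfcₙ (fun t : ℝ => min (max t 0) δ) a, IsSelfAdjoint.cfcₙ, norm_cfcₙ_le fun t _ => ?_, ?_⟩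
  · rw [Real.norm_of_nonneg (le_min (le_max_right _ _) hδ)]
    exact min_le_right _ _
  · conv_lhs => enter [1]; rw [← cfcₙ_id' ℝ a]
    rw [posCut, ← cfcₙ_sub ..]
    refine cfcₙ_mono fun t _ => ?_
    rcases le_total t δ with ht | ht
    · rw [max_eq_right (sub_nonpos.2 ht), sub_zero]
      exact le_min (le_max_left _ _) ht
    · rw [max_eq_left (sub_nonneg.2 ht)]
      exact le_min (by simp [hδ.trans ht, ht]) (by linarith)

theorem posCut_le {δ : ℝ} (hδ : 0 ≤ δ) {a : S} (ha : 0 ≤ a) : posCut δ a ≤ a := by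
  have h0 : (fun t : ℝ => max (t - δ) 0) 0 = 0 := by simp [hδ]
  conv_rhs => rw [← cfcₙ_id' ℝ a]
  refine cfcₙ_mono fun t ht => max_le (by linarith) (quasispectrum_nonneg_of_nonneg a ha t ht)

theorem norm_sub_posCut_le {δ : ℝ} (hδ : 0 ≤ δ) {a : S} (ha : 0 ≤ a) : ‖a - posCut δ a‖ ≤ δ := by
  obtain ⟨u, -, hu, h⟩ := sub_posCut_le hδ ha.isSelfAdjoint
  exact (CStarAlgebra.norm_le_norm_of_nonneg_of_le (sub_nonneg.2 (posCut_le hδ ha)) h).trans hu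

theorem tendsto_posCut {a : S} (ha : 0 ≤ a) {δ : ℕ → ℝ} (hδ : ∀ n, 0 ≤ δ n)
    (h : Tendsto δ atTop (𝓝 0)) : Tendsto (fun n => posCut (δ n) a) atTop (𝓝 a) := by
  rw [tendsto_iff_norm_sub_tendsto_zero]
  refine squeeze_zero (fun _ => norm_nonneg _) (fun n => ?_) h
  rw [norm_sub_rev]
  exact norm_sub_posCut_le (hδ n) ha

/-- The cut is a unit for (a - 2δ)₊; if it vanished, that element would too, and a would have norm
at most 2δ. -/
theorem spectralCut_ne_zero {δ : ℝ} (hδ : 0 < δ) {a : S} (ha : 0 ≤ a) (h : 2 * δ < ‖a‖) :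
    spectralCut δ a ≠ 0 := by
  intro h0
  have h1 := spectralCut_mul_sqrtPosCut hδ a
  have h2 := sqrtPosCut_mul_self (by positivity : 0 ≤ 2 * δ) a
  rw [h0, zero_mul] at h1
  rw [← h1, zero_mul] at h2
  have h3 := norm_sub_posCut_le (by positivity : 0 ≤ 2 * δ) ha
  rw [← h2, sub_zero] at h3
  linarith

theorem conjugate_le_of_norm_le {k u : S} (hk : IsSelfAdjoint k) (hu : IsSelfAdjoint u) {δ : ℝ}
    (h : ‖u‖ ≤ δ) : k * u * k ≤ δ • (k * k) := by
  have h1 := CStarAlgebra.star_left_conjugate_le_norm_smul (a := k) (b := u)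
  rw [hk.star_eq] at h1
  exact h1.trans (smul_le_smul_of_nonneg_right h hk.mul_self_nonneg)

/-- Of the lower bound δ available for s under its cut, replacing s by v costs at most δ/2. -/
theorem smul_spectralCut_mul_self_le_of_norm_sub_le {δ : ℝ} (hδ : 0 < δ) {s v : S}
    (hs : IsSelfAdjoint s) (hv : IsSelfAdjoint v) (h : ‖s - v‖ ≤ δ / 2) :
    (δ / 2) • (spectralCut δ s * spectralCut δ s) ≤ spectralCut δ s * v * spectralCut δ s := by
  have h1 := smul_spectralCut_mul_self_le hδ hs
  have h2 := conjugate_le_of_norm_le (isSelfAdjoint_spectralCut δ s) (hs.sub hv) h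
  rw [mul_sub, sub_mul] at h2
  have h3 : δ • (spectralCut δ s * spectralCut δ s) =
    (δ / 2) • (spectralCut δ s * spectralCut δ s) +
      (δ / 2) • (spectralCut δ s * spectralCut δ s) := by
    rw [← add_smul]; congr 1; ring
  rw [h3] at h1
  have h4 := sub_le_sub h1 h2
  simpa using h4

theorem conjugate_le_conjugate_posCut {ε : ℝ} (hε : 0 ≤ ε) {k q : S} (hk : IsSelfAdjoint k)
    (hq : IsSelfAdjoint q) : k * q * k ≤ k * posCut ε q * k + ε • (k * k) := by
  obtain ⟨u, hu, hn, h⟩ := sub_posCut_le hε hq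
  have h1 := hk.conjugate_le_conjugate h
  rw [mul_sub, sub_mul, sub_le_iff_le_add'] at h1
  exact h1.trans (add_le_add_right (conjugate_le_of_norm_le hk hu hn) _)

end SpectralCut

/-! ### Monotonicity, compression and semicontinuity of extended traces -/

namespace IsLscExtendedTrace

variable {S : Type*} [NonUnitalCStarAlgebra S] [PartialOrder S] [StarOrderedRing S]
variable {S' : Type*} [NonUnitalCStarAlgebra S'] [PartialOrder S'] [StarOrderedRing S']
variable {τ : S → ℝ≥0∞} (hτ : IsLscExtendedTrace τ)
include hτ

theorem mono {a b : S} (ha : 0 ≤ a) (hab : a ≤ b) : τ a ≤ τ b := by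
  have h := hτ.map_add a (b - a) ha (sub_nonneg.2 hab)
  rw [add_sub_cancel] at h
  rw [h]
  exact le_self_add

theorem map_smul' {t : ℝ} (ht : 0 ≤ t) {a : S} (ha : 0 ≤ a) :
    τ (t • a) = ENNReal.ofReal t * τ a := by
  rcases ht.eq_or_lt with rfl | h
  · simp [hτ.map_zero]
  · exact hτ.map_smul t a h ha

theorem map_sum {ι : Type*} (s : Finset ι) (f : ι → S) (hf : ∀ i ∈ s, 0 ≤ f i) :
    τ (∑ i ∈ s, f i) = ∑ i ∈ s, τ (f i) := by
  classical
  induction s using Finset.induction_on with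
  | empty => simp [hτ.map_zero]
  | insert i s hi ih =>
    rw [Finset.sum_insert hi, Finset.sum_insert hi, hτ.map_add _ _ (hf i (by simp))
      (Finset.sum_nonneg fun j hj => hf j (by simp [hj])), ih fun j hj => hf j (by simp [hj])]

theorem comp (φ : S' →⋆ₙₐ[ℂ] S) : IsLscExtendedTrace fun x => τ (φ x) where
  map_zero := by rw [_root_.map_zero, hτ.map_zero]
  map_add a b ha hb := by
    rw [_root_.map_add, hτ.map_add _ _ (map_nonneg φ ha) (map_nonneg φ hb)]
  map_smul t a ht ha := by
    rw [← hτ.map_smul t _ ht (map_nonneg φ ha)]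
    congr 1
    exact _root_.map_smul φ (t : ℂ) a
  tracial x := by simp only [map_mul, map_star, hτ.tracial]
  lsc := hτ.lsc.comp (by fun_prop) fun x hx => map_nonneg φ hx

/-- With v = w², the trace turns x*w · wx into w(xx*)w, which is at most ‖x‖² w². -/
theorem conj_le (x : S) {v : S} (hv : 0 ≤ v) :
    τ (star x * v * x) ≤ ENNReal.ofReal (‖x‖ ^ 2) * τ v := by
  obtain ⟨w, hw, rfl⟩ := CStarAlgebra.nonneg_iff_exists_isSelfAdjoint_and_eq_mul_self.1 hv
  have h1 : star x * (w * w) * x = star (w * x) * (w * x) := by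
    rw [star_mul, hw.star_eq]; simp only [mul_assoc]
  rw [h1, ← hτ.tracial, ← hτ.map_smul' (by positivity) hv]
  refine hτ.mono (mul_star_self_nonneg _) ?_
  have h2 := CStarAlgebra.star_left_conjugate_le_norm_smul (a := w) (b := x * star x)
    (hb := .mul_star_self x)
  rw [hw.star_eq, CStarRing.norm_self_mul_star, ← sq] at h2
  rw [star_mul, hw.star_eq]
  simpa only [mul_assoc] using h2

theorem conj_le_of_norm_le_one {k v : S} (hk : IsSelfAdjoint k) (hk1 : ‖k‖ ≤ 1) (hv : 0 ≤ v) :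
    τ (k * v * k) ≤ τ v := by
  have h := hτ.conj_le k hv
  rw [hk.star_eq] at h
  refine h.trans (mul_le_of_le_one_left' ?_)
  rw [ENNReal.ofReal_le_one]
  exact pow_le_one₀ (norm_nonneg _) hk1

/-- A substitute for norm continuity: a lower bound for the trace passes from s to a norm-close v,
provided s is first replaced by its spectral cut. -/
theorem spectralCut_le {δ : ℝ} (hδ : 0 < δ) {s v : S} (hs : IsSelfAdjoint s) (hv : 0 ≤ v)
    (h : ‖s - v‖ ≤ δ / 2) :
    ENNReal.ofReal (δ / 2) * τ (spectralCut δ s * spectralCut δ s) ≤ τ v := by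
  have hk := isSelfAdjoint_spectralCut δ s
  rw [← hτ.map_smul' (by positivity) hk.mul_self_nonneg]
  exact (hτ.mono (smul_nonneg (by positivity) hk.mul_self_nonneg)
    (smul_spectralCut_mul_self_le_of_norm_sub_le hδ hs hv.isSelfAdjoint h)).trans
    (hτ.conj_le_of_norm_le_one hk (norm_spectralCut_le δ s) hv)

theorem le_of_tendsto {x : S} {u : ℕ → S} (hx : 0 ≤ x) (hu : ∀ n, 0 ≤ u n)
    (h : Tendsto u atTop (𝓝 x)) {C : ℝ≥0∞} (hC : ∀ᶠ n in atTop, τ (u n) ≤ C) : τ x ≤ C := by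
  by_contra! hlt
  have h1 : ∀ᶠ y in 𝓝[{a : S | 0 ≤ a}] x, C < τ y := hτ.lsc x hx C hlt
  have h2 : Tendsto u atTop (𝓝[{a : S | 0 ≤ a}] x) :=
    tendsto_nhdsWithin_iff.2 ⟨h, Eventually.of_forall hu⟩
  obtain ⟨n, hn, hn'⟩ := ((h2.eventually h1).and hC).exists
  exact hn.not_ge hn'

end IsLscExtendedTrace

/-! ### Traces on the stabilization as sums over diagonal entries -/

namespace Stabilization

variable {A : Type*} [NonUnitalCStarAlgebra A] [PartialOrder A] [StarOrderedRing A]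
variable {B : Type*} [NonUnitalCStarAlgebra B] [PartialOrder B] [StarOrderedRing B]

/-- The isomorphism of `A` with its `1 × 1` matrices. -/
def matOne (A : Type*) [NonUnitalCStarAlgebra A] [PartialOrder A] [StarOrderedRing A] :
    A →⋆ₙₐ[ℂ] CStarMatrix (Fin 1) (Fin 1) A where
  toFun a := CStarMatrix.ofMatrix fun _ _ => a
  map_smul' _ _ := rfl
  map_zero' := rfl
  map_add' _ _ := rfl
  map_mul' a b := by
    ext i j
    rw [CStarMatrix.mul_apply, Fin.sum_univ_one]
    rfl
  map_star' _ := rfl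

/-- The corner embedding `A → A ⊗ K` as a `*`-homomorphism. -/
noncomputable def cornerHom (A : Type*) [NonUnitalCStarAlgebra A] [PartialOrder A]
    [StarOrderedRing A] : A →⋆ₙₐ[ℂ] Stab A := (ofMat 1).comp (matOne A)

theorem cornerHom_apply (a : A) : cornerHom A a = corner a := rfl

theorem corner_eq_ofMat {n : ℕ} (hn : 0 < n) (a : A) :
    corner a = ofMat n (CStarMatrix.ofMatrix fun r s : Fin n =>
      if (r : ℕ) = 0 ∧ (s : ℕ) = 0 then a else 0) := by
  rw [corner, ← ofMat_pad 1 n hn]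
  congr 1
  ext r s
  rw [pad_apply]
  change _ = if (r : ℕ) = 0 ∧ (s : ℕ) = 0 then a else 0
  by_cases h : (r : ℕ) = 0 ∧ (s : ℕ) = 0
  · simp only [h.1, h.2]
    rfl
  · simp [h]

theorem map_corner (φ : A →⋆ₙₐ[ℂ] B) (a : A) : map φ (corner a) = corner (φ a) := by
  rw [corner, map_ofMat]
  rfl

/-- The `(i, i)` entry of a matrix, extended by zero. -/
def FinMat.diagEntry (i : ℕ) : FinMat A →ₗ[ℂ] A where
  toFun := DirectLimit.lift (pad A)
    (fun n x => if h : i < n then x ⟨i, h⟩ ⟨i, h⟩ else 0) fun m n h x => by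
      simp only [pad_apply]
      split_ifs <;> first | rfl | omega
  map_add' x y := FinMat.ind₂ x y fun n x y => by
    rw [← mk_add]
    change (if h : i < n then (x + y) ⟨i, h⟩ ⟨i, h⟩ else 0) =
      (if h : i < n then x ⟨i, h⟩ ⟨i, h⟩ else 0) + (if h : i < n then y ⟨i, h⟩ ⟨i, h⟩ else 0)
    split_ifs <;> simp
  map_smul' c x := FinMat.ind x fun n x => by
    rw [← mk_smul]
    change (if h : i < n then (c • x) ⟨i, h⟩ ⟨i, h⟩ else 0) =
      c • (if h : i < n then x ⟨i, h⟩ ⟨i, h⟩ else 0)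
    split_ifs <;> simp

theorem FinMat.diagEntry_mk (i n : ℕ) (x : CStarMatrix (Fin n) (Fin n) A) :
    FinMat.diagEntry i (FinMat.mk n x) = if h : i < n then x ⟨i, h⟩ ⟨i, h⟩ else 0 := rfl

theorem FinMat.norm_diagEntry_le (i : ℕ) (x : FinMat A) : ‖FinMat.diagEntry i x‖ ≤ 1 * ‖x‖ :=
  FinMat.ind x fun n x => by
    rw [FinMat.diagEntry_mk, FinMat.norm_mk, one_mul]
    split_ifs
    · exact CStarMatrix.norm_entry_le_norm
    · simp

/-- The `(i, i)` entry of an element of `A ⊗ K`. -/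
noncomputable def diagEntry (i : ℕ) : Stab A →L[ℂ] A :=
  (LinearMap.mkContinuous (FinMat.diagEntry i) 1 (FinMat.norm_diagEntry_le i)).fromCompletion

theorem diagEntry_ofMat (i n : ℕ) (x : CStarMatrix (Fin n) (Fin n) A) :
    diagEntry i (ofMat n x) = if h : i < n then x ⟨i, h⟩ ⟨i, h⟩ else 0 :=
  (ContinuousLinearMap.fromCompletion_apply_coe _ _).trans (FinMat.diagEntry_mk i n x)

theorem diagEntry_map (φ : A →⋆ₙₐ[ℂ] B) (i : ℕ) (x : Stab A) :
    diagEntry i (map φ x) = φ (diagEntry i x) := by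
  refine ind (p := fun x => diagEntry i (map φ x) = φ (diagEntry i x)) x
    (isClosed_eq (by fun_prop) (by fun_prop)) fun n x => ?_
  rw [map_ofMat, diagEntry_ofMat, diagEntry_ofMat]
  split_ifs
  · rfl
  · rw [map_zero]

/-- Left multiplication of a matrix by the matrix unit `e_{0i}`. -/
def shiftMat (i n : ℕ) (x : CStarMatrix (Fin n) (Fin n) A) : CStarMatrix (Fin n) (Fin n) A :=
  CStarMatrix.ofMatrix fun r s => if h : (r : ℕ) = 0 ∧ i < n then x ⟨i, h.2⟩ s else 0

theorem shiftMat_apply (i n : ℕ) (x : CStarMatrix (Fin n) (Fin n) A) (r s : Fin n) :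
    shiftMat i n x r s = if h : (r : ℕ) = 0 ∧ i < n then x ⟨i, h.2⟩ s else 0 := rfl

/-- The product is e_{0i} x x* e_{i0}, which carries the (i, i) entry of xx* to the corner. For i ≥
n both sides vanish. -/
theorem shiftMat_mul_star (i n : ℕ) (x : CStarMatrix (Fin n) (Fin n) A) :
    ofMat n (shiftMat i n x * star (shiftMat i n x)) = corner (diagEntry i (ofMat n (x * star x))) := by
  rw [diagEntry_ofMat]
  by_cases hi : i < n
  · rw [dif_pos hi, corner_eq_ofMat (n := n) (by omega)]
    congr 1
    ext r s
    rw [CStarMatrix.mul_apply]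
    simp only [CStarMatrix.star_apply, shiftMat_apply, hi, and_true]
    rw [show (CStarMatrix.ofMatrix fun r s : Fin n => if (r : ℕ) = 0 ∧ (s : ℕ) = 0 then
      (x * star x) ⟨i, hi⟩ ⟨i, hi⟩ else 0) r s = if (r : ℕ) = 0 ∧ (s : ℕ) = 0 then
      (x * star x) ⟨i, hi⟩ ⟨i, hi⟩ else 0 from rfl, CStarMatrix.mul_apply]
    by_cases hr : (r : ℕ) = 0 <;> by_cases hs : (s : ℕ) = 0 <;>
      simp [hr, hs, CStarMatrix.star_apply]
  · rw [dif_neg hi, ← cornerHom_apply, map_zero]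
    have : shiftMat i n x = 0 := by
      ext r s
      simp [shiftMat_apply, hi]
    rw [this, zero_mul, map_zero]

theorem norm_corner_le (a : A) : ‖corner a‖ ≤ ‖a‖ :=
  NonUnitalStarAlgHom.norm_apply_le (cornerHom A) a

theorem norm_diagEntry_le (i : ℕ) (x : Stab A) : ‖diagEntry i x‖ ≤ ‖x‖ := by
  refine ind (p := fun x => ‖diagEntry i x‖ ≤ ‖x‖) x
    (isClosed_le (by fun_prop) (by fun_prop)) fun n x => ?_
  rw [diagEntry_ofMat, norm_ofMat]
  split_ifs
  · exact CStarMatrix.norm_entry_le_norm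
  · simp

/-- By the C*-identity it is enough to bound one diagonal entry of xx*. -/
theorem norm_shiftMat_le (i n : ℕ) (x : CStarMatrix (Fin n) (Fin n) A) :
    ‖shiftMat i n x‖ ≤ ‖x‖ := by
  have h : ‖shiftMat i n x‖ * ‖shiftMat i n x‖ ≤ ‖x‖ * ‖x‖ := by
    rw [← CStarRing.norm_self_mul_star, ← CStarRing.norm_self_mul_star, ← norm_ofMat,
      shiftMat_mul_star]
    exact (norm_corner_le _).trans ((norm_diagEntry_le i _).trans (norm_ofMat _ _).le)
  exact abs_le_of_sq_le_sq' (by simpa only [sq] using h) (norm_nonneg _) |>.2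

/-- Left multiplication by `e_{0i}` on `⋃ₙ Mₙ(A)`. -/
def FinMat.shift (i : ℕ) : FinMat A →ₗ[ℂ] FinMat A where
  toFun := DirectLimit.map (pad A) (pad A) (fun n x => shiftMat i n x) fun m n h x => by
    ext r s
    simp only [pad_apply, shiftMat_apply]
    split_ifs <;> first | rfl | omega
  map_add' x y := FinMat.ind₂ x y fun n x y => by
    rw [← mk_add]
    refine (congrArg (mk n) (?_ : shiftMat i n (x + y) = _)).trans (mk_add _ _ _)
    ext r s
    simp only [shiftMat_apply, CStarMatrix.add_apply]
    split_ifs <;> simp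
  map_smul' c x := FinMat.ind x fun n x => by
    rw [← mk_smul]
    refine (congrArg (mk n) (?_ : shiftMat i n (c • x) = _)).trans (mk_smul _ _ _)
    ext r s
    simp only [shiftMat_apply, CStarMatrix.smul_apply]
    split_ifs <;> simp

theorem FinMat.shift_mk (i n : ℕ) (x : CStarMatrix (Fin n) (Fin n) A) :
    FinMat.shift i (FinMat.mk n x) = FinMat.mk n (shiftMat i n x) := rfl

/-- Left multiplication by `1 ⊗ e_{0i}` on `A ⊗ K`. -/
noncomputable def shift (i : ℕ) : Stab A →L[ℂ] Stab A :=
  (LinearMap.mkContinuous (FinMat.shift i) 1 fun x => FinMat.ind x fun n x => by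
    rw [FinMat.shift_mk, FinMat.norm_mk, FinMat.norm_mk, one_mul]
    exact norm_shiftMat_le i n x).completion

theorem shift_ofMat (i n : ℕ) (x : CStarMatrix (Fin n) (Fin n) A) :
    shift i (ofMat n x) = ofMat n (shiftMat i n x) :=
  ContinuousLinearMap.completion_apply_coe _ _

theorem shift_mul_star (i : ℕ) (x : Stab A) :
    shift i x * star (shift i x) = corner (diagEntry i (x * star x)) := by
  have hc : Continuous (corner : A → Stab A) := map_continuous (cornerHom A)
  refine ind (p := fun x => shift i x * star (shift i x) = corner (diagEntry i (x * star x))) x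
    (isClosed_eq (by fun_prop) (by fun_prop)) fun n x => ?_
  rw [shift_ofMat, ← map_star, ← map_mul, ← map_star, ← map_mul, shiftMat_mul_star]

/-- `x* (∑_{i < n} e_{ii}) x`. -/
noncomputable def partialGram (n : ℕ) (x : Stab A) : Stab A :=
  ∑ i ∈ Finset.range n, star (shift i x) * shift i x

/-- The projection ∑_{i<n} e_{ii} is a unit for matrices of size m ≤ n. -/
theorem partialGram_ofMat {m n : ℕ} (h : m ≤ n) (x : CStarMatrix (Fin m) (Fin m) A) :
    partialGram n (ofMat m x) = star (ofMat m x) * ofMat m x := by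
  -- For n = 0 there is no row 0 to shift into, but then the matrix is empty.
  rcases Nat.eq_zero_or_pos n with rfl | hn
  · obtain rfl : m = 0 := by omega
    have : x = 0 := by
      ext i
      exact i.elim0
    simp [this, partialGram]
  · rw [← ofMat_pad m n h x]
    generalize pad A m n h x = x
    simp only [partialGram, shift_ofMat, ← map_star, ← map_mul, ← map_sum]
    congr 1
    have he : ∀ (s : Finset ℕ) (f : ℕ → CStarMatrix (Fin n) (Fin n) A) (r t : Fin n),
        (∑ i ∈ s, f i) r t = ∑ i ∈ s, f i r t := fun s f r t => by
      classical
      induction s using Finset.induction_on with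
      | empty => rfl
      | insert i s hi ih => rw [Finset.sum_insert hi, Finset.sum_insert hi, ← ih]; rfl
    ext r t
    rw [he, Finset.sum_range, CStarMatrix.mul_apply]
    refine Finset.sum_congr rfl fun i _ => ?_
    rw [CStarMatrix.mul_apply, Finset.sum_eq_single ⟨0, hn⟩]
    · simp [CStarMatrix.star_apply, shiftMat_apply]
    · intro j _ hj
      have : (j : ℕ) ≠ 0 := fun h => hj (Fin.ext h)
      simp [CStarMatrix.star_apply, shiftMat_apply, this]
    · simp

theorem partialGram_mono {m n : ℕ} (h : m ≤ n) (x : Stab A) : partialGram m x ≤ partialGram n x :=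
  Finset.sum_le_sum_of_subset_of_nonneg (Finset.range_mono h) fun _ _ _ => star_mul_self_nonneg _

theorem continuous_partialGram (n : ℕ) : Continuous (partialGram n : Stab A → Stab A) := by
  unfold partialGram
  fun_prop

theorem partialGram_nonneg (n : ℕ) (x : Stab A) : 0 ≤ partialGram n x :=
  Finset.sum_nonneg fun _ _ => star_mul_self_nonneg _

theorem partialGram_le (n : ℕ) (x : Stab A) : partialGram n x ≤ star x * x := by
  refine ind (p := fun x => partialGram n x ≤ star x * x) x
    (isClosed_le (continuous_partialGram n) (by fun_prop)) fun m x => ?_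
  rw [← partialGram_ofMat (le_max_right n m)]
  exact partialGram_mono (le_max_left n m) _

theorem partialGram_parallelogram (n : ℕ) (x y : Stab A) :
    partialGram n (x + y) + partialGram n (x - y) =
      (2 : ℕ) • (partialGram n x + partialGram n y) := by
  simp only [partialGram, ← Finset.sum_add_distrib, Finset.smul_sum]
  refine Finset.sum_congr rfl fun i _ => ?_
  simp only [map_add, map_sub, star_add, star_sub, add_mul, mul_add, sub_mul, mul_sub, two_smul]
  abel

/-- The defect D(x) = x*x - x*(∑_{i<n} e_{ii})x is a positive quadratic expression satisfying the
parallelogram law. Approximate x by a matrix y and put z = x - y. Once n is at least the size of y,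
D(y) = 0, so D(x) ≤ 2 D(z) ≤ 2 z*z. -/
theorem tendsto_partialGram (x : Stab A) :
    Tendsto (fun n => partialGram n x) atTop (𝓝 (star x * x)) := by
  rw [Metric.tendsto_atTop]
  intro ε hε
  -- With δ ≤ 1 the final bound 2‖z‖² is at most 2δ ≤ ε/2.
  let δ := min 1 (ε / 4)
  have hδ : 0 < δ := lt_min one_pos (by positivity)
  have hd : ∃ m, ∃ x0 : CStarMatrix (Fin m) (Fin m) A, ‖x - ofMat m x0‖ < δ := by
    by_contra! hcon
    refine absurd (ind (p := fun z => δ ≤ ‖x - z‖) x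
      (isClosed_le continuous_const (by fun_prop)) fun n y => hcon n y) ?_
    simpa using hδ
  obtain ⟨m, x0, h0⟩ := hd
  refine ⟨m, fun n hn => ?_⟩
  set y := ofMat m x0
  set z := x - y
  have hx : y + z = x := add_sub_cancel _ _
  have h1 : star x * x - partialGram n x ≤ (2 : ℕ) • (star z * z) := by
    have hpar := partialGram_parallelogram n y z
    have hpar' : star (y + z) * (y + z) + star (y - z) * (y - z) =
        (2 : ℕ) • (star y * y + star z * z) := by
      simp only [star_add, star_sub, add_mul, mul_add, sub_mul, mul_sub, two_smul]
      abel
    have e : star x * x - partialGram n x = (2 : ℕ) • (star z * z) -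
        ((star (y - z) * (y - z) - partialGram n (y - z)) + (2 : ℕ) • partialGram n z) := by
      rw [hx] at hpar hpar'
      rw [partialGram_ofMat hn] at hpar
      rw [eq_sub_of_add_eq hpar, eq_sub_of_add_eq hpar']
      simp only [smul_add]
      abel
    rw [e]
    exact sub_le_self _ (add_nonneg (sub_nonneg.2 (partialGram_le n _))
      (nsmul_nonneg (partialGram_nonneg n z) 2))
  rw [dist_comm, dist_eq_norm]
  have h2 := CStarAlgebra.norm_le_norm_of_nonneg_of_le (sub_nonneg.2 (partialGram_le n x)) h1
  have h3 : ‖(2 : ℕ) • (star z * z)‖ ≤ 2 * ‖z‖ ^ 2 := by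
    refine (norm_nsmul_le).trans ?_
    rw [CStarRing.norm_star_mul_self, sq]
    norm_num
  have h4 : ‖z‖ ^ 2 ≤ δ * 1 := by
    rw [sq]
    exact mul_le_mul h0.le (h0.le.trans (min_le_left _ _)) (norm_nonneg _) hδ.le
  have h5 : δ ≤ ε / 4 := min_le_right _ _
  linarith

/-- For x = y² the trace property exchanges the corner element of the i-th diagonal entry with the
i-th summand of `partialGram`. The partial sums lie below x and converge to it, so monotonicity
gives one inequality and lower semicontinuity the other. -/
theorem trace_eq_tsum_diagEntry {τ : Stab A → ℝ≥0∞} (hτ : IsLscExtendedTrace τ) {x : Stab A}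
    (hx : 0 ≤ x) : τ x = ∑' i, τ (corner (diagEntry i x)) := by
  obtain ⟨y, hy, rfl⟩ := CStarAlgebra.nonneg_iff_exists_isSelfAdjoint_and_eq_mul_self.1 hx
  have h : ∀ i, τ (corner (diagEntry i (y * y))) = τ (star (shift i y) * shift i y) := fun i => by
    rw [← hτ.tracial, shift_mul_star, hy.star_eq]
  have hs : ∀ n, ∑ i ∈ Finset.range n, τ (corner (diagEntry i (y * y))) = τ (partialGram n y) :=
    fun n => by
      rw [partialGram, hτ.map_sum _ _ fun i _ => star_mul_self_nonneg _]
      exact Finset.sum_congr rfl fun i _ => h i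
  have hlim := tendsto_partialGram y
  rw [hy.star_eq] at hlim
  refine le_antisymm ?_ ?_
  · refine hτ.le_of_tendsto hx (fun n => partialGram_nonneg n y) hlim
      (Eventually.of_forall fun n => ?_)
    rw [← hs]
    exact ENNReal.sum_le_tsum _
  · rw [ENNReal.tsum_eq_iSup_nat]
    refine iSup_le fun n => ?_
    rw [hs]
    have := partialGram_le n y
    rw [hy.star_eq] at this
    exact hτ.mono (partialGram_nonneg n y) this

end Stabilization

theorem IsLscExtendedTrace.map_nsmul {S : Type*} [NonUnitalCStarAlgebra S] [PartialOrder S]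
    [StarOrderedRing S] {τ : S → ℝ≥0∞} (hτ : IsLscExtendedTrace τ) (n : ℕ) {a : S} (ha : 0 ≤ a) :
    τ (n • a) = n * τ a := by
  have h := hτ.map_sum (Finset.range n) (fun _ => a) fun _ _ => ha
  simpa using h

/-! ### Sums over orbits of the action -/

section OrbitSum

variable {A : Type*} [NonUnitalCStarAlgebra A] [PartialOrder A] [StarOrderedRing A]
variable {G : Type*} [Group G] [Fintype G] (α : G →* (A ≃⋆ₐ[ℂ] A))

theorem action_inv_apply (g : G) (x : A) : α g ((α g)⁻¹ x) = x := by
  change (α g * (α g)⁻¹) x = x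
  rw [mul_inv_cancel]
  rfl

/-- The sum of the translates of `x` under the action. -/
def orbitSum (x : A) : A := ∑ g, α g x

theorem action_orbitSum (g : G) (x : A) : α g (orbitSum α x) = orbitSum α x := by
  simp only [orbitSum, map_sum, action_action]
  exact Fintype.sum_equiv (Equiv.mulLeft g) _ _ fun _ => rfl

theorem orbitSum_of_fixed {x : A} (hx : ∀ g, α g x = x) : orbitSum α x = Fintype.card G • x := by
  simp [orbitSum, hx]

theorem action_nonneg (g : G) {x : A} (hx : 0 ≤ x) : 0 ≤ α g x := map_nonneg (α g) hx

theorem norm_action (g : G) (x : A) : ‖α g x‖ = ‖x‖ :=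
  NonUnitalStarAlgHom.norm_map (α g) (α g).injective x

theorem orbitSum_nonneg {x : A} (hx : 0 ≤ x) : 0 ≤ orbitSum α x :=
  Finset.sum_nonneg fun g _ => action_nonneg α g hx

theorem orbitSum_add (x y : A) : orbitSum α (x + y) = orbitSum α x + orbitSum α y := by
  simp [orbitSum, Finset.sum_add_distrib]

theorem orbitSum_sub (x y : A) : orbitSum α (x - y) = orbitSum α x - orbitSum α y := by
  simp [orbitSum, Finset.sum_sub_distrib]

theorem orbitSum_mono {x y : A} (h : x ≤ y) : orbitSum α x ≤ orbitSum α y := by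
  rw [← sub_nonneg, ← orbitSum_sub]
  exact orbitSum_nonneg α (sub_nonneg.2 h)

theorem action_cfc {g : G} {f : ℝ → ℝ} (hf : Continuous f) (h0 : f 0 = 0) {x : A}
    (hx : IsSelfAdjoint x) (hg : α g x = x) : α g (cfcₙ f x) = cfcₙ f x := by
  have hc : Continuous (α g) := (StarAlgEquiv.isometry (α g)).continuous
  have h := NonUnitalStarAlgHomClass.map_cfcₙ (S := ℂ) (α g) f x hf.continuousOn h0 hc hx
    (by rw [hg]; exact hx)
  rwa [hg] at h

end OrbitSum

/-! ### Algebra and traces in the crossed product -/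

namespace CrossedProduct

variable {A : Type*} [NonUnitalCStarAlgebra A] [PartialOrder A] [StarOrderedRing A]
variable {G : Type*} [Group G] [Fintype G] (α : G →* (A ≃⋆ₐ[ℂ] A))

theorem mk_add (a b : G → A) : mk α (a + b) = mk α a + mk α b := by
  apply toMatrix_injective
  ext s t
  simp [toMatrix_mk, regularRep_apply]

theorem mk_smul (c : ℂ) (a : G → A) : mk α (c • a) = c • mk α a := by
  apply toMatrix_injective
  ext s t
  simp [toMatrix_mk, regularRep_apply]

/-- `mk` as a linear map. -/
def mkₗ : (G → A) →ₗ[ℂ] CrossedProduct α where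
  toFun := mk α
  map_add' := mk_add α
  map_smul' := mk_smul α

theorem mkₗ_apply (a : G → A) : mkₗ α a = mk α a := rfl

theorem mk_mul_mk (a b : G → A) :
    mk α a * mk α b = mk α fun g => ∑ h, a h * α h (b (h⁻¹ * g)) := by
  apply toMatrix_injective
  rw [map_mul, toMatrix_mk, toMatrix_mk, toMatrix_mk, regularRep_mul]

theorem star_mk (a : G → A) : star (mk α a) = mk α fun g => α g (star (a g⁻¹)) := by
  apply toMatrix_injective
  rw [map_star, toMatrix_mk, toMatrix_mk, regularRep_star]

open Classical in
theorem incl_eq (a : A) : incl α a = mk α (Pi.single 1 a) := rfl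

theorem incl_mul_mk (x : A) (a : G → A) : incl α x * mk α a = mk α fun g => x * a g := by
  classical
  rw [incl_eq, mk_mul_mk]
  congr 1
  ext g
  rw [Finset.sum_eq_single 1]
  · simp
  · intro h _ hh
    simp [hh]
  · simp

theorem mk_mul_incl (x : A) (a : G → A) : mk α a * incl α x = mk α fun g => a g * α g x := by
  classical
  rw [incl_eq, mk_mul_mk]
  congr 1
  ext g
  rw [Finset.sum_eq_single g]
  · simp
  · intro h _ hh
    rw [Pi.single_eq_of_ne, map_zero, mul_zero]
    rw [Ne, inv_mul_eq_one]
    exact hh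
  · simp

-- The C*-identity applies because (x u_g)(x u_g)* = xx* lies in the image of A.
open Classical in
theorem norm_mk_single_le (g : G) (x : A) : ‖mk α (Pi.single g x)‖ ≤ ‖x‖ := by
  have h : mk α (Pi.single g x) * star (mk α (Pi.single g x)) = incl α (x * star x) := by
    rw [star_mk, mk_mul_mk, incl_eq]
    congr 1
    ext s
    rw [Finset.sum_eq_single g]
    · by_cases hs : s = 1
      · subst hs
        simp [action_inv_apply]
      · have : s⁻¹ * g ≠ g := by simpa using hs
        simp [hs, this]
    · intro h _ hh
      simp [hh]
    · simp
  have h2 := NonUnitalStarAlgHom.norm_apply_le (incl α) (x * star x)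
  rw [← h, CStarRing.norm_self_mul_star, CStarRing.norm_self_mul_star] at h2
  exact abs_le_of_sq_le_sq' (by simpa only [sq] using h2) (norm_nonneg _) |>.2

theorem norm_mk_le (a : G → A) : ‖mk α a‖ ≤ ∑ g, ‖a g‖ := by
  classical
  have h : mk α a = ∑ g, mk α (Pi.single g (a g)) := by
    simp only [← mkₗ_apply, ← map_sum, Finset.univ_sum_single]
  rw [h]
  exact (norm_sum_le _ _).trans (Finset.sum_le_sum fun g _ => norm_mk_single_le α g (a g))

/-- `constMk x = ∑ g, x u_g`, that is, `x` times `|G| p`. -/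
def constMk (x : A) : CrossedProduct α := mk α fun _ => x

theorem constMk_add (x y : A) : constMk α (x + y) = constMk α x + constMk α y :=
  mk_add α (fun _ => x) (fun _ => y)

theorem constMk_smul (c : ℂ) (x : A) : constMk α (c • x) = c • constMk α x :=
  mk_smul α c (fun _ => x)

/-- `constMk` as a linear map. -/
def constMkₗ : A →ₗ[ℂ] CrossedProduct α where
  toFun := constMk α
  map_add' := constMk_add α
  map_smul' := constMk_smul α

theorem constMk_sub (x y : A) : constMk α (x - y) = constMk α x - constMk α y :=
  map_sub (constMkₗ α) x y

theorem constMk_nsmul (n : ℕ) (x : A) : constMk α (n • x) = n • constMk α x :=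
  map_nsmul (constMkₗ α) n x

theorem continuous_constMk : Continuous (constMk α) :=
  AddMonoidHomClass.continuous_of_bound (constMkₗ α) (Fintype.card G) fun x =>
    (norm_mk_le α _).trans (by simp)

/-- Since `constMk` multiplies by N p, this is the formula p w p = N⁻¹ (∑ α_g(w)) p with w = x*z. -/
theorem star_constMk_mul (x z : A) :
    star (constMk α x) * constMk α z = constMk α (orbitSum α (star x * z)) := by
  rw [constMk, star_mk, constMk, mk_mul_mk]
  simp [constMk, orbitSum]

theorem constMk_mul_star (x z : A) :
    constMk α x * star (constMk α z) = Fintype.card G • mk α fun g => x * α g (star z) := by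
  rw [constMk, constMk, star_mk, mk_mul_mk, ← mkₗ_apply, ← mkₗ_apply, ← map_nsmul]
  congr 1
  ext g
  simp [action_inv_apply]

theorem constMk_orbitSum_nonneg {q : A} (hq : 0 ≤ q) : 0 ≤ constMk α (orbitSum α q) := by
  obtain ⟨w, rfl⟩ := CStarAlgebra.nonneg_iff_eq_star_mul_self.1 hq
  rw [← star_constMk_mul]
  exact star_mul_self_nonneg _

/-- A fixed q has orbit sum N q, so the positivity of `constMk` on orbit sums can be divided by N.
-/
theorem constMk_nonneg {q : A} (hq : 0 ≤ q) (hf : ∀ g, α g q = q) : 0 ≤ constMk α q := by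
  have h := constMk_orbitSum_nonneg α hq
  rw [orbitSum_of_fixed α hf, constMk_nsmul] at h
  have h2 : constMk α q = ((Fintype.card G : ℝ)⁻¹) • (Fintype.card G • constMk α q) := by
    rw [← Nat.cast_smul_eq_nsmul ℝ, smul_smul, inv_mul_cancel₀ (by simp), one_smul]
  rw [h2]
  exact smul_nonneg (by positivity) h

theorem mk_mul_action_nonneg (x : A) : 0 ≤ mk α fun g => x * α g (star x) := by
  have h : 0 ≤ constMk α x * star (constMk α x) := mul_star_self_nonneg _
  rw [constMk_mul_star] at h
  have h2 : (mk α fun g => x * α g (star x)) =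
      ((Fintype.card G : ℝ)⁻¹) • (Fintype.card G • mk α fun g => x * α g (star x)) := by
    rw [← Nat.cast_smul_eq_nsmul ℝ, smul_smul, inv_mul_cancel₀ (by simp), one_smul]
  rw [h2]
  exact smul_nonneg (by positivity) h

theorem isSelfAdjoint_mk_mul_action (x : A) : IsSelfAdjoint (mk α fun g => x * α g (star x)) :=
  (mk_mul_action_nonneg α x).isSelfAdjoint

section Trace

variable {τ : CrossedProduct α → ℝ≥0∞} (hτ : IsLscExtendedTrace τ)
include hτ

/-- For x = y² one has α_g(x) = (u_g y)(u_g y)*, and the trace property cancels the unitary. -/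
theorem trace_incl_action (g : G) {x : A} (hx : 0 ≤ x) :
    τ (incl α (α g x)) = τ (incl α x) := by
  classical
  obtain ⟨y, hy, rfl⟩ := CStarAlgebra.nonneg_iff_exists_isSelfAdjoint_and_eq_mul_self.1 hx
  have h1 : incl α (α g (y * y)) = leftMul α g (incl α y) * star (leftMul α g (incl α y)) := by
    rw [incl_eq, incl_eq, leftMul_mk, star_mk, mk_mul_mk]
    congr 1
    ext s
    rw [Finset.sum_eq_single g]
    · by_cases hs : s = 1
      · subst hs
        simp [action_inv_apply, ← map_star, hy.star_eq]
      · have : g⁻¹ * (s⁻¹ * g) ≠ 1 := by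
          rw [← mul_assoc, Ne, mul_eq_one_iff_eq_inv]
          simpa using hs
        simp [hs, this]
    · intro h _ hh
      have : g⁻¹ * h ≠ 1 := by rw [Ne, inv_mul_eq_one]; exact fun e => hh e.symm
      simp [this]
    · simp
  rw [h1, hτ.tracial, star_leftMul_mul, ← map_star, ← map_mul, hy.star_eq]

theorem trace_incl_orbitSum {x : A} (hx : 0 ≤ x) :
    τ (incl α (orbitSum α x)) = Fintype.card G * τ (incl α x) := by
  rw [orbitSum, map_sum, hτ.map_sum _ _ fun g _ => map_nonneg _ (action_nonneg α g hx)]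
  simp [trace_incl_action α hτ _ hx]

/-- The trace property applied to N X p: its two squares are N² p X*X p and N² X p X*. This identity
links averaging over the orbit with the nearly diagonal element ∑ X α_g(X*) u_g. -/
theorem trace_constMk_orbitSum (x : A) :
    τ (constMk α (orbitSum α (star x * x))) =
      Fintype.card G * τ (mk α fun g => x * α g (star x)) := by
  rw [← star_constMk_mul, ← hτ.tracial, constMk_mul_star, hτ.map_nsmul _ (mk_mul_action_nonneg α x)]

/-- With q = w², the trace property leads to N² w p w, and w p w ≤ w² because p is a projection. -/
theorem trace_constMk_orbitSum_le {q : A} (hq : 0 ≤ q) :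
    τ (constMk α (orbitSum α q)) ≤ (Fintype.card G : ℝ≥0∞) ^ 2 * τ (incl α q) := by
  obtain ⟨w, hw, rfl⟩ := CStarAlgebra.nonneg_iff_exists_isSelfAdjoint_and_eq_mul_self.1 hq
  have hS : constMk α w * star (constMk α w) =
      Fintype.card G • (incl α w * star (constMk α w)) := by
    rw [constMk_mul_star, constMk, star_mk, incl_mul_mk]
  have hS' : constMk α w * star (constMk α w) =
      Fintype.card G • (constMk α w * incl α w) := by
    have := congrArg star hS
    simpa [← map_star, hw.star_eq] using this
  have h1 : constMk α w * star (constMk α w) ≤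
      Fintype.card G ^ 2 • (incl α (w * w)) := by
    -- This element is N² w(1 - p)w, so its positivity expresses p ≤ 1 without using multipliers.
    have h2 : 0 ≤ (Fintype.card G • incl α w - constMk α w) *
      star (Fintype.card G • incl α w - constMk α w) := mul_star_self_nonneg _
    have h3 : (Fintype.card G • incl α w - constMk α w) *
      star (Fintype.card G • incl α w - constMk α w) =
        Fintype.card G ^ 2 • (incl α (w * w)) - constMk α w * star (constMk α w) := by
      rw [star_sub, star_nsmul, ← map_star, hw.star_eq, sub_mul, mul_sub, mul_sub,
        smul_mul_assoc, smul_mul_assoc, ← hS, mul_smul_comm (Fintype.card G) (constMk α w), ← hS',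
        mul_smul_comm, smul_smul, ← map_mul, ← sq]
      abel
    rw [h3] at h2
    exact sub_nonneg.1 h2
  have h4 := star_constMk_mul α w w
  rw [hw.star_eq] at h4
  rw [← h4, ← hτ.tracial]
  refine (hτ.mono (mul_star_self_nonneg _) h1).trans ?_
  rw [hτ.map_nsmul _ (map_nonneg _ hq)]
  simp

end Trace

end CrossedProduct

/-! ### Local units and sums of orthogonal contractions -/

section LocalUnit

variable {S : Type*} [NonUnitalCStarAlgebra S] [PartialOrder S] [StarOrderedRing S]

/-- The elements for which a self-adjoint `c` acts as a two-sided unit. -/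
def localUnitSubalgebra (c : S) (hc : IsSelfAdjoint c) : NonUnitalStarSubalgebra ℝ S where
  carrier := {x | c * x = x ∧ x * c = x}
  add_mem' := by
    rintro x y ⟨h1, h2⟩ ⟨h3, h4⟩
    exact ⟨by rw [mul_add, h1, h3], by rw [add_mul, h2, h4]⟩
  zero_mem' := ⟨mul_zero c, zero_mul c⟩
  mul_mem' := by
    rintro x y ⟨h1, -⟩ ⟨-, h4⟩
    exact ⟨by rw [← mul_assoc, h1], by rw [mul_assoc, h4]⟩
  smul_mem' := by
    rintro t x ⟨h1, h2⟩
    exact ⟨by rw [mul_smul_comm, h1], by rw [smul_mul_assoc, h2]⟩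
  star_mem' := by
    rintro x ⟨h1, h2⟩
    refine ⟨?_, ?_⟩
    · have := congrArg star h2
      rwa [star_mul, hc.star_eq] at this
    · have := congrArg star h1
      rwa [star_mul, hc.star_eq] at this

/-- The elements for which c is a unit form a closed `*`-subalgebra, hence one containing all that
the functional calculus makes from s. -/
theorem cfc_of_local_unit {c s : S} (hc : IsSelfAdjoint c) (hs : IsSelfAdjoint s) (h : c * s = s)
    (f : ℝ → ℝ) : c * cfcₙ f s = cfcₙ f s ∧ cfcₙ f s * c = cfcₙ f s := by
  have hcl : IsClosed (localUnitSubalgebra c hc : Set S) := by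
    have : (localUnitSubalgebra c hc : Set S) = {x | c * x = x} ∩ {x | x * c = x} := rfl
    rw [this]
    exact (isClosed_eq (by fun_prop) continuous_id).inter (isClosed_eq (by fun_prop) continuous_id)
  have hm : s ∈ localUnitSubalgebra c hc := by
    refine ⟨h, ?_⟩
    have := congrArg star h
    rwa [star_mul, hc.star_eq, hs.star_eq] at this
  exact NonUnitalStarAlgebra.elemental.le_of_mem hcl hm (cfcₙ_mem_elemental f s)

theorem mul_self_le_self {f : S} (hf : 0 ≤ f) (h1 : ‖f‖ ≤ 1) : f * f ≤ f := by
  obtain ⟨r, hr, rfl⟩ := CStarAlgebra.nonneg_iff_exists_isSelfAdjoint_and_eq_mul_self.1 hf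
  have h := conjugate_le_of_norm_le hr hf.isSelfAdjoint h1
  rw [one_smul] at h
  simpa only [mul_assoc] using h

/-- With f the sum, orthogonality removes the cross terms, so f² = ∑ f_g² ≤ f and therefore ‖f‖² ≤
‖f‖. -/
theorem norm_sum_le_one_of_orthogonal {ι : Type*} [Fintype ι] {f : ι → S}
    (hf : ∀ g, 0 ≤ f g ∧ ‖f g‖ ≤ 1) (ho : ∀ g h, g ≠ h → f g * f h = 0) :
    (∑ g, f g) * (∑ g, f g) = ∑ g, f g * f g ∧ (∑ g, f g) * (∑ g, f g) ≤ ∑ g, f g ∧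
      ‖∑ g, f g‖ ≤ 1 := by
  classical
  have h1 : (∑ g, f g) * (∑ g, f g) = ∑ g, f g * f g := by
    rw [Finset.sum_mul_sum]
    refine Finset.sum_congr rfl fun g _ => ?_
    rw [Finset.sum_eq_single g]
    · intro h _ hh
      exact ho g h hh.symm
    · simp
  have h2 : (∑ g, f g) * (∑ g, f g) ≤ ∑ g, f g := by
    rw [h1]
    exact Finset.sum_le_sum fun g _ => mul_self_le_self (hf g).1 (hf g).2
  refine ⟨h1, h2, ?_⟩
  have hs : IsSelfAdjoint (∑ g, f g) := (Finset.sum_nonneg fun g _ => (hf g).1).isSelfAdjoint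
  have h3 := CStarAlgebra.norm_le_norm_of_nonneg_of_le hs.mul_self_nonneg h2
  have h4 := CStarRing.norm_star_mul_self (x := ∑ g, f g)
  rw [hs.star_eq] at h4
  rw [h4] at h3
  by_contra! hlt
  nlinarith

theorem norm_mul_le_of_le_left {x y : S} {C : ℝ} (hx : ‖x‖ ≤ C) (hy : ‖y‖ ≤ 1) : ‖x * y‖ ≤ C :=
  (norm_mul_le x y).trans <| (mul_le_mul hx hy (norm_nonneg _) ((norm_nonneg _).trans hx)).trans
    (mul_one C).le

theorem norm_mul_le_of_le_right {x y : S} {C : ℝ} (hx : ‖x‖ ≤ 1) (hy : ‖y‖ ≤ C) : ‖x * y‖ ≤ C :=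
  (norm_mul_le x y).trans <| (mul_le_mul hx hy (norm_nonneg _) zero_le_one).trans
    (one_mul C).le

end LocalUnit

/-! ### Simplicity and almost central contractions -/

section AsymptoticIdeal

variable {A : Type*} [NonUnitalCStarAlgebra A]

/-- `b` is small against every almost central contraction against which `r` is small. -/
def AsymptoticallyDominated (r b : A) : Prop :=
  ∀ η : ℝ, 0 < η → ∃ ε : ℝ, 0 < ε ∧ ∃ F : Finset A, ∀ f : A, ‖f‖ ≤ 1 →
    (∀ z ∈ F, ‖z * f - f * z‖ < ε) → ‖r * f‖ < ε → ‖b * f‖ < η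

theorem AsymptoticallyDominated.add {r b c : A} (hb : AsymptoticallyDominated r b)
    (hc : AsymptoticallyDominated r c) : AsymptoticallyDominated r (b + c) := by
  classical
  intro η hη
  obtain ⟨ε₁, h₁, F₁, H₁⟩ := hb (η / 2) (by positivity)
  obtain ⟨ε₂, h₂, F₂, H₂⟩ := hc (η / 2) (by positivity)
  refine ⟨min ε₁ ε₂, lt_min h₁ h₂, F₁ ∪ F₂, fun f hf hz hr => ?_⟩
  have e₁ := H₁ f hf (fun z h => (hz z (by simp [h])).trans_le (min_le_left _ _))
    (hr.trans_le (min_le_left _ _))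
  have e₂ := H₂ f hf (fun z h => (hz z (by simp [h])).trans_le (min_le_right _ _))
    (hr.trans_le (min_le_right _ _))
  rw [add_mul]
  linarith [norm_add_le (b * f) (c * f)]

theorem AsymptoticallyDominated.mul_left {r b : A} (hb : AsymptoticallyDominated r b) (c : A) :
    AsymptoticallyDominated r (c * b) := by
  intro η hη
  have hc : 0 < ‖c‖ + 1 := by positivity
  obtain ⟨ε, h, F, H⟩ := hb (η / (‖c‖ + 1)) (by positivity)
  refine ⟨ε, h, F, fun f hf hz hr => ?_⟩
  have e := H f hf hz hr
  rw [lt_div_iff₀ hc] at e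
  rw [mul_assoc]
  nlinarith [norm_mul_le c (b * f), norm_nonneg (b * f), norm_nonneg c]

theorem AsymptoticallyDominated.smul {r b : A} (hb : AsymptoticallyDominated r b) (c : ℂ) :
    AsymptoticallyDominated r (c • b) := by
  intro η hη
  have hc : 0 < ‖c‖ + 1 := by positivity
  obtain ⟨ε, h, F, H⟩ := hb (η / (‖c‖ + 1)) (by positivity)
  refine ⟨ε, h, F, fun f hf hz hr => ?_⟩
  have e := H f hf hz hr
  rw [lt_div_iff₀ hc] at e
  rw [smul_mul_assoc, norm_smul]
  nlinarith [norm_nonneg (b * f), norm_nonneg c]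

theorem AsymptoticallyDominated.mul_right {r b : A} (hb : AsymptoticallyDominated r b) (c : A) :
    AsymptoticallyDominated r (b * c) := by
  classical
  intro η hη
  have hc : 0 < ‖c‖ + 1 := by positivity
  have hb' : 0 < ‖b‖ + 1 := by positivity
  obtain ⟨ε, h, F, H⟩ := hb (η / 2 / (‖c‖ + 1)) (by positivity)
  refine ⟨min ε (η / 2 / (‖b‖ + 1)), lt_min h (by positivity), insert c F, fun f hf hz hr => ?_⟩
  have e := H f hf (fun z h => (hz z (by simp [h])).trans_le (min_le_left _ _))
    (hr.trans_le (min_le_left _ _))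
  have e2 := (hz c (by simp)).trans_le (min_le_right _ _)
  rw [lt_div_iff₀ hc] at e
  rw [lt_div_iff₀ hb'] at e2
  -- Almost centrality is what makes the dominated elements a right ideal: c joins the finite set so
  -- that f can be moved past it.
  have e3 : b * c * f = b * f * c + b * (c * f - f * c) := by
    rw [mul_sub]; simp only [mul_assoc]; abel
  rw [e3]
  have := norm_add_le (b * f * c) (b * (c * f - f * c))
  nlinarith [norm_mul_le (b * f) c, norm_mul_le b (c * f - f * c), norm_nonneg (b * f),
    norm_nonneg c, norm_nonneg b, norm_nonneg (c * f - f * c)]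

/-- The elements asymptotically dominated by `r`. -/
def asymptoticIdeal (r : A) : Submodule ℂ A where
  carrier := {b | AsymptoticallyDominated r b}
  add_mem' := AsymptoticallyDominated.add
  zero_mem' := fun η hη => ⟨1, one_pos, ∅, fun f _ _ _ => by simpa using hη⟩
  smul_mem' c _ hb := hb.smul c

theorem isClosed_asymptoticIdeal (r : A) : IsClosed (asymptoticIdeal r : Set A) := by
  refine isClosed_of_closure_subset fun b hb η hη => ?_
  obtain ⟨c, hc, hbc⟩ := Metric.mem_closure_iff.1 hb (η / 2) (by positivity)
  obtain ⟨ε, h, F, H⟩ := hc (η / 2) (by positivity)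
  refine ⟨ε, h, F, fun f hf hz hr => ?_⟩
  have e := H f hf hz hr
  rw [dist_eq_norm] at hbc
  have e2 : b * f = (b - c) * f + c * f := by rw [sub_mul, sub_add_cancel]
  rw [e2]
  nlinarith [norm_add_le ((b - c) * f) (c * f), norm_mul_le (b - c) f, norm_nonneg (b - c)]

/-- The dominated elements form a closed two-sided ideal containing r ≠ 0, so simplicity makes it
everything. -/
theorem IsSimpleCStar.asymptoticallyDominated (hA : IsSimpleCStar A) {r : A} (hr : r ≠ 0) (b : A) :
    AsymptoticallyDominated r b := by
  have hmem : r ∈ asymptoticIdeal r := fun η hη => ⟨η, hη, ∅, fun f _ _ h => h⟩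
  rcases hA.2 (asymptoticIdeal r) (fun x hx c => ⟨hx.mul_left c, hx.mul_right c⟩)
    (isClosed_asymptoticIdeal r) with h | h
  · rw [h, Submodule.mem_bot] at hmem
    exact absurd hmem hr
  · have : b ∈ asymptoticIdeal r := h ▸ Submodule.mem_top
    exact this

end AsymptoticIdeal

/-! ### Elements of neither sign from the Rokhlin property -/

section Splitting

variable {A : Type*} [NonUnitalCStarAlgebra A] [PartialOrder A] [StarOrderedRing A]
variable {G : Type*} [Group G] [Fintype G] {α : G →* (A ≃⋆ₐ[ℂ] A)}

/-- One has ‖rp‖² = ‖pzp‖ and (pzp)² ≤ p(zpz)p ≤ p(zqz)p. Since pq = 0, the factor pzq equals (pz -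
zp)q, which is small. -/
theorem norm_mul_pow_four_le {r z p q : A} (hr : IsSelfAdjoint r) (hz : r * r = z) (hp : 0 ≤ p)
    (hp1 : ‖p‖ ≤ 1) (hq1 : ‖q‖ ≤ 1) (hpq : p * q = 0) {ε : ℝ}
    (hε : ‖z * p - p * z‖ ≤ ε) (hle : z * p * z ≤ z * q * z) : ‖r * p‖ ^ 4 ≤ ε * ‖z‖ := by
  have hps := hp.isSelfAdjoint
  have hzs : IsSelfAdjoint z := hz ▸ hr.mul_self_nonneg.isSelfAdjoint
  have e1 : ‖p * z * p‖ = ‖r * p‖ ^ 2 := by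
    rw [sq, ← CStarRing.norm_star_mul_self, star_mul, hps.star_eq, hr.star_eq, ← hz]
    simp only [mul_assoc]
  have hsa : IsSelfAdjoint (p * z * p) := hzs.conjugate_self hps
  have e2 : ‖p * z * p‖ ^ 2 = ‖p * z * p * (p * z * p)‖ := by
    rw [sq, ← CStarRing.norm_star_mul_self, hsa.star_eq]
  have e3 : p * z * p * (p * z * p) ≤ p * (z * q * z) * p := by
    have h1 := (hzs.conjugate_le_conjugate (mul_self_le_self hp hp1)).trans hle
    have h2 := hps.conjugate_le_conjugate h1
    simpa only [mul_assoc] using h2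
  have e4 : p * (z * q * z) * p = (p * z - z * p) * q * z * p := by
    rw [sub_mul, mul_assoc z p q, hpq, mul_zero, sub_zero]
    simp only [mul_assoc]
  have e5 := CStarAlgebra.norm_le_norm_of_nonneg_of_le hsa.mul_self_nonneg e3
  rw [← e2, e1, e4] at e5
  rw [norm_sub_rev] at hε
  calc ‖r * p‖ ^ 4 = (‖r * p‖ ^ 2) ^ 2 := by ring
    _ ≤ ‖(p * z - z * p) * q * z * p‖ := e5
    _ ≤ ‖(p * z - z * p) * q * z‖ := norm_mul_le_of_le_left le_rfl hp1
    _ ≤ ‖(p * z - z * p) * q‖ * ‖z‖ := norm_mul_le _ _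
    _ ≤ ε * ‖z‖ := mul_le_mul_of_nonneg_right (norm_mul_le_of_le_left hε hq1) (norm_nonneg _)

/-- Take t = f_{g₀} - f_{h₀}. If ztz had a sign, `norm_mul_pow_four_le` would make z^{1/2} f_g small
for one g. By simplicity b f_g would be small for the invariant norm-one element b, and approximate
equivariance would spread this to every b f_k. Then fbf would be small, against condition (iv). -/
theorem HasWeakTracialRokhlinProperty.exists_indefinite (hA : IsSimpleCStar A)
    (hα : HasWeakTracialRokhlinProperty α) {g₀ h₀ : G} (hgh : g₀ ≠ h₀) {z : A} (hz : 0 ≤ z)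
    (hz0 : z ≠ 0) : ∃ t : A, IsSelfAdjoint t ∧ ¬ 0 ≤ z * t * z ∧ ¬ z * t * z ≤ 0 := by
  classical
  obtain ⟨r, hr, hrz⟩ := CStarAlgebra.nonneg_iff_exists_isSelfAdjoint_and_eq_mul_self.1 hz
  have hr0 : r ≠ 0 := by
    rintro rfl
    exact hz0 (by rw [hrz, zero_mul])
  have hz' : 0 < ‖z‖ := norm_pos_iff.2 hz0
  have hN : 0 < (Fintype.card G : ℝ) := by simp [Fintype.card_pos]
  have hN1 : 1 ≤ (Fintype.card G : ℝ) := by exact_mod_cast Fintype.card_pos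
  set N : ℝ := (Fintype.card G : ℝ)
  have hs : ‖z‖ ≤ ‖orbitSum α z‖ := by
    refine CStarAlgebra.norm_le_norm_of_nonneg_of_le hz ?_
    have := Finset.single_le_sum (f := fun g => α g z) (fun g _ => action_nonneg α g hz)
      (Finset.mem_univ 1)
    simpa [orbitSum] using this
  have hs' : 0 < ‖orbitSum α z‖ := hz'.trans_le hs
  set b : A := ‖orbitSum α z‖⁻¹ • orbitSum α z with hb
  have hb0 : 0 ≤ b := smul_nonneg (by positivity) (orbitSum_nonneg α hz)
  have hb1 : ‖b‖ = 1 := by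
    rw [hb, norm_smul, norm_inv, norm_norm, inv_mul_cancel₀ hs'.ne']
  have hbf : ∀ g, α g b = b := fun g => by
    have : α g b = ‖orbitSum α z‖⁻¹ • α g (orbitSum α z) :=
      map_smul (α g) ((‖orbitSum α z‖⁻¹ : ℝ) : ℂ) (orbitSum α z)
    rw [this, action_orbitSum]
  -- With an equivariance error of at most 1/(4N), every ‖b f_k‖ is at most 1/(2N), so ‖bf‖ ≤ 1/2,
  -- below 1 - ε ≥ 3/4.
  obtain ⟨ε₁, hε₁, F, hF⟩ := hA.asymptoticallyDominated hr0 b (1 / (4 * N)) (by positivity)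
  have key : ∀ f : G → A, (∀ g, 0 ≤ f g ∧ ‖f g‖ ≤ 1) → (∀ g h, g ≠ h → f g * f h = 0) →
      ∀ ε, ε ≤ ε₁ → ε ≤ 1 / (4 * N) → ε * ‖z‖ < ε₁ ^ 4 →
      (∀ g, ∀ a ∈ insert z F, ‖a * f g - f g * a‖ < ε) →
      (∀ g h, ‖α g (f h) - f (g * h)‖ < ε) → 1 - ε < ‖(∑ g, f g) * b * (∑ g, f g)‖ →
      ∀ g h, g ≠ h → z * f g * z ≤ z * f h * z → False := by
    intro f h1 h2 ε hle1 hle2 hle3 h3 h4 h5 g h hne hcmp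
    have e1 := norm_mul_pow_four_le hr hrz.symm (h1 g).1 (h1 g).2 (h1 h).2 (h2 g h hne)
      (h3 g z (by simp)).le hcmp
    have e2 : ‖r * f g‖ < ε₁ := lt_of_pow_lt_pow_left₀ 4 hε₁.le (e1.trans_lt hle3)
    have e3 := hF (f g) (h1 g).2
      (fun a ha => (h3 g a (by simp [ha])).trans_le hle1) e2
    have e4 : ∀ k, ‖b * f k‖ ≤ 1 / (2 * N) := fun k => by
      have h6 := h4 (k * g⁻¹) g
      rw [inv_mul_cancel_right] at h6
      have h7 : b * f k = α (k * g⁻¹) (b * f g) - b * (α (k * g⁻¹) (f g) - f k) := by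
        rw [map_mul, hbf, mul_sub, sub_sub_cancel]
      have h8 := norm_mul_le_of_le_right hb1.le h6.le
      have h9 := norm_sub_le (α (k * g⁻¹) (b * f g)) (b * (α (k * g⁻¹) (f g) - f k))
      rw [← h7, norm_action] at h9
      have : 1 / (2 * N) = 1 / (4 * N) + 1 / (4 * N) := by field_simp; norm_num
      linarith
    have e5 : ‖b * ∑ g, f g‖ ≤ 1 / 2 := by
      rw [Finset.mul_sum]
      refine (norm_sum_le _ _).trans ((Finset.sum_le_sum fun k _ => e4 k).trans ?_)
      rw [Finset.sum_const, Finset.card_univ, nsmul_eq_mul]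
      apply le_of_eq
      change N * _ = _
      field_simp
    rw [mul_assoc] at h5
    have e6 := norm_mul_le_of_le_right (norm_sum_le_one_of_orthogonal h1 h2).2.2 e5
    have : 1 / (4 * N) ≤ 1 / 4 := by
      apply one_div_le_one_div_of_le <;> linarith
    linarith
  -- The last bound ensures ε‖z‖ < ε₁⁴, which the fourth-power estimate needs; the factor 2 makes it
  -- strict.
  let ε := min ε₁ (min (1 / (4 * N)) (ε₁ ^ 4 / (2 * ‖z‖)))
  have hε : 0 < ε := by positivity
  have hε4 : ε * ‖z‖ < ε₁ ^ 4 := by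
    have : ε ≤ ε₁ ^ 4 / (2 * ‖z‖) := (min_le_right _ _).trans (min_le_right _ _)
    rw [le_div_iff₀ (by positivity)] at this
    nlinarith [pow_pos hε₁ 4, mul_pos hε hz']
  -- The comparison condition plays no part here, so y = 0 is chosen.
  obtain ⟨f, h1, h2, h3, h4, -, h5⟩ := hα ε hε (insert z F) b 0 hb0 le_rfl hb1
  have K := key f h1 h2 ε (min_le_left _ _) ((min_le_right _ _).trans (min_le_left _ _)) hε4 h3 h4 h5
  refine ⟨f g₀ - f h₀, (h1 g₀).1.isSelfAdjoint.sub (h1 h₀).1.isSelfAdjoint, fun h => ?_, fun h => ?_⟩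
  · rw [mul_sub, sub_mul, sub_nonneg] at h
    exact K h₀ g₀ hgh.symm h
  · rw [mul_sub, sub_mul, sub_nonpos] at h
    exact K g₀ h₀ hgh h

end Splitting

/-! ### Local units of small trace and the trace dichotomy -/

section SmallElements

variable {A : Type*} [NonUnitalCStarAlgebra A] [PartialOrder A] [StarOrderedRing A]

/-- A positive contraction that is a unit for some nonzero positive element. -/
def IsLocalUnit (c : A) : Prop :=
  0 ≤ c ∧ ‖c‖ ≤ 1 ∧ ∃ z : A, 0 ≤ z ∧ z ≠ 0 ∧ c * z = z

/-- If every (s - 2δ)₊ vanished, s would lie below elements of arbitrarily small norm, and the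
positive cone is closed. -/
theorem exists_posCut_ne_zero {s : A} (hs : IsSelfAdjoint s) (h : ¬ s ≤ 0) :
    ∃ δ : ℝ, 0 < δ ∧ posCut (2 * δ) s ≠ 0 := by
  by_contra! hcon
  apply h
  have hd : ∀ n : ℕ, 0 < (1 / ((n : ℝ) + 1)) := fun n => by positivity
  have hu : ∀ n : ℕ, ∃ u : A, ‖u‖ ≤ 2 * (1 / ((n : ℝ) + 1)) ∧ s ≤ u := fun n => by
    obtain ⟨u, -, h1, h2⟩ := sub_posCut_le (δ := 2 * (1 / ((n : ℝ) + 1))) (by positivity) hs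
    rw [hcon _ (hd n), sub_zero] at h2
    exact ⟨u, h1, h2⟩
  choose u h1 h2 using hu
  have hlim : Tendsto u atTop (𝓝 0) := by
    refine squeeze_zero_norm h1 ?_
    simpa using (tendsto_one_div_add_atTop_nhds_zero_nat (𝕜 := ℝ)).const_mul 2
  exact ge_of_tendsto' hlim h2

theorem isLocalUnit_spectralCut {δ : ℝ} (hδ : 0 < δ) {s : A} (h : posCut (2 * δ) s ≠ 0) :
    IsLocalUnit (spectralCut δ s) := by
  refine ⟨spectralCut_nonneg δ s, norm_spectralCut_le δ s, posCut (2 * δ) s, posCut_nonneg _ s, h, ?_⟩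
  rw [← sqrtPosCut_mul_self (by positivity), ← mul_assoc, spectralCut_mul_sqrtPosCut hδ]

variable {T : A → ℝ≥0∞} (hT : IsLscExtendedTrace T)
include hT

/-- The cuts of s = ztz and of -s are functions of s with disjoint supports, both nonzero because s
has neither sign. Their squares add up to at most c², so one of them carries at most half the trace.
-/
theorem IsLocalUnit.exists_half
    (hsplit : ∀ z : A, 0 ≤ z → z ≠ 0 → ∃ t : A, IsSelfAdjoint t ∧ ¬ 0 ≤ z * t * z ∧ ¬ z * t * z ≤ 0)
    {c : A} (hc : IsLocalUnit c) : ∃ c' : A, IsLocalUnit c' ∧ T (c' * c') ≤ 2⁻¹ * T (c * c) := by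
  obtain ⟨hc0, hc1, z, hz, hz0, hcz⟩ := hc
  obtain ⟨t, ht, hn, hp⟩ := hsplit z hz hz0
  set s := z * t * z with hs_def
  have hs : IsSelfAdjoint s := ht.conjugate_self hz.isSelfAdjoint
  have hcs : c * s = s := by rw [hs_def, ← mul_assoc, ← mul_assoc, hcz]
  obtain ⟨δ₁, h1, hz1⟩ := exists_posCut_ne_zero hs hp
  obtain ⟨δ₂, h2, hz2⟩ := exists_posCut_ne_zero hs.neg (by rwa [neg_nonpos])
  have hu1 := isLocalUnit_spectralCut h1 hz1
  have hu2 := isLocalUnit_spectralCut h2 hz2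
  have f1 := cutFun_zero h1
  have f2 : (fun t => cutFun δ₂ (-t)) 0 = 0 := by simp [cutFun_zero h2]
  have g1 := (continuous_cutFun δ₁).continuousOn (s := quasispectrum ℝ s)
  have g2 := ((continuous_cutFun δ₂).comp continuous_neg).continuousOn (s := quasispectrum ℝ s)
  have e2 : spectralCut δ₂ (-s) = cfcₙ (fun t => cutFun δ₂ (-t)) s := by
    rw [spectralCut, ← cfcₙ_comp_neg _ s (continuous_cutFun δ₂).continuousOn (cutFun_zero h2) hs]
  have hg2 : ContinuousOn (fun t => cutFun δ₂ (-t)) (quasispectrum ℝ s) := g2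
  set u := spectralCut δ₁ s * spectralCut δ₁ s + spectralCut δ₂ (-s) * spectralCut δ₂ (-s) with hu
  have eu : u = cfcₙ (fun t => cutFun δ₁ t * cutFun δ₁ t + cutFun δ₂ (-t) * cutFun δ₂ (-t)) s := by
    rw [hu, e2, spectralCut, ← cfcₙ_mul .., ← cfcₙ_mul .., ← cfcₙ_add ..]
  have hu0 : 0 ≤ u := add_nonneg hu1.1.isSelfAdjoint.mul_self_nonneg
    hu2.1.isSelfAdjoint.mul_self_nonneg
  have hun : ‖u‖ ≤ 1 := by
    rw [eu]
    refine norm_cfcₙ_le fun t _ => ?_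
    rw [Real.norm_of_nonneg (add_nonneg (mul_self_nonneg _) (mul_self_nonneg _))]
    rcases le_total t 0 with h | h
    · rw [cutFun_eq_zero h1 (h.trans h1.le)]
      nlinarith [cutFun_nonneg δ₂ (-t), cutFun_le_one δ₂ (-t)]
    · rw [cutFun_eq_zero h2 (show -t ≤ δ₂ by linarith)]
      nlinarith [cutFun_nonneg δ₁ t, cutFun_le_one δ₁ t]
  -- Being a unit for s, c is a unit for u; together with ‖u‖ ≤ 1 this gives u = cuc ≤ c².
  have hcu : c * u * c = u := by
    rw [eu]
    have := cfc_of_local_unit hc0.isSelfAdjoint hs hcs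
      (fun t => cutFun δ₁ t * cutFun δ₁ t + cutFun δ₂ (-t) * cutFun δ₂ (-t))
    rw [this.1, this.2]
  have hle : u ≤ c * c := by
    have := conjugate_le_of_norm_le hc0.isSelfAdjoint hu0.isSelfAdjoint hun
    rwa [hcu, one_smul] at this
  have hTu := hT.mono hu0 hle
  rw [hu, hT.map_add _ _ hu1.1.isSelfAdjoint.mul_self_nonneg
    hu2.1.isSelfAdjoint.mul_self_nonneg] at hTu
  have half : ∀ a b C : ℝ≥0∞, a ≤ b → a + b ≤ C → a ≤ 2⁻¹ * C := fun a b C h1 h2 => by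
    rw [mul_comm, ← div_eq_mul_inv, ENNReal.le_div_iff_mul_le (by simp) (by simp), mul_two]
    exact (add_le_add_right h1 a).trans h2
  rcases le_total (T (spectralCut δ₁ s * spectralCut δ₁ s))
    (T (spectralCut δ₂ (-s) * spectralCut δ₂ (-s))) with h | h
  · exact ⟨_, hu1, half _ _ _ h hTu⟩
  · exact ⟨_, hu2, half _ _ _ h (by rwa [add_comm])⟩

/-- Halving is iterated from a local unit of finite trace. The normalized z supplies the Rokhlin
comparison element z², while c bounds the trace of whatever is Cuntz-below it. -/
theorem exists_small_localUnit
    (hsplit : ∀ z : A, 0 ≤ z → z ≠ 0 → ∃ t : A, IsSelfAdjoint t ∧ ¬ 0 ≤ z * t * z ∧ ¬ z * t * z ≤ 0)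
    {c : A} (hc : IsLocalUnit c) (hfin : T (c * c) ≠ ∞) {δ : ℝ≥0∞} (hδ : δ ≠ 0) :
    ∃ c z : A, 0 ≤ c ∧ ‖c‖ ≤ 1 ∧ 0 ≤ z ∧ ‖z‖ = 1 ∧ z * c = z ∧ T (c * c) ≤ δ := by
  have h : ∀ n : ℕ, ∃ c' : A, IsLocalUnit c' ∧ T (c' * c') ≤ 2⁻¹ ^ n * T (c * c) := fun n => by
    induction n with
    | zero => exact ⟨c, hc, by simp⟩
    | succ n ih =>
      obtain ⟨c', h1, h2⟩ := ih
      obtain ⟨c'', h3, h4⟩ := h1.exists_half hT hsplit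
      refine ⟨c'', h3, h4.trans ?_⟩
      rw [pow_succ', mul_assoc]
      gcongr
  have hlim : Tendsto (fun n : ℕ => (2⁻¹ : ℝ≥0∞) ^ n * T (c * c)) atTop (𝓝 0) := by
    have := ENNReal.Tendsto.mul_const (b := T (c * c))
      (ENNReal.tendsto_pow_atTop_nhds_zero_of_lt_one (r := 2⁻¹) (by simp)) (.inr hfin)
    simpa using this
  obtain ⟨n, hn⟩ := (hlim.eventually_le_const (pos_iff_ne_zero.2 hδ)).exists
  obtain ⟨c', ⟨h0, h1, z, hz, hz0, hcz⟩, h2⟩ := h n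
  have hzn : 0 < ‖z‖ := norm_pos_iff.2 hz0
  refine ⟨c', ‖z‖⁻¹ • z, h0, h1, smul_nonneg (by positivity) hz, ?_, ?_, h2.trans hn⟩
  · rw [norm_smul, norm_inv, norm_norm, inv_mul_cancel₀ hzn.ne']
  · have := congrArg star hcz
    rw [star_mul, h0.isSelfAdjoint.star_eq, hz.isSelfAdjoint.star_eq] at this
    rw [smul_mul_assoc, this]

/-- The two-sided ideal of elements `x` with `T (x* x) < ∞`. -/
def IsLscExtendedTrace.squareSummable : Submodule ℂ A where
  carrier := {x | T (star x * x) < ∞}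
  zero_mem' := by simp [hT.map_zero]
  add_mem' := by
    intro x y hx hy
    have h : star (x + y) * (x + y) ≤ (2 : ℕ) • (star x * x + star y * y) := by
      rw [← sub_nonneg]
      have : (2 : ℕ) • (star x * x + star y * y) - star (x + y) * (x + y) =
          star (x - y) * (x - y) := by
        simp only [star_add, star_sub, add_mul, mul_add, sub_mul, mul_sub, two_smul]
        abel
      rw [this]
      exact star_mul_self_nonneg _
    refine (hT.mono (star_mul_self_nonneg _) h).trans_lt ?_
    rw [hT.map_nsmul _ (add_nonneg (star_mul_self_nonneg _) (star_mul_self_nonneg _)),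
      hT.map_add _ _ (star_mul_self_nonneg _) (star_mul_self_nonneg _)]
    exact ENNReal.mul_lt_top (by simp) (ENNReal.add_lt_top.2 ⟨hx, hy⟩)
  smul_mem' := by
    intro c x hx
    have h : star (c • x) * (c • x) = (‖c‖ ^ 2 : ℝ) • (star x * x) := by
      rw [star_smul, smul_mul_smul_comm]
      have : star c * c = ((‖c‖ ^ 2 : ℝ) : ℂ) := by
        rw [Complex.star_def, Complex.conj_mul']
        push_cast
        rfl
      rw [this]
      rfl
    change T _ < ∞
    rw [h, hT.map_smul' (by positivity) (star_mul_self_nonneg _)]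
    exact ENNReal.mul_lt_top ENNReal.ofReal_lt_top hx

theorem IsLscExtendedTrace.isTwoSided_squareSummable : IsTwoSided hT.squareSummable := by
  have hl : ∀ x b : A, T (star x * x) < ∞ → T (star (b * x) * (b * x)) < ∞ := fun x b hx => by
    have h := CStarAlgebra.star_left_conjugate_le_norm_smul (a := x) (b := star b * b)
      (hb := .star_mul_self b)
    have e : star (b * x) * (b * x) = star x * (star b * b) * x := by
      rw [star_mul]; simp only [mul_assoc]
    rw [← e] at h
    refine (hT.mono (star_mul_self_nonneg _) h).trans_lt ?_
    rw [hT.map_smul' (norm_nonneg _) (star_mul_self_nonneg _)]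
    exact ENNReal.mul_lt_top ENNReal.ofReal_lt_top hx
  refine fun x hx b => ⟨hl x b hx, ?_⟩
  have h1 : T (star (star x) * star x) < ∞ := by
    rw [star_star, hT.tracial]
    exact hx
  have h2 := hl (star x) (star b) h1
  rw [← star_mul, star_star, hT.tracial] at h2
  exact h2

/-- The closure of the ideal of square-summable elements is zero or everything. In the second case y
is approximated by square-summable z, and z*z approximates y². -/
theorem IsLscExtendedTrace.infinite_or_dense (hA : IsSimpleCStar A) :
    (∀ a : A, 0 ≤ a → a ≠ 0 → T a = ∞) ∨
      ∀ s : A, 0 ≤ s → ∀ δ : ℝ, 0 < δ → ∃ v : A, 0 ≤ v ∧ T v < ∞ ∧ ‖s - v‖ ≤ δ := by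
  have h2 : IsTwoSided hT.squareSummable.topologicalClosure := by
    intro x hx b
    have hx' : x ∈ closure (hT.squareSummable : Set A) := hx
    refine ⟨?_, ?_⟩
    · exact map_mem_closure (f := fun x => b * x) (by fun_prop) hx'
        fun y hy => (hT.isTwoSided_squareSummable y hy b).1
    · exact map_mem_closure (f := fun x => x * b) (by fun_prop) hx'
        fun y hy => (hT.isTwoSided_squareSummable y hy b).2
  rcases hA.2 _ h2 hT.squareSummable.isClosed_topologicalClosure with h | h
  · left
    intro a ha ha0
    obtain ⟨y, hy, rfl⟩ := CStarAlgebra.nonneg_iff_exists_isSelfAdjoint_and_eq_mul_self.1 ha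
    by_contra hne
    have hy' : y ∈ hT.squareSummable := by
      change T (star y * y) < ∞
      rw [hy.star_eq]
      exact lt_top_iff_ne_top.2 hne
    have := hT.squareSummable.le_topologicalClosure hy'
    rw [h, Submodule.mem_bot] at this
    exact ha0 (by rw [this, zero_mul])
  · right
    intro s hs δ hδ
    obtain ⟨y, hy, rfl⟩ := CStarAlgebra.nonneg_iff_exists_isSelfAdjoint_and_eq_mul_self.1 hs
    have hd : Dense (hT.squareSummable : Set A) := (Submodule.dense_iff_topologicalClosure_eq_top).2 h
    have ho : IsOpen {z : A | ‖y * y - star z * z‖ < δ} := isOpen_lt (by fun_prop) continuous_const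
    obtain ⟨z, hz, hz'⟩ := hd.exists_mem_open ho ⟨y, by simpa [hy.star_eq] using hδ⟩
    exact ⟨star z * z, star_mul_self_nonneg z, hz, hz'.le⟩

end SmallElements

/-! ### Traces under Cuntz comparison -/

namespace Stabilization

variable {A : Type*} [NonUnitalCStarAlgebra A] [PartialOrder A] [StarOrderedRing A]

/-- If `a ≾ z²` and `c` is a contractive unit for `z`, then `T a` is controlled by `T (c²)`. -/
theorem trace_le_of_cuntzSub {T : Stab A → ℝ≥0∞} (hT : IsLscExtendedTrace T) {a c z : A}
    (ha : 0 ≤ a) (hc : 0 ≤ c) (hz : 0 ≤ z) (hzc : z * c = z)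
    (h : CuntzSub (corner a) (corner (z * z))) :
    T (corner a) ≤ ENNReal.ofReal (‖a‖ + 1) * T (corner (c * c)) := by
  obtain ⟨w, hw⟩ := h
  have hcn : ‖corner a‖ < ‖a‖ + 1 := (norm_corner_le a).trans_lt (lt_add_one _)
  -- The summand 1 leaves room for a bound that holds for all large n, not only in the limit.
  have hev := hw.norm.eventually_le_const hcn
  have e : ∀ n, w n * corner (z * z) * star (w n) =
      (w n * corner z) * star (w n * corner z) := fun n => by
    rw [star_mul, ← cornerHom_apply, ← cornerHom_apply, map_mul, ← map_star,
      hz.isSelfAdjoint.star_eq]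
    simp only [mul_assoc]
  refine hT.le_of_tendsto (map_nonneg (cornerHom A) ha)
    (fun n => by rw [e]; exact mul_star_self_nonneg _) hw (hev.mono fun n hn => ?_)
  rw [e] at hn ⊢
  set v := w n * corner z with hv
  have hvc : v * corner c = v := by
    rw [hv, mul_assoc, ← cornerHom_apply, ← cornerHom_apply, ← map_mul, hzc]
  have hcs : IsSelfAdjoint (corner c) := by
    rw [← cornerHom_apply]
    exact (map_nonneg (cornerHom A) hc).isSelfAdjoint
  -- Since c is a right unit for v, v*v = c(v*v)c ≤ ‖v‖² c².
  have hle : star v * v ≤ (‖a‖ + 1) • (corner c * corner c) := by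
    have h1 := conjugate_le_of_norm_le hcs (IsSelfAdjoint.star_mul_self v) (δ := ‖a‖ + 1)
      (by rwa [CStarRing.norm_star_mul_self, ← CStarRing.norm_self_mul_star])
    have h2 : corner c * (star v * v) * corner c = star (v * corner c) * (v * corner c) := by
      rw [star_mul v, hcs.star_eq]
      simp only [mul_assoc]
    rwa [h2, hvc] at h1
  rw [hT.tracial]
  refine (hT.mono (star_mul_self_nonneg _) hle).trans ?_
  rw [hT.map_smul' (by positivity) hcs.mul_self_nonneg, ← cornerHom_apply, ← cornerHom_apply,
    map_mul]

end Stabilization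

/-! ### Estimates for compressions by Rokhlin elements -/

namespace CrossedProduct

variable {A : Type*} [NonUnitalCStarAlgebra A] [PartialOrder A] [StarOrderedRing A]
variable {G : Type*} [Group G] [Fintype G] {α : G →* (A ≃⋆ₐ[ℂ] A)}

/-- The coefficients at 1 cancel. For g ≠ 1 the coefficient f_1 y² α_g(f_1) is close to f_1 y² f_g,
hence to f_1 f_g y² = 0. -/
theorem norm_mk_sub_incl_le {f : G → A} (hf : ∀ g, 0 ≤ f g ∧ ‖f g‖ ≤ 1)
    (ho : ∀ g h, g ≠ h → f g * f h = 0) {ε : ℝ} (hinv : ∀ g h, ‖α g (f h) - f (g * h)‖ ≤ ε)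
    {y : A} (hy : IsSelfAdjoint y) (hyf : ∀ g, α g y = y)
    (hcomm : ∀ g, ‖y * y * f g - f g * (y * y)‖ ≤ ε) :
    ‖(mk α fun g => f 1 * y * α g (star (f 1 * y))) - incl α (f 1 * y * star (f 1 * y))‖ ≤
      Fintype.card G * ((‖y * y‖ + 1) * ε) := by
  classical
  have hε : 0 ≤ ε := (norm_nonneg _).trans (hinv 1 1)
  rw [incl_eq, ← mkₗ_apply, ← mkₗ_apply, ← map_sub, mkₗ_apply]
  refine (norm_mk_le α _).trans ?_
  have h : ∀ g ∈ Finset.univ, ‖((fun g => f 1 * y * α g (star (f 1 * y))) -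
      Pi.single 1 (f 1 * y * star (f 1 * y)) : G → A) g‖ ≤ (‖y * y‖ + 1) * ε := fun g _ => by
    rw [Pi.sub_apply]
    by_cases hg : g = 1
    · subst hg
      simp only [map_one, Pi.single_eq_same]
      change ‖f 1 * y * star (f 1 * y) - f 1 * y * star (f 1 * y)‖ ≤ _
      rw [sub_self, norm_zero]
      positivity
    · rw [Pi.single_eq_of_ne hg, sub_zero, star_mul, hy.star_eq, (hf 1).1.isSelfAdjoint.star_eq,
        map_mul, hyf]
      have e : f 1 * y * (y * α g (f 1)) = f 1 * (y * y * (α g (f 1) - f g) +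
          (y * y * f g - f g * (y * y))) := by
        have h0 : f 1 * (f g * (y * y)) = 0 := by
          rw [← mul_assoc, ho 1 g (Ne.symm hg), zero_mul]
        rw [mul_add, mul_sub, mul_sub, mul_sub, h0]
        simp only [mul_assoc]
        abel
      rw [e]
      refine norm_mul_le_of_le_right (hf 1).2 ((norm_add_le _ _).trans ?_)
      have h1 := hinv g 1
      rw [mul_one] at h1
      have h2 := norm_mul_le (y * y) (α g (f 1) - f g)
      have h3 := hcomm g
      have h4 := mul_le_mul_of_nonneg_left h1 (norm_nonneg (y * y))
      linarith
  refine (Finset.sum_le_sum h).trans (le_of_eq ?_)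
  rw [Finset.sum_const, Finset.card_univ, nsmul_eq_mul]

theorem incl_conj_mk {k : A} (hk : ∀ g, α g k = k) (a : G → A) :
    incl α k * mk α a * incl α k = mk α fun g => k * a g * k := by
  rw [incl_mul_mk, mk_mul_incl]
  simp only [hk]

/-- Two terms replace p by q on either side of k², and two more exchange q with k. -/
theorem norm_conj_sub_le {p q k : A} (hp : ‖p‖ ≤ 1) (hq : ‖q‖ ≤ 1) (hk : ‖k‖ ≤ 1) {ε : ℝ}
    (hpq : ‖p - q‖ ≤ ε) (hqk : ‖k * q - q * k‖ ≤ ε) :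
    ‖p * (k * k) * p - k * (q * q) * k‖ ≤ 4 * ε := by
  have e : p * (k * k) * p - k * (q * q) * k =
      (p - q) * (k * k * p) + q * (k * k) * (p - q) - (k * q - q * k) * (k * q) +
        (k * q) * (k * q - q * k) := by
    simp only [mul_sub, sub_mul, mul_assoc]
    abel
  have hkk : ‖k * k‖ ≤ 1 := norm_mul_le_of_le_left hk hk
  have h1 : ‖(p - q) * (k * k * p)‖ ≤ ε :=
    norm_mul_le_of_le_left hpq (norm_mul_le_of_le_left hkk hp)
  have h2 : ‖q * (k * k) * (p - q)‖ ≤ ε :=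
    norm_mul_le_of_le_right (norm_mul_le_of_le_left hq hkk) hpq
  have h3 : ‖(k * q - q * k) * (k * q)‖ ≤ ε :=
    norm_mul_le_of_le_left hqk (norm_mul_le_of_le_left hk hq)
  have h4 : ‖(k * q) * (k * q - q * k)‖ ≤ ε :=
    norm_mul_le_of_le_right (norm_mul_le_of_le_left hk hq) hqk
  rw [e]
  have h5 := norm_add_le ((p - q) * (k * k * p) + q * (k * k) * (p - q) - (k * q - q * k) * (k * q))
    ((k * q) * (k * q - q * k))
  have h6 := norm_sub_le ((p - q) * (k * k * p) + q * (k * k) * (p - q)) ((k * q - q * k) * (k * q))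
  have h7 := norm_add_le ((p - q) * (k * k * p)) (q * (k * k) * (p - q))
  linarith

/-- The averaged compression of `y²` by a Rokhlin element is close to `y²`, up to a Cuntz-small
remainder. -/
theorem orbitSum_compression {f : G → A} (hf : ∀ g, 0 ≤ f g ∧ ‖f g‖ ≤ 1)
    (ho : ∀ g h, g ≠ h → f g * f h = 0) {ε : ℝ} (hinv : ∀ g h, ‖α g (f h) - f (g * h)‖ ≤ ε)
    {k y : A} (hk : IsSelfAdjoint k) (hk1 : ‖k‖ ≤ 1) (hy : IsSelfAdjoint y) (hky : k * y = y)
    (hkf : ∀ g, α g k = k) (hyf : ∀ g, α g y = y) (hcomm : ∀ g, ‖k * f g - f g * k‖ ≤ ε) :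
    orbitSum α (star (k * (f 1 * y)) * (k * (f 1 * y))) ≤
        (1 + 4 * Fintype.card G * ε) • (y * y) ∧
      y * y ≤ orbitSum α (star (k * (f 1 * y)) * (k * (f 1 * y))) +
        ((4 * Fintype.card G + 2) * ε) • (y * y) +
        (2 : ℕ) • (y * posCut ε (k * k - k * (∑ g, f g) * k) * y) := by
  have hε : 0 ≤ ε := (norm_nonneg _).trans (hinv 1 1)
  have hyk : y * k = y := by
    have := congrArg star hky
    rwa [star_mul, hk.star_eq, hy.star_eq] at this
  obtain ⟨hff, hff', hf1⟩ := norm_sum_le_one_of_orthogonal hf ho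
  set s := ∑ g, f g with hs
  have hs0 : 0 ≤ s := Finset.sum_nonneg fun g _ => (hf g).1
  set E : A := ∑ g, α g (f 1) * (k * k) * α g (f 1) with hE
  have e1 : orbitSum α (star (k * (f 1 * y)) * (k * (f 1 * y))) = y * E * y := by
    rw [hE, Finset.mul_sum, Finset.sum_mul, orbitSum]
    refine Finset.sum_congr rfl fun g _ => ?_
    rw [star_mul, star_mul, hk.star_eq, hy.star_eq, (hf 1).1.isSelfAdjoint.star_eq]
    simp only [map_mul, hkf, hyf, mul_assoc]
  have hEs : IsSelfAdjoint E := by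
    rw [hE]
    refine (Finset.sum_nonneg fun g _ => ?_).isSelfAdjoint
    exact (action_nonneg α g (hf 1).1).isSelfAdjoint.conjugate_nonneg hk.mul_self_nonneg
  have hD : ‖E - k * (s * s) * k‖ ≤ 4 * Fintype.card G * ε := by
    rw [hff, Finset.mul_sum, Finset.sum_mul, hE, ← Finset.sum_sub_distrib]
    refine (norm_sum_le _ _).trans ((Finset.sum_le_sum fun g _ => norm_conj_sub_le
      ((norm_action α g _).trans_le (hf 1).2) (hf g).2 hk1 (ε := ε) ?_ (hcomm g)).trans ?_)
    · simpa using hinv g 1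
    · rw [Finset.sum_const, Finset.card_univ, nsmul_eq_mul]
      apply le_of_eq; ring
  have hKs : IsSelfAdjoint (k * (s * s) * k) :=
    hs0.isSelfAdjoint.mul_self_nonneg.isSelfAdjoint.conjugate_self hk
  -- As k is a unit for y, it disappears once y is multiplied on from both sides.
  have e2 : y * (k * (s * s) * k) * y = y * (s * s) * y := by
    calc y * (k * (s * s) * k) * y = (y * k) * (s * s) * (k * y) := by simp only [mul_assoc]
      _ = _ := by rw [hyk, hky]
  have hD1 : y * E * y - y * (s * s) * y ≤ (4 * Fintype.card G * ε) • (y * y) := by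
    rw [← e2, ← sub_mul, ← mul_sub]
    exact conjugate_le_of_norm_le hy (hEs.sub hKs) hD
  have hD2 : y * (s * s) * y - y * E * y ≤ (4 * Fintype.card G * ε) • (y * y) := by
    rw [← e2, ← sub_mul, ← mul_sub]
    exact conjugate_le_of_norm_le hy (hKs.sub hEs) (by rwa [norm_sub_rev])
  rw [e1]
  refine ⟨?_, ?_⟩
  · have h1 := conjugate_le_of_norm_le hy hs0.isSelfAdjoint.mul_self_nonneg.isSelfAdjoint
      (norm_mul_le_of_le_left hf1 hf1)
    rw [add_smul]
    have := add_le_add h1 hD1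
    rwa [add_sub_cancel] at this
  · have hq : IsSelfAdjoint (k * k - k * s * k) :=
      hk.mul_self_nonneg.isSelfAdjoint.sub (hs0.isSelfAdjoint.conjugate_self hk)
    have h1 := conjugate_le_conjugate_posCut hε hy hq
    have e3 : y * (k * k - k * s * k) * y = y * y - y * s * y := by
      have : y * (k * k - k * s * k) * y = (y * k) * (k * y) - (y * k) * s * (k * y) := by
        simp only [mul_sub, sub_mul, mul_assoc]
      rw [this, hyk, hky]
    rw [e3] at h1
    -- This is (1 - s)² ≥ 0 between two factors y. It gives y² - y s² y ≤ 2(y² - y s y), turning the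
    -- remainder bound for s into one for s².
    have h2 : 0 ≤ y * y - (2 : ℕ) • (y * s * y) + y * (s * s) * y := by
      have : y * y - (2 : ℕ) • (y * s * y) + y * (s * s) * y = (y - y * s) * star (y - y * s) := by
        rw [star_sub, star_mul, hs0.isSelfAdjoint.star_eq, hy.star_eq, two_smul]
        simp only [mul_sub, sub_mul, mul_assoc]
        abel
      rw [this]
      exact mul_star_self_nonneg _
    have h3 := nsmul_le_nsmul_right h1 2
    have h4 : y * y = (2 : ℕ) • (y * y - y * s * y) + y * (s * s) * y -
        (y * y - (2 : ℕ) • (y * s * y) + y * (s * s) * y) := by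
      simp only [two_smul]; abel
    have h5 : y * y ≤ (2 : ℕ) • (y * y - y * s * y) + y * (s * s) * y := by
      conv_lhs => rw [h4]
      exact sub_le_self _ h2
    have h6 := h5.trans (add_le_add h3 (sub_le_iff_le_add.1 hD2))
    refine h6.trans (le_of_eq ?_)
    have : ((4 * Fintype.card G + 2) * ε) • (y * y) =
        (4 * Fintype.card G * ε) • (y * y) + (2 : ℕ) • (ε • (y * y)) := by
      rw [← Nat.cast_smul_eq_nsmul ℝ, smul_smul, ← add_smul]
      congr 1
      push_cast
      ring
    rw [this, smul_add]
    abel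

end CrossedProduct

theorem posCut_zero {S : Type*} [NonUnitalCStarAlgebra S] [PartialOrder S] [StarOrderedRing S]
    {a : S} (ha : 0 ≤ a) : posCut 0 a = a := by
  have h := norm_sub_posCut_le le_rfl ha
  rw [norm_le_zero_iff, sub_eq_zero] at h
  exact h.symm

theorem ENNReal.le_of_forall_le_add_ofReal_mul {s t K : ℝ≥0∞} (hK : K ≠ ∞)
    (h : ∀ ε : ℝ, 0 < ε → ε ≤ 1 → s ≤ t + ENNReal.ofReal ε * K) : s ≤ t := by
  have hlim : Tendsto (fun n : ℕ => t + ENNReal.ofReal (1 / ((n : ℝ) + 1)) * K) atTop (𝓝 t) := by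
    have h1 := ENNReal.tendsto_ofReal (tendsto_one_div_add_atTop_nhds_zero_nat (𝕜 := ℝ))
    have h2 := (ENNReal.Tendsto.mul_const h1 (.inr hK)).const_add t
    simpa using h2
  refine ge_of_tendsto' hlim fun n => h _ (by positivity) ?_
  rw [div_le_one (by positivity)]
  linarith [n.cast_nonneg (α := ℝ)]

/-! ### The trace identity for fixed elements of A: infinite and finite cases -/

namespace CrossedProduct

variable {A : Type*} [NonUnitalCStarAlgebra A] [PartialOrder A] [StarOrderedRing A]
variable {G : Type*} [Group G] [Fintype G] {α : G →* (A ≃⋆ₐ[ℂ] A)}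

theorem constMk_mono {p q : A} (hp : ∀ g, α g p = p) (hq : ∀ g, α g q = q) (h : p ≤ q) :
    constMk α p ≤ constMk α q := by
  rw [← sub_nonneg, ← constMk_sub]
  exact constMk_nonneg α (sub_nonneg.2 h) fun g => by rw [map_sub, hp, hq]

theorem incl_spectralCut {δ : ℝ} (hδ : 0 < δ) {s : A} (hs : IsSelfAdjoint s) :
    incl α (spectralCut δ s) = spectralCut δ (incl α s) :=
  (incl α).map_cfcₙ (cutFun δ) s (continuous_cutFun δ).continuousOn (cutFun_zero hδ)
    (map_continuous (incl α)) hs (hs.map (incl α))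

theorem action_sqrtPosCut {δ : ℝ} (hδ : 0 ≤ δ) {b : A} (hb : IsSelfAdjoint b)
    (hbf : ∀ g, α g b = b) (g : G) : α g (sqrtPosCut δ b) = sqrtPosCut δ b :=
  action_cfc α (by fun_prop) (by simp [hδ]) hb (hbf g)

theorem action_spectralCut {δ : ℝ} (hδ : 0 < δ) {b : A} (hb : IsSelfAdjoint b)
    (hbf : ∀ g, α g b = b) (g : G) : α g (spectralCut δ b) = spectralCut δ b :=
  action_cfc α (continuous_cutFun δ) (cutFun_zero hδ) hb (hbf g)

/-- Each y² f_g is within ε‖y‖² of the translate α_g(y² f_1), so ‖y² f‖ ≤ N(‖y‖ ‖f_1 y‖ + ε‖y‖²).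
Condition (iv) with ε ≤ 1/(4N) then forces ‖y‖ < 2N ‖f_1 y‖. -/
theorem lt_norm_of_lt_norm_compression {f : G → A} (hf : ∀ g, 0 ≤ f g ∧ ‖f g‖ ≤ 1)
    (ho : ∀ g h, g ≠ h → f g * f h = 0) {ε : ℝ} (hε : ε ≤ 1 / (4 * Fintype.card G))
    (hinv : ∀ g h, ‖α g (f h) - f (g * h)‖ ≤ ε) {y : A} (hy : IsSelfAdjoint y)
    (hy0 : y ≠ 0) (hyf : ∀ g, α g y = y)
    (hnorm : (1 - ε) * ‖y * y‖ < ‖(∑ g, f g) * (y * y) * (∑ g, f g)‖) :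
    ‖y * y‖ / (4 * Fintype.card G ^ 2) < ‖f 1 * y * star (f 1 * y)‖ := by
  have hN1 : 1 ≤ (Fintype.card G : ℝ) := by exact_mod_cast Fintype.card_pos
  set N : ℝ := (Fintype.card G : ℝ) with hN
  have hy' : 0 < ‖y‖ := norm_pos_iff.2 hy0
  have hyy : ‖y * y‖ = ‖y‖ ^ 2 := by
    rw [sq, ← CStarRing.norm_star_mul_self, hy.star_eq]
  have hfy : ‖y * f 1‖ = ‖f 1 * y‖ := by
    rw [← norm_star, star_mul, hy.star_eq, (hf 1).1.isSelfAdjoint.star_eq]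
  have e1 : ∀ g, ‖y * y * f g‖ ≤ ‖y‖ * ‖f 1 * y‖ + ‖y‖ ^ 2 * ε := fun g => by
    have h1 : y * y * f g = α g (y * (y * f 1)) - y * y * (α g (f 1) - f g) := by
      simp only [map_mul, hyf, mul_sub, mul_assoc]
      abel
    have h2 := hinv g 1
    rw [mul_one] at h2
    rw [h1]
    refine (norm_sub_le _ _).trans (add_le_add ?_ ?_)
    · rw [norm_action, ← hfy]
      exact norm_mul_le _ _
    · refine (norm_mul_le _ _).trans ?_
      rw [hyy]
      exact mul_le_mul_of_nonneg_left h2 (by positivity)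
  have e2 : ‖y * y * ∑ g, f g‖ ≤ N * (‖y‖ * ‖f 1 * y‖ + ‖y‖ ^ 2 * ε) := by
    rw [Finset.mul_sum]
    refine (norm_sum_le _ _).trans ((Finset.sum_le_sum fun g _ => e1 g).trans (le_of_eq ?_))
    rw [Finset.sum_const, Finset.card_univ, nsmul_eq_mul]
  rw [mul_assoc (∑ g, f g)] at hnorm
  have e3 := hnorm.trans_le (norm_mul_le_of_le_right (norm_sum_le_one_of_orthogonal hf ho).2.2 e2)
  rw [CStarRing.norm_self_mul_star, hyy]
  rw [hyy] at e3
  rw [le_div_iff₀ (by positivity)] at hε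
  have e4 : ‖y‖ < 2 * N * ‖f 1 * y‖ := by
    have h3 : ‖y‖ * ‖y‖ < ‖y‖ * (2 * N * ‖f 1 * y‖) := by
      have hε0 : 0 ≤ ε := (norm_nonneg _).trans (hinv 1 1)
      have h4 : ε ≤ 1 / 4 := by nlinarith
      have h5 : ε * ‖y‖ ^ 2 ≤ 1 / 4 * ‖y‖ ^ 2 := by gcongr
      have h6 : ε * (4 * N) * ‖y‖ ^ 2 ≤ 1 * ‖y‖ ^ 2 := by gcongr
      linarith
    exact lt_of_mul_lt_mul_left h3 hy'.le
  rw [div_lt_iff₀ (by positivity)]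
  nlinarith

/-- Put X = f_1 b^{1/2}. The element ∑ X α_g(X*) u_g is norm-close to XX*, whose spectral cut is
nonzero and so has a square of infinite trace; `spectralCut_le` passes this on. By
`trace_constMk_orbitSum` the orbit sum of X*X has infinite trace under `constMk`, and it is at most
N b. -/
theorem trace_constMk_eq_top (hα : HasWeakTracialRokhlinProperty α)
    {τ : CrossedProduct α → ℝ≥0∞} (hτ : IsLscExtendedTrace τ)
    (hinf : ∀ a : A, 0 ≤ a → a ≠ 0 → τ (incl α a) = ∞) {b : A} (hb : 0 ≤ b) (hb0 : b ≠ 0)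
    (hbf : ∀ g, α g b = b) : τ (constMk α b) = ∞ := by
  have hN1 : 1 ≤ (Fintype.card G : ℝ) := by exact_mod_cast Fintype.card_pos
  have hb' : 0 < ‖b‖ := norm_pos_iff.2 hb0
  set y := sqrtPosCut 0 b
  have hyy : y * y = b := by rw [sqrtPosCut_mul_self le_rfl, posCut_zero hb]
  have hy : IsSelfAdjoint y := (sqrtPosCut_nonneg 0 b).isSelfAdjoint
  have hyf := action_sqrtPosCut le_rfl hb.isSelfAdjoint hbf
  have hy0 : y ≠ 0 := by
    intro h
    rw [h, zero_mul] at hyy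
    exact hb0 hyy.symm
  set N : ℝ := (Fintype.card G : ℝ) with hN
  -- Half the lower bound ‖b‖/(4N²) for ‖XX*‖, so that the cut at δ is nonzero.
  set δ : ℝ := ‖b‖ / (8 * N ^ 2) with hδ_def
  have hδ : 0 < δ := by positivity
  -- The first entry serves the norm bound; the second brings the off-diagonal error N(‖b‖ + 1)ε
  -- below δ/2.
  set ε : ℝ := min (1 / (4 * N)) (δ / 2 / (N * (‖b‖ + 1)))
  have hε : 0 < ε := by positivity
  have hx : 0 ≤ ‖b‖⁻¹ • b := smul_nonneg (by positivity) hb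
  have hx1 : ‖‖b‖⁻¹ • b‖ = 1 := by rw [norm_smul, norm_inv, norm_norm, inv_mul_cancel₀ hb'.ne']
  obtain ⟨f, h1, h2, h3, h4, -, h5⟩ := hα ε hε {b} (‖b‖⁻¹ • b) 0 hx le_rfl hx1
  have hnorm : (1 - ε) * ‖y * y‖ < ‖(∑ g, f g) * (y * y) * (∑ g, f g)‖ := by
    rw [mul_smul_comm, smul_mul_assoc, norm_smul, norm_inv, norm_norm, ← div_eq_inv_mul,
      lt_div_iff₀ hb'] at h5
    rwa [hyy]
  have hlow := lt_norm_of_lt_norm_compression h1 h2 (min_le_left _ _) (fun g h => (h4 g h).le) hy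
    hy0 hyf hnorm
  have happ := norm_mk_sub_incl_le h1 h2 (fun g h => (h4 g h).le) hy hyf
    (fun g => by rw [hyy]; exact (h3 g b (by simp)).le)
  rw [hyy] at hlow happ
  have hsmall : N * ((‖b‖ + 1) * ε) ≤ δ / 2 := by
    have : ε ≤ δ / 2 / (N * (‖b‖ + 1)) := min_le_right _ _
    rw [le_div_iff₀ (by positivity)] at this
    linarith
  set X := f 1 * y with hX
  have hcut := hτ.spectralCut_le hδ (IsSelfAdjoint.mul_star_self X |>.map (incl α))
    (mk_mul_action_nonneg α X) (by rw [norm_sub_rev]; exact happ.trans hsmall)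
  rw [← incl_spectralCut hδ (IsSelfAdjoint.mul_star_self X), ← map_mul] at hcut
  set k := spectralCut δ (X * star X)
  have hk : IsSelfAdjoint k := isSelfAdjoint_spectralCut _ _
  have hk0 : k ≠ 0 := by
    refine spectralCut_ne_zero hδ (mul_star_self_nonneg X) (lt_of_le_of_lt (le_of_eq ?_) hlow)
    rw [hδ_def, ← hN]
    field_simp
    norm_num
  have hkk : k * k ≠ 0 := by
    intro h
    rw [← norm_eq_zero] at h
    have := CStarRing.norm_star_mul_self (x := k)
    rw [hk.star_eq, h] at this
    exact hk0 (norm_eq_zero.1 (mul_self_eq_zero.1 this.symm))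
  rw [hinf _ hk.mul_self_nonneg hkk, ENNReal.mul_top (by simpa using hδ), top_le_iff] at hcut
  have hle : orbitSum α (star X * X) ≤ Fintype.card G • b := by
    rw [← orbitSum_of_fixed α hbf]
    refine orbitSum_mono α ?_
    have h6 := conjugate_le_of_norm_le hy (u := f 1 * f 1) (δ := 1)
      (h1 1).1.isSelfAdjoint.mul_self_nonneg.isSelfAdjoint
      (norm_mul_le_of_le_left (h1 1).2 (h1 1).2)
    rw [one_smul, hyy] at h6
    rw [hX, star_mul, hy.star_eq, (h1 1).1.isSelfAdjoint.star_eq]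
    simpa only [mul_assoc] using h6
  have h7 := hτ.mono (constMk_orbitSum_nonneg α (star_mul_self_nonneg X))
    (constMk_mono (action_orbitSum α · _) (fun g => by rw [map_nsmul, hbf]) hle)
  rw [trace_constMk_orbitSum α hτ, hcut, ENNReal.mul_top (by simp), top_le_iff, constMk_nsmul,
    hτ.map_nsmul _ (constMk_nonneg α hb hbf)] at h7
  by_contra hne
  exact ENNReal.mul_ne_top (by simp) hne h7

/-- The bookkeeping for both inequalities s ≤ t and t ≤ s: every error carries the factor E. Values
lie in [0, ∞], so nothing is subtracted. -/
theorem le_add_of_compression_bounds {N : ℕ} {s t σe Te r tk κ E Y P : ℝ≥0∞}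
    (h1 : s ≤ σe + (4 * N + 2) * E * s + 2 * N * r) (h2 : σe ≤ Te + N * (N * (P * E)) * tk)
    (h3 : Te ≤ (1 + 4 * N * E) * t) (h4 : r ≤ Y * (3 * κ)) (h5 : κ ≤ E) :
    s ≤ t + E * (4 * N * t + N * N * P * tk + (4 * N + 2) * s + 6 * N * Y) := by
  calc s ≤ σe + (4 * N + 2) * E * s + 2 * N * r := h1
    _ ≤ ((1 + 4 * N * E) * t + N * (N * (P * E)) * tk) + (4 * N + 2) * E * s +
        2 * N * (Y * (3 * E)) := by
      gcongr
      · exact h2.trans (by gcongr)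
      · exact h4.trans (by gcongr)
    _ = _ := by ring

/-- Both sides are compared with their values at e, the orbit sum of X*X for X = k f_1 y. The two
values at e differ little, because ∑ X α_g(X*) u_g is close to XX*. The factor k in X turns that
norm error into a small multiple of k², which has finite trace. Replacing y² by e costs multiples of
ε y² and the remainder y m y, whose trace is small by Cuntz comparison. -/
theorem trace_constMk_mul_self [Nontrivial G] (hA : IsSimpleCStar A)
    (hα : HasWeakTracialRokhlinProperty α) {τ : Stab (CrossedProduct α) → ℝ≥0∞}
    (hτ : IsLscExtendedTrace τ)
    (hfin : ∃ c : A, IsLocalUnit c ∧ τ (Stabilization.corner (incl α (c * c))) ≠ ∞)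
    {k y : A} (hk0 : 0 ≤ k) (hk1 : ‖k‖ ≤ 1) (hy : IsSelfAdjoint y) (hky : k * y = y)
    (hkf : ∀ g, α g k = k) (hyf : ∀ g, α g y = y)
    (hkfin : τ (Stabilization.corner (incl α (k * k))) ≠ ∞) :
    τ (Stabilization.corner (constMk α (y * y))) =
      τ (Stabilization.corner (incl α (y * y))) := by
  classical
  have hk := hk0.isSelfAdjoint
  set N := Fintype.card G with hN
  have hN1 : 1 ≤ (N : ℝ) := by exact_mod_cast Fintype.card_pos
  have hD := hτ.comp (Stabilization.cornerHom (CrossedProduct α))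
  have hT := hD.comp (incl α)
  have hTs := hτ.comp (Stabilization.map (incl α))
  change ∃ c : A, IsLocalUnit c ∧ τ (Stabilization.cornerHom _ (incl α (c * c))) ≠ ∞ at hfin
  change τ (Stabilization.cornerHom _ (incl α (k * k))) ≠ ∞ at hkfin
  change τ (Stabilization.cornerHom _ (constMk α (y * y))) =
    τ (Stabilization.cornerHom _ (incl α (y * y)))
  set σ : CrossedProduct α → ℝ≥0∞ := fun x => τ (Stabilization.cornerHom (CrossedProduct α) x)
  set s := σ (constMk α (y * y))
  set t := σ (incl α (y * y))
  set tk := σ (incl α (k * k))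
  have hyyf : ∀ g, α g (y * y) = y * y := fun g => by rw [map_mul, hyf]
  have hyy0 := hy.mul_self_nonneg
  have hS0 := constMk_nonneg α hyy0 hyyf
  have ht : t ≠ ∞ := by
    have h1 : y * y ≤ (‖y * y‖) • (k * k) := by
      have h2 := conjugate_le_of_norm_le hk hyy0.isSelfAdjoint le_rfl
      have hyk : y * k = y := by
        have := congrArg star hky
        rwa [star_mul, hk.star_eq, hy.star_eq] at this
      have h3 : k * (y * y) * k = y * y := by rw [← mul_assoc, hky, mul_assoc, hyk]
      rwa [h3] at h2
    refine ne_top_of_le_ne_top ?_ (hT.mono hyy0 h1)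
    rw [hT.map_smul' (norm_nonneg _) hk.mul_self_nonneg]
    exact ENNReal.mul_ne_top ENNReal.ofReal_ne_top hkfin
  have hs : s ≠ ∞ := by
    have h1 := trace_constMk_orbitSum_le α hD hyy0
    rw [orbitSum_of_fixed α hyyf, constMk_nsmul, hD.map_nsmul _ hS0] at h1
    have h2 := ne_top_of_le_ne_top (ENNReal.mul_ne_top (by simp) ht) h1
    intro h
    apply h2
    change (Fintype.card G : ℝ≥0∞) * s = ∞
    rw [h, ENNReal.mul_top (by simp)]
  set Y : ℝ≥0∞ := ENNReal.ofReal (‖y‖ ^ 2)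
  set P : ℝ≥0∞ := ENNReal.ofReal (‖y * y‖ + 1)
  have key : ∀ ε : ℝ, 0 < ε → ε ≤ 1 →
      s ≤ t + ENNReal.ofReal ε * (4 * N * t + N * N * P * tk + (4 * N + 2) * s + 6 * N * Y) ∧
      t ≤ s + ENNReal.ofReal ε * (4 * N * s + N * N * P * tk + (4 * N + 2) * t + 6 * N * Y) := by
    intro ε hε hε1
    obtain ⟨g₀, h₀, hgh⟩ := exists_pair_ne G
    obtain ⟨c₀, hc₀, hc₀fin⟩ := hfin
    obtain ⟨c, z, hc, -, hz, hz1, hzc, hκ⟩ := exists_small_localUnit hT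
      (fun z hz hz0 => hα.exists_indefinite hA hgh hz hz0) hc₀ hc₀fin
      (δ := ENNReal.ofReal ε) (by simpa using hε)
    have hzz : ‖z * z‖ = 1 := by
      have := CStarRing.norm_star_mul_self (x := z)
      rw [hz.isSelfAdjoint.star_eq, hz1] at this
      simpa using this
    -- The comparison condition is used with k in place of y; y then only compresses the remainder.
    obtain ⟨f, f1, f2, f3, f4, f5, -⟩ := hα ε hε {k, y * y} (z * z) k
      hz.isSelfAdjoint.mul_self_nonneg hk0 hzz
    obtain ⟨A1, A2⟩ := orbitSum_compression f1 f2 (fun g h => (f4 g h).le) hk hk1 hy hky hkf hyf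
      (fun g => (f3 g k (by simp)).le)
    have happ := norm_mk_sub_incl_le f1 f2 (fun g h => (f4 g h).le) hy hyf
      (fun g => (f3 g (y * y) (by simp)).le)
    set X₀ := f 1 * y
    set X := k * X₀ with hX
    set e := orbitSum α (star X * X) with he
    set q := k * k - k * (∑ g, f g) * k with hq
    set m := posCut ε q with hm
    have hm0 : 0 ≤ m := posCut_nonneg _ _
    have hymy : 0 ≤ y * m * y := hy.conjugate_nonneg hm0
    have hef : ∀ g, α g e = e := fun g => action_orbitSum α g _
    have he0 : 0 ≤ e := orbitSum_nonneg α (star_mul_self_nonneg X)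
    have hSe0 : 0 ≤ constMk α e := constMk_nonneg α he0 hef
    have hc1 : ENNReal.ofReal (1 + 4 * N * ε) = 1 + 4 * N * ENNReal.ofReal ε := by
      rw [ENNReal.ofReal_add (by norm_num) (by positivity), ENNReal.ofReal_mul (by positivity),
        ENNReal.ofReal_mul (by positivity)]
      simp
    have hc2 : ENNReal.ofReal ((4 * N + 2) * ε) = (4 * N + 2) * ENNReal.ofReal ε := by
      rw [ENNReal.ofReal_mul (by positivity), ENNReal.ofReal_add (by positivity) (by positivity),
        ENNReal.ofReal_mul (by positivity)]
      simp
    have hc3 : ENNReal.ofReal (N * ((‖y * y‖ + 1) * ε)) = N * (P * ENNReal.ofReal ε) := by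
      rw [ENNReal.ofReal_mul (by positivity), ENNReal.ofReal_mul (by positivity)]
      simp [P]
    have hc4 : 0 ≤ (4 * N + 2) * ε := by positivity
    have B1 : σ (constMk α e) ≤ (1 + 4 * N * ENNReal.ofReal ε) * s := by
      have h1 := constMk_mono hef (q := (1 + 4 * N * ε) • (y * y)) (fun g => by
        have : α g ((1 + 4 * N * ε) • (y * y)) = (1 + 4 * N * ε) • α g (y * y) :=
          _root_.map_smul (α g) ((1 + 4 * N * ε : ℝ) : ℂ) (y * y)
        rw [this, hyyf]) A1
      have h2 : constMk α ((1 + 4 * N * ε) • (y * y)) = (1 + 4 * N * ε) • constMk α (y * y) :=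
        constMk_smul α ((1 + 4 * N * ε : ℝ) : ℂ) (y * y)
      rw [h2] at h1
      have h3 := hD.mono hSe0 h1
      rwa [hD.map_smul' (by positivity) hS0, hc1] at h3
    have B2 : σ (incl α e) ≤ (1 + 4 * N * ENNReal.ofReal ε) * t := by
      have h3 := hT.mono he0 A1
      rwa [hT.map_smul' (by positivity) hyy0, hc1] at h3
    have C1 : t ≤ σ (incl α e) + (4 * N + 2) * ENNReal.ofReal ε * t +
        2 * N * σ (incl α (y * m * y)) := by
      have h3 := hT.mono hyy0 A2
      rw [hT.map_add _ _ (add_nonneg he0 (smul_nonneg hc4 hyy0)) (nsmul_nonneg hymy 2),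
        hT.map_add _ _ he0 (smul_nonneg hc4 hyy0), hT.map_smul' hc4 hyy0,
        hT.map_nsmul 2 hymy, hc2] at h3
      refine h3.trans (add_le_add_right ?_ _)
      gcongr
      push_cast
      -- The coefficient 2 is enlarged to 2N to fit the shape shared with the other inequality.
      exact le_mul_of_one_le_right' (by exact_mod_cast Fintype.card_pos)
    have C2 : s ≤ σ (constMk α e) + (4 * N + 2) * ENNReal.ofReal ε * s +
        2 * N * σ (incl α (y * m * y)) := by
      -- The element y m y need not be fixed, so `constMk` need not respect the inequality as it
      -- stands. It is averaged over the orbit, and the factor N is cancelled at the end.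
      have h1 := orbitSum_mono α A2
      rw [orbitSum_add, orbitSum_add, orbitSum_of_fixed α hyyf, orbitSum_of_fixed α hef] at h1
      have h2 : orbitSum α (((4 * N + 2) * ε) • (y * y)) = ((4 * N + 2) * ε) • (N • (y * y)) := by
        rw [← orbitSum_of_fixed α hyyf, orbitSum, orbitSum, Finset.smul_sum]
        exact Finset.sum_congr rfl fun g _ =>
          _root_.map_smul (α g) (((4 * N + 2) * ε : ℝ) : ℂ) (y * y)
      have h3 : orbitSum α ((2 : ℕ) • (y * m * y)) = 2 • orbitSum α (y * m * y) := by
        rw [two_smul, orbitSum_add, two_smul]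
      rw [h2, h3] at h1
      have hfix : ∀ (n : ℕ) (x : A), (∀ g, α g x = x) → ∀ g, α g (n • x) = n • x :=
        fun n x hx g => by rw [map_nsmul, hx]
      have h4 := constMk_mono (α := α) (hfix N _ hyyf) (fun g => by
        rw [map_add, map_add, hfix N _ hef, hfix 2 _ fun g => action_orbitSum α g _]
        have : α g (((4 * N + 2) * ε) • (N • (y * y))) =
            ((4 * N + 2) * ε) • α g (N • (y * y)) :=
          _root_.map_smul (α g) (((4 * N + 2) * ε : ℝ) : ℂ) (N • (y * y))
        rw [this, hfix N _ hyyf]) h1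
      have h5 : constMk α (((4 * N + 2) * ε) • (N • (y * y))) =
          ((4 * N + 2) * ε) • (N • constMk α (y * y)) := by
        rw [← constMk_nsmul]
        exact constMk_smul α (((4 * N + 2) * ε : ℝ) : ℂ) _
      rw [constMk_add, constMk_add, h5, constMk_nsmul, constMk_nsmul, constMk_nsmul] at h4
      have hO := constMk_orbitSum_nonneg α hymy
      have h6 := hD.mono (nsmul_nonneg hS0 N) h4
      have hNS := nsmul_nonneg hS0 N
      rw [hD.map_add _ _ (add_nonneg (nsmul_nonneg hSe0 N) (smul_nonneg hc4 hNS))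
          (nsmul_nonneg hO 2),
        hD.map_add _ _ (nsmul_nonneg hSe0 N) (smul_nonneg hc4 hNS), hD.map_smul' hc4 hNS,
        hD.map_nsmul N hS0, hD.map_nsmul N hSe0, hD.map_nsmul 2 hO, hc2] at h6
      have h7 := trace_constMk_orbitSum_le α hD hymy
      have h8 : N * s ≤ N * (σ (constMk α e) + (4 * N + 2) * ENNReal.ofReal ε * s +
          2 * N * σ (incl α (y * m * y))) := by
        refine h6.trans ((add_le_add_right (mul_le_mul_right h7 _) _).trans (le_of_eq ?_))
        push_cast
        ring
      exact (ENNReal.mul_le_mul_iff_right (by simp [hN]) (by simp)).1 h8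
    have hM : (mk α fun g => X * α g (star X)) =
        incl α k * (mk α fun g => X₀ * α g (star X₀)) * incl α k := by
      rw [incl_conj_mk hkf]
      congr 1
      ext g
      rw [hX, star_mul, hk.star_eq, map_mul, hkf]
      simp only [mul_assoc]
    have hXX : incl α (X * star X) = incl α k * incl α (X₀ * star X₀) * incl α k := by
      rw [← map_mul, ← map_mul, hX, star_mul, hk.star_eq]
      simp only [mul_assoc]
    have hik : IsSelfAdjoint (incl α k) := hk.map (incl α)
    have hM₀ := isSelfAdjoint_mk_mul_action α X₀
    have hI₀ : IsSelfAdjoint (incl α (X₀ * star X₀)) := (IsSelfAdjoint.mul_star_self X₀).map _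
    have hσe : σ (constMk α e) = N * σ (mk α fun g => X * α g (star X)) :=
      trace_constMk_orbitSum α hD X
    have hTe : σ (incl α e) = N * σ (incl α (X * star X)) := by
      refine (trace_incl_orbitSum α hD (star_mul_self_nonneg X)).trans ?_
      exact congrArg ((N : ℝ≥0∞) * ·) (hT.tracial X).symm
    have hpos : 0 ≤ (N : ℝ) * ((‖y * y‖ + 1) * ε) := by positivity
    have hkk : 0 ≤ incl α k * incl α k := hik.mul_self_nonneg
    have D1 : σ (constMk α e) ≤ σ (incl α e) + N * (N * (P * ENNReal.ofReal ε)) * tk := by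
      have h1 := conjugate_le_of_norm_le hik (hM₀.sub hI₀) happ
      rw [mul_sub, sub_mul, ← hM, ← hXX, sub_le_iff_le_add'] at h1
      have h2 := hD.mono (mk_mul_action_nonneg α X) h1
      rw [hD.map_add _ _ (map_nonneg _ (mul_star_self_nonneg X)) (smul_nonneg hpos hkk),
        hD.map_smul' hpos hkk, hc3, ← map_mul (incl α)] at h2
      rw [hσe, hTe]
      refine (mul_le_mul_right h2 (N : ℝ≥0∞)).trans (le_of_eq ?_)
      rw [mul_add, ← mul_assoc (N : ℝ≥0∞) _ (σ (incl α (k * k)))]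
    have D2 : σ (incl α e) ≤ σ (constMk α e) + N * (N * (P * ENNReal.ofReal ε)) * tk := by
      have h1 := conjugate_le_of_norm_le hik (hI₀.sub hM₀)
        (by rw [norm_sub_rev]; exact happ : _ ≤ (N : ℝ) * ((‖y * y‖ + 1) * ε))
      rw [mul_sub, sub_mul, ← hM, ← hXX, sub_le_iff_le_add'] at h1
      have h2 := hD.mono (map_nonneg _ (mul_star_self_nonneg X)) h1
      rw [hD.map_add _ _ (mk_mul_action_nonneg α X) (smul_nonneg hpos hkk),
        hD.map_smul' hpos hkk, hc3, ← map_mul (incl α)] at h2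
      rw [hσe, hTe]
      refine (mul_le_mul_right h2 (N : ℝ≥0∞)).trans (le_of_eq ?_)
      rw [mul_add, ← mul_assoc (N : ℝ≥0∞) _ (σ (incl α (k * k)))]
    have hmn : ‖m‖ ≤ 2 := by
      obtain ⟨-, -, hf1⟩ := norm_sum_le_one_of_orthogonal f1 f2
      have hfs : IsSelfAdjoint (∑ g, f g) := (Finset.sum_nonneg fun g _ => (f1 g).1).isSelfAdjoint
      have hq0 : 0 ≤ q := by
        have := conjugate_le_of_norm_le hk hfs hf1
        rwa [one_smul, ← sub_nonneg] at this
      refine (CStarAlgebra.norm_le_norm_of_nonneg_of_le hm0 (posCut_le hε.le hq0)).trans ?_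
      have h1 := norm_mul_le_of_le_left hk1 hk1
      have h2 := norm_mul_le_of_le_left (norm_mul_le_of_le_left hk1 hf1) hk1
      refine (norm_sub_le _ _).trans ?_
      linarith
    have F1 : σ (incl α (y * m * y)) ≤ Y * (3 * σ (incl α (c * c))) := by
      have h1 := hT.conj_le y hm0
      rw [hy.star_eq] at h1
      refine h1.trans (mul_le_mul_right ?_ _)
      -- The comparison takes place in the stabilization of A, so the trace is pulled back there.
      -- The constant 3 comes from ‖m‖ + 1 with ‖m‖ ≤ 2.
      have h2 := Stabilization.trace_le_of_cuntzSub hTs hm0 hc hz hzc f5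
      simp only [Stabilization.map_corner] at h2
      refine h2.trans (mul_le_mul_left ?_ _)
      rw [ENNReal.ofReal_le_iff_le_toReal (by simp)]
      simpa using (by linarith : ‖m‖ + 1 ≤ 3)
    exact ⟨le_add_of_compression_bounds C2 D1 B2 F1 hκ, le_add_of_compression_bounds C1 D2 B1 F1 hκ⟩
  -- Finiteness of s, t and tk is what makes the error vanish as ε tends to 0.
  exact le_antisymm
    (ENNReal.le_of_forall_le_add_ofReal_mul (by finiteness) fun ε h h' => (key ε h h').1)
    (ENNReal.le_of_forall_le_add_ofReal_mul (by finiteness) fun ε h h' => (key ε h h').2)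

end CrossedProduct

theorem Stabilization.diagEntry_nonneg {A : Type*} [NonUnitalCStarAlgebra A] [PartialOrder A]
    [StarOrderedRing A] (i : ℕ) {x : Stab A} (hx : 0 ≤ x) : 0 ≤ diagEntry i x := by
  obtain ⟨y, rfl⟩ := CStarAlgebra.nonneg_iff_eq_mul_star_self.1 hx
  refine Stabilization.ind (p := fun y => 0 ≤ diagEntry i (y * star y)) y
    (isClosed_le continuous_const (by fun_prop)) fun n y => ?_
  rw [← map_star, ← map_mul, diagEntry_ofMat]
  split_ifs
  · rw [CStarMatrix.mul_apply]
    exact Finset.sum_nonneg fun j _ => mul_star_self_nonneg _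
  · exact le_rfl

/-! ### From fixed elements of A to the stabilized crossed product -/

namespace CrossedProduct

variable {A : Type*} [NonUnitalCStarAlgebra A] [PartialOrder A] [StarOrderedRing A]
variable {G : Type*} [Group G] [Fintype G] {α : G →* (A ≃⋆ₐ[ℂ] A)}

theorem constMk_eq_incl [Subsingleton G] (x : A) : constMk α x = incl α x := by
  classical
  rw [incl_eq, constMk]
  congr 1
  ext g
  simp [Subsingleton.elim g 1]

/-- In the finite case the identity holds for (b - 2δ)₊, with the cut of b at δ as local unit. As δ
tends to 0 these elements converge to b from below, and semicontinuity with monotonicity carries the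
identity over. -/
theorem trace_constMk (hA : IsSimpleCStar A) (hα : HasWeakTracialRokhlinProperty α)
    {τ : Stab (CrossedProduct α) → ℝ≥0∞} (hτ : IsLscExtendedTrace τ) {b : A} (hb : 0 ≤ b)
    (hbf : ∀ g, α g b = b) :
    τ (Stabilization.corner (constMk α b)) = τ (Stabilization.corner (incl α b)) := by
  -- Halving requires two distinct group elements; for the trivial group p = 1.
  rcases subsingleton_or_nontrivial G with hG | hG
  · rw [constMk_eq_incl]
  rcases eq_or_ne b 0 with rfl | hb0
  · rw [_root_.map_zero, constMk, show (fun _ : G => (0 : A)) = 0 from rfl, ← mkₗ_apply,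
      _root_.map_zero]
  have hD := hτ.comp (Stabilization.cornerHom (CrossedProduct α))
  have hT := hD.comp (incl α)
  rcases hT.infinite_or_dense hA with hinf | hdense
  · exact (trace_constMk_eq_top hα hD hinf hb hb0 hbf).trans (hinf b hb hb0).symm
  -- A finite-trace v within δ/2 of b controls the trace of the squared cut at δ.
  have hfin : ∀ δ : ℝ, 0 < δ →
      τ (Stabilization.corner (incl α (spectralCut δ b * spectralCut δ b))) ≠ ∞ := fun δ hδ => by
    obtain ⟨v, hv, hvfin, hbv⟩ := hdense b hb (δ / 2) (by positivity)
    have h1 := hT.spectralCut_le hδ hb.isSelfAdjoint hv hbv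
    have h2 := h1.trans_lt hvfin
    intro h
    change ENNReal.ofReal (δ / 2) *
      τ (Stabilization.corner (incl α (spectralCut δ b * spectralCut δ b))) < ∞ at h2
    rw [h, ENNReal.mul_top (by simpa using hδ)] at h2
    exact lt_irrefl _ h2
  have hb' : 0 < ‖b‖ := norm_pos_iff.2 hb0
  have hlu : ∃ c : A, IsLocalUnit c ∧ τ (Stabilization.corner (incl α (c * c))) ≠ ∞ := by
    refine ⟨spectralCut (‖b‖ / 4) b, isLocalUnit_spectralCut (by positivity) fun h => ?_,
      hfin _ (by positivity)⟩
    have h1 := norm_sub_posCut_le (by positivity : 0 ≤ 2 * (‖b‖ / 4)) hb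
    rw [h, sub_zero] at h1
    linarith
  have heq : ∀ δ : ℝ, 0 < δ → τ (Stabilization.corner (constMk α (posCut (2 * δ) b))) =
      τ (Stabilization.corner (incl α (posCut (2 * δ) b))) := fun δ hδ => by
    rw [← sqrtPosCut_mul_self (by positivity)]
    exact trace_constMk_mul_self hA hα hτ hlu (spectralCut_nonneg δ b) (norm_spectralCut_le δ b)
      (sqrtPosCut_nonneg _ b).isSelfAdjoint (spectralCut_mul_sqrtPosCut hδ b)
      (action_spectralCut hδ hb.isSelfAdjoint hbf)
      (action_sqrtPosCut (by positivity) hb.isSelfAdjoint hbf) (hfin δ hδ)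
  have hposf : ∀ δ : ℝ, 0 ≤ δ → ∀ g, α g (posCut δ b) = posCut δ b := fun δ hδ g =>
    action_cfc α (by fun_prop) (by simp [hδ]) hb.isSelfAdjoint (hbf g)
  let δ : ℕ → ℝ := fun n => 1 / ((n : ℝ) + 1)
  have hδ : ∀ n, 0 < δ n := fun n => by positivity
  have hδ2 : ∀ n, 0 ≤ 2 * δ n := fun n => by positivity
  have hlim : Tendsto (fun n => posCut (2 * δ n) b) atTop (𝓝 b) :=
    tendsto_posCut hb hδ2 (by simpa [δ] using
      (tendsto_one_div_add_atTop_nhds_zero_nat (𝕜 := ℝ)).const_mul 2)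
  refine le_antisymm ?_ ?_
  · refine hD.le_of_tendsto (constMk_nonneg α hb hbf)
      (fun n => constMk_nonneg α (posCut_nonneg _ b) (hposf _ (hδ2 n)))
      (((continuous_constMk α).tendsto b).comp hlim) (Eventually.of_forall fun n => ?_)
    exact (heq _ (hδ n)).trans_le (hT.mono (posCut_nonneg _ b) (posCut_le (hδ2 n) hb))
  · refine hT.le_of_tendsto hb (fun n => posCut_nonneg _ b) hlim
      (Eventually.of_forall fun n => ?_)
    exact (heq _ (hδ n)).symm.trans_le (hD.mono (constMk_nonneg α (posCut_nonneg _ b)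
      (hposf _ (hδ2 n))) (constMk_mono (hposf _ (hδ2 n)) hbf (posCut_le (hδ2 n) hb)))

theorem incl_fixed (z : FixedPointAlgebra α) (g : G) :
    α g (FixedPointAlgebra.incl α z) = FixedPointAlgebra.incl α z := z.2 g

theorem constMk_mul_constMk (x : A) {z : A} (hz : ∀ g, α g z = z) :
    constMk α x * constMk α z = (Fintype.card G : ℂ) • constMk α (x * z) := by
  rw [constMk, constMk, mk_mul_mk, constMk, ← mk_smul]
  congr 1
  ext g
  simp [hz, Nat.cast_smul_eq_nsmul]

theorem star_constMk {x : A} (hx : ∀ g, α g x = x) :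
    star (constMk α x) = constMk α (star x) := by
  rw [constMk, star_mk, constMk]
  simp [map_star, hx]

variable (α) in
/-- The `*`-homomorphism `z ↦ z p` from the fixed point algebra to the crossed product. -/
noncomputable def projHom : FixedPointAlgebra α →⋆ₙₐ[ℂ] CrossedProduct α where
  toFun z := (Fintype.card G : ℂ)⁻¹ • constMk α (FixedPointAlgebra.incl α z)
  map_smul' c z := by
    rw [map_smul, constMk_smul, smul_comm]
    rfl
  map_zero' := by
    rw [map_zero]
    exact (congrArg _ (map_zero (constMkₗ α))).trans (smul_zero _)
  map_add' x z := by rw [map_add, constMk_add, smul_add]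
  map_mul' x z := by
    rw [smul_mul_smul_comm, constMk_mul_constMk _ (incl_fixed z), map_mul, smul_smul, mul_assoc,
      inv_mul_cancel₀ (by simp), mul_one]
  map_star' z := by
    rw [star_smul, star_constMk (incl_fixed z), map_star]
    congr 1
    simp

theorem projHom_apply (z : FixedPointAlgebra α) :
    projHom α z = (Fintype.card G : ℂ)⁻¹ • constMk α (FixedPointAlgebra.incl α z) := rfl

theorem sum_rightMul_incl (x : A) : ∑ g, rightMul α g (incl α x) = constMk α x := by
  classical
  simp only [incl_eq, rightMul_mk]
  simp only [← mkₗ_apply, constMk]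
  rw [← map_sum]
  congr 1
  ext h
  rw [Finset.sum_apply, Finset.sum_eq_single h]
  · simp
  · intro g _ hg
    rw [Pi.single_eq_of_ne]
    rw [Ne, mul_inv_eq_one]
    exact hg.symm
  · simp

theorem mulMultiplier_averagingProjection (x : Stab (CrossedProduct α)) :
    mulMultiplier x (averagingProjection α) = (Fintype.card G : ℂ)⁻¹ •
      ∑ g, (canonicalUnitary α g).snd x := by
  have h : ∀ s : Finset G, (∑ g ∈ s, canonicalUnitary α g).snd x =
      ∑ g ∈ s, (canonicalUnitary α g).snd x := fun s => by
    classical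
    induction s using Finset.induction_on with
    | empty => simp
    | insert i s hi ih => rw [Finset.sum_insert hi, Finset.sum_insert hi, ← ih]; simp
  rw [mulMultiplier, averagingProjection, DoubleCentralizer.smul_snd, ← h]
  rfl

/-- On matrices, multiplying every entry by p is applying z ↦ z p entrywise; density does the rest.
Thus a p is a homomorphic image of a. -/
theorem mulMultiplier_stabIncl (a : Stab (FixedPointAlgebra α)) :
    mulMultiplier (stabIncl α a) (averagingProjection α) = Stabilization.map (projHom α) a := by
  rw [mulMultiplier_averagingProjection]
  refine Stabilization.ind (p := fun a => (Fintype.card G : ℂ)⁻¹ •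
    ∑ g, (canonicalUnitary α g).snd (stabIncl α a) = Stabilization.map (projHom α) a) a
    (isClosed_eq ?_ (map_continuous _)) fun n x => ?_
  · exact (continuous_finsetSum _ fun g _ => (canonicalUnitary α g).snd.continuous.comp
      (map_continuous (stabIncl α))).const_smul (Fintype.card G : ℂ)⁻¹
  have h : ∀ g, (canonicalUnitary α g).snd (stabIncl α (Stabilization.ofMat n x)) =
      Stabilization.ofMat n (Stabilization.entrywise (rightMul α g) n
        (CStarMatrix.mapₙₐ (n := Fin n) (incl α)
          (CStarMatrix.mapₙₐ (n := Fin n) (FixedPointAlgebra.incl α) x))) := fun g => by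
    change (canonicalUnitary α g).snd (Stabilization.map (incl α)
      (Stabilization.map (FixedPointAlgebra.incl α) (Stabilization.ofMat n x))) = _
    rw [Stabilization.map_ofMat, Stabilization.map_ofMat]
    exact Stabilization.amplify_ofMat (rightMul α g)
      (Stabilization.norm_entrywise_right _ (rightMul_mul_star α g)) n _
  simp only [h, Stabilization.map_ofMat, ← map_sum, ← map_smul]
  congr 1
  ext i j
  have he : ∀ (s : Finset G) (f : G → CStarMatrix (Fin n) (Fin n) (CrossedProduct α)),
      (∑ g ∈ s, f g) i j = ∑ g ∈ s, f g i j := fun s f => by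
    classical
    induction s using Finset.induction_on with
    | empty => rfl
    | insert i s hi ih => rw [Finset.sum_insert hi, Finset.sum_insert hi, ← ih]; rfl
  rw [CStarMatrix.smul_apply, he]
  exact congrArg ((Fintype.card G : ℂ)⁻¹ • ·) (sum_rightMul_incl _)

theorem trace_map_projHom (hA : IsSimpleCStar A) (hα : HasWeakTracialRokhlinProperty α)
    {τ : Stab (CrossedProduct α) → ℝ≥0∞} (hτ : IsLscExtendedTrace τ)
    {a : Stab (FixedPointAlgebra α)} (ha : 0 ≤ a) :
    τ (Stabilization.map (projHom α) a) = (Fintype.card G : ℝ≥0∞)⁻¹ * τ (stabIncl α a) := by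
  have hD := hτ.comp (Stabilization.cornerHom (CrossedProduct α))
  rw [Stabilization.trace_eq_tsum_diagEntry hτ (map_nonneg _ ha),
    Stabilization.trace_eq_tsum_diagEntry hτ (map_nonneg (stabIncl α) ha), ← ENNReal.tsum_mul_left]
  refine tsum_congr fun i => ?_
  have h1 : Stabilization.diagEntry i (stabIncl α a) =
      incl α (FixedPointAlgebra.incl α (Stabilization.diagEntry i a)) := by
    change Stabilization.diagEntry i (Stabilization.map (incl α)
      (Stabilization.map (FixedPointAlgebra.incl α) a)) = _
    rw [Stabilization.diagEntry_map, Stabilization.diagEntry_map]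
  rw [Stabilization.diagEntry_map, h1]
  set z := Stabilization.diagEntry i a with hz
  have hz0 : 0 ≤ z := Stabilization.diagEntry_nonneg i ha
  have hz' : 0 ≤ FixedPointAlgebra.incl α z := map_nonneg _ hz0
  rw [← trace_constMk hA hα hτ hz' (incl_fixed z), projHom_apply]
  have h2 := hD.map_smul' (t := (Fintype.card G : ℝ)⁻¹) (by positivity)
    (constMk_nonneg α hz' (incl_fixed z))
  rw [ENNReal.ofReal_inv_of_pos (by simp [Fintype.card_pos]), ENNReal.ofReal_natCast] at h2
  refine Eq.trans (congrArg (fun w => τ (Stabilization.corner w)) ?_) h2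
  change _ = (((Fintype.card G : ℝ)⁻¹ : ℝ) : ℂ) • constMk α (FixedPointAlgebra.incl α z)
  push_cast
  rfl

end CrossedProduct

/-! ### Roots and the dimension function -/

section Powers

variable {S : Type*} [NonUnitalCStarAlgebra S] [PartialOrder S] [StarOrderedRing S]
variable {S' : Type*} [NonUnitalCStarAlgebra S'] [PartialOrder S'] [StarOrderedRing S']

theorem nnrpow_eq_cfc_real {b : S} (hb : 0 ≤ b) (p : ℝ≥0) :
    CFC.nnrpow b p = cfcₙ (fun t : ℝ => t ^ (p : ℝ)) b :=
  CFC.nnrpow_eq_cfcₙ_real b p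

theorem NonUnitalStarAlgHom.map_nnrpow (φ : S' →⋆ₙₐ[ℂ] S) {a : S'} (ha : 0 ≤ a) (p : ℝ≥0) :
    φ (CFC.nnrpow a p) = CFC.nnrpow (φ a) p := by
  -- The exponent 0 gives the element 0 by convention, and only for p > 0 does t^p vanish at 0.
  rcases eq_or_ne p 0 with rfl | hp
  · rw [CFC.nnrpow_eq_pow, CFC.nnrpow_eq_pow, CFC.nnrpow_zero, CFC.nnrpow_zero, map_zero]
  · have hp' : 0 < (p : ℝ) := by exact_mod_cast pos_iff_ne_zero.2 hp
    have hφ := map_nonneg φ ha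
    rw [nnrpow_eq_cfc_real ha, nnrpow_eq_cfc_real hφ]
    exact φ.map_cfcₙ (fun t : ℝ => t ^ (p : ℝ)) a
      (Real.continuous_rpow_const hp'.le).continuousOn (Real.zero_rpow hp'.ne')
      (map_continuous φ) ha.isSelfAdjoint hφ.isSelfAdjoint

/-- After division by its norm M, b has increasing roots, so their traces converge to a supremum.
The scaling factors M^{1/n} tend to 1. -/
theorem IsLscExtendedTrace.exists_tendsto_nnrpow {τ : S → ℝ≥0∞} (hτ : IsLscExtendedTrace τ)
    {b : S} (hb : 0 ≤ b) :
    ∃ L, Tendsto (fun n : ℕ => τ (CFC.nnrpow b (n : ℝ≥0)⁻¹)) atTop (𝓝 L) := by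
  rcases eq_or_ne b 0 with rfl | hb0
  · refine ⟨0, ?_⟩
    simp [CFC.nnrpow_eq_pow, hτ.map_zero]
  have hM : 0 < ‖b‖ := norm_pos_iff.2 hb0
  set M := ‖b‖
  -- The sequence starts at exponent 1, since at n = 0 the inverse of n is 0.
  let p : ℕ → ℝ := fun n => ((n : ℝ) + 1)⁻¹
  have hp : ∀ n, 0 < p n := fun n => by positivity
  let w : ℕ → S := fun n => cfcₙ (fun t : ℝ => (t / M) ^ p n) b
  have hcont : ∀ n, Continuous fun t : ℝ => (t / M) ^ p n := fun n =>
    (Real.continuous_rpow_const (hp n).le).comp (by fun_prop)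
  have hspec : ∀ t ∈ quasispectrum ℝ b, 0 ≤ t / M ∧ t / M ≤ 1 := fun t ht => by
    have h0 := quasispectrum_nonneg_of_nonneg b hb t ht
    refine ⟨by positivity, ?_⟩
    have h1 := norm_apply_le_norm_cfcₙ (fun t : ℝ => t) b ht
    rw [cfcₙ_id' ℝ b, Real.norm_of_nonneg h0] at h1
    rwa [div_le_one hM]
  have hzero : ∀ n, (fun t : ℝ => (t / M) ^ p n) 0 = 0 := fun n => by
    beta_reduce
    rw [zero_div, Real.zero_rpow (hp n).ne']
  have hw0 : ∀ n, 0 ≤ w n := fun n => cfcₙ_nonneg fun t ht =>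
    Real.rpow_nonneg (hspec t ht).1 _
  have hmono : Monotone w := monotone_nat_of_le_succ fun n => by
    have h1 := (hcont n).continuousOn (s := quasispectrum ℝ b)
    have h2 := (hcont (n + 1)).continuousOn (s := quasispectrum ℝ b)
    have h3 := hzero n
    have h4 := hzero (n + 1)
    refine cfcₙ_mono (hf := h1) (hg := h2) (hf0 := h3) (hg0 := h4) fun t ht => ?_
    refine Real.rpow_le_rpow_of_exponent_ge' (hspec t ht).1 (hspec t ht).2 (hp _).le ?_
    refine inv_anti₀ (by positivity) ?_
    push_cast
    linarith
  have heq : ∀ n : ℕ, τ (CFC.nnrpow b ((n + 1 : ℕ) : ℝ≥0)⁻¹) =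
      ENNReal.ofReal (M ^ p n) * τ (w n) := fun n => by
    rw [← hτ.map_smul' (by positivity) (hw0 n), nnrpow_eq_cfc_real hb]
    have h1 := (hcont n).continuousOn (s := quasispectrum ℝ b)
    rw [← cfcₙ_smul (M ^ p n) _ b h1 (hzero n)]
    congr 1
    refine cfcₙ_congr fun t ht => ?_
    have h3 : (((n + 1 : ℕ) : ℝ≥0)⁻¹ : ℝ≥0) = p n := by
      push_cast
      rfl
    simp only [h3, smul_eq_mul]
    rw [← Real.mul_rpow hM.le (hspec t ht).1, mul_div_cancel₀ _ hM.ne']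
  have hlimM : Tendsto (fun n => ENNReal.ofReal (M ^ p n)) atTop (𝓝 1) := by
    have h1 : Tendsto p atTop (𝓝 0) := by
      simpa [p] using tendsto_one_div_add_atTop_nhds_zero_nat (𝕜 := ℝ)
    have h2 := ENNReal.tendsto_ofReal (((Real.continuous_const_rpow hM.ne').tendsto 0).comp h1)
    simpa using h2
  have hlimw : Tendsto (fun n => τ (w n)) atTop (𝓝 (⨆ n, τ (w n))) :=
    tendsto_atTop_iSup fun m n h => hτ.mono (hw0 m) (hmono h)
  refine ⟨1 * ⨆ n, τ (w n), (tendsto_add_atTop_iff_nat 1).1 ?_⟩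
  simp only [heq]
  exact ENNReal.Tendsto.mul hlimM (.inl one_ne_zero) hlimw (.inr ENNReal.one_ne_top)

end Powers

theorem mainTheorem6 {A : Type*} [NonUnitalCStarAlgebra A] [PartialOrder A] [StarOrderedRing A]
    (hsimple : IsSimpleCStar A) (hinf : ¬ FiniteDimensional ℂ A)
    {G : Type*} [Group G] [Fintype G] (α : G →* (A ≃⋆ₐ[ℂ] A))
    (hα : HasWeakTracialRokhlinProperty α)
    (a : Stab (FixedPointAlgebra α)) (ha_pos : 0 ≤ a) (ha_ne : a ≠ 0)
    (ha_ped : a ∈ pedersenIdeal (Stab (FixedPointAlgebra α)))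
    (τ : Stab (CrossedProduct α) → ℝ≥0∞) (hτ : IsLscExtendedTrace τ)
    (b c : Stab (CrossedProduct α)) (hb : b = CrossedProduct.stabIncl α a)
    (hc : c = mulMultiplier b (CrossedProduct.averagingProjection α)) :
    (0 ≤ b ∧ 0 ≤ c) ∧
    τ c = (Fintype.card G : ℝ≥0∞)⁻¹ * τ b ∧
    (Tendsto (fun n : ℕ => τ (CFC.nnrpow b (n : ℝ≥0)⁻¹)) atTop (𝓝 (dimensionFunction τ b)) ∧
      Tendsto (fun n : ℕ => τ (CFC.nnrpow c (n : ℝ≥0)⁻¹)) atTop (𝓝 (dimensionFunction τ c)) ∧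
      dimensionFunction τ c = (Fintype.card G : ℝ≥0∞)⁻¹ * dimensionFunction τ b) := by
  subst hb
  rw [CrossedProduct.mulMultiplier_stabIncl] at hc
  subst hc
  have hb0 := map_nonneg (CrossedProduct.stabIncl α) ha_pos
  have hc0 := map_nonneg (Stabilization.map (CrossedProduct.projHom α)) ha_pos
  refine ⟨⟨hb0, hc0⟩, CrossedProduct.trace_map_projHom hsimple hα hτ ha_pos, ?_⟩
  obtain ⟨L, hL⟩ := hτ.exists_tendsto_nnrpow hb0
  -- Roots commute with both homomorphisms, so statement 1 applies to the positive element a^{1/n};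
  -- n = 0 is covered, where both sides are 0.
  have heq : ∀ n : ℕ, τ (CFC.nnrpow (Stabilization.map (CrossedProduct.projHom α) a)
      (n : ℝ≥0)⁻¹) = (Fintype.card G : ℝ≥0∞)⁻¹ *
        τ (CFC.nnrpow (CrossedProduct.stabIncl α a) (n : ℝ≥0)⁻¹) := fun n => by
    rw [← NonUnitalStarAlgHom.map_nnrpow _ ha_pos, ← NonUnitalStarAlgHom.map_nnrpow _ ha_pos]
    exact CrossedProduct.trace_map_projHom hsimple hα hτ CFC.nnrpow_nonneg
  have hL' : Tendsto (fun n : ℕ => τ (CFC.nnrpow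
      (Stabilization.map (CrossedProduct.projHom α) a) (n : ℝ≥0)⁻¹)) atTop
      (𝓝 ((Fintype.card G : ℝ≥0∞)⁻¹ * L)) := by
    simp only [heq]
    exact ENNReal.Tendsto.const_mul hL (.inr (by simp))
  have hdb : dimensionFunction τ (CrossedProduct.stabIncl α a) = L := hL.limUnder_eq
  have hdc : dimensionFunction τ (Stabilization.map (CrossedProduct.projHom α) a) =
      (Fintype.card G : ℝ≥0∞)⁻¹ * L := hL'.limUnder_eq
  rw [hdb, hdc]
  exact ⟨hL, hL', rfl⟩
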